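/- Let $f,g:[0,\infty)\to\mathbb R$ with $f\in C^1([0,\infty))$ and $g\in C([0,\infty))$ (one-sided derivatives at $0$). A \emph{finite-energy vertical wave} with data $(f,g)$ is a function $\phi\in C^2([0,\infty)\times(0,\infty))$, $\phi=\phi(t,z)$, such that $$\partial_{tt}\phi-\frac1z\,\partial_z\bigl(z\,\partial_z\phi\bigr)=0\quad(t>0,\ z>0),\qquad \phi(0,z)=f(z),\quad \partial_t\phi(0,z)=g(z)\quad(z>0),$$ and $\partial_t\phi(t,\cdot),\ \partial_z\phi(t,\cdot)\in L^2((0,\infty),z\,dz)$ for every $t\ge0$. (These are the $x$-independent solutions of the wave equation on the Taub spacetime; no condition is imposed at the boundary $z=0$.) Let ${}_2F_1$ be the Gauss hypergeometric function, and write $F(w)={}_2F_1(\frac12,\frac12;1;w)$, $G(w)={}_2F_1(\frac32,\frac32;2;w)$ and $$w=\frac{t^2-(\zeta-z)^2}{4\zeta z}.$$ (1) Every finite-energy vertical wave $\phi$ with data $(f,g)$ is given by the following formulas, in which all integrals converge absolutely. If $0\le t\le z$ and $z>0$, $$\begin{aligned}\phi(t,z)={}&\tfrac12\sqrt{1-\tfrac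 tz}\,f(z-t)+\tfrac12\sqrt{1+\tfrac tz}\,f(z+t)\\&+\frac{t}{16z\sqrt z}\int_{z-t}^{z+t}\frac{f(\zeta)}{\sqrt\zeta}\,G(w)\,d\zeta+\frac1{2\sqrt z}\int_{z-t}^{z+t}g(\zeta)\sqrt\zeta\,F(w)\,d\zeta .\end{aligned}$$ If $0<z\le t$, $$\begin{aligned}\phi(t,z)={}&\int_0^{t-z}\bigl(f'(\zeta)+g(\zeta)\bigr)\frac{\zeta}{\sqrt{t^2-(\zeta-z)^2}}\,F\!\left(\tfrac1w\right)d\zeta\\&+(t-z)\int_0^{t-z}f(\zeta)\,\frac{1}{(t-z+\zeta)\sqrt{t^2-(\zeta-z)^2}}\,F\!\left(\tfrac1w\right)d\zeta\\&+z\int_0^{t-z}f(\zeta)\,\frac{\zeta\,(t-z-\zeta)}{(t-z+\zeta)\,\bigl(t^2-(\zeta-z)^2\bigr)^{3/2}}\,G\!\left(\tfrac1w\right)d\zeta\\&+\frac1{2\sqrt z}\int_{t-z}^{t+z}\Bigl(f'(\zeta)+g(\zeta)+\frac{f(\zeta)}{2\zeta}\Bigr)\sqrt\zeta\,F(w)\,d\zeta\\&+\frac1{32z\sqrt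 z}\int_{t-z}^{t+z}f(\zeta)\,\frac{z^2-(t-\zeta)^2}{\zeta\sqrt\zeta}\,G(w)\,d\zeta .\end{aligned}$$ In particular the solution is unique. Moreover, for every $t\ge0$ the boundary trace $\phi(t,0):=\lim_{z\to0^+}\phi(t,z)$ exists, and $$\phi(t,0)=f(0)+\int_0^t\frac{t\,f'(\zeta)+\zeta\,g(\zeta)}{\sqrt{t^2-\zeta^2}}\,d\zeta .$$ (2) If in addition $f\in C^3([0,\infty))$, $f'(0)=0$, $g\in C^2([0,\infty))$ and $f',g\in L^2((0,\infty),z\,dz)$, then a finite-energy vertical wave with data $(f,g)$ exists (and hence is given by these formulas). -/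

import Mathlib

open Real Set Filter Topology MeasureTheory

noncomputable section

/-- The measure `z dz` on the half-line `(0, ∞)`. -/
def halfLineMeasure : Measure ℝ :=
  (volume.restrict (Ioi (0 : ℝ))).withDensity (fun z => ENNReal.ofReal z)

/-- `φ t z` is a classical (twice continuously differentiable on `[0, ∞) × (0, ∞)`) solution of
`∂ₜₜ φ - z⁻¹ ∂_z (z ∂_z φ) = 0` with Cauchy data `φ = f`, `∂ₜ φ = g` at `t = 0`, such that
`∂ₜ φ(t, ·)` and `∂_z φ(t, ·)` belong to `L²((0, ∞), z dz)` for every `t ≥ 0`.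
Nothing is required at the boundary `z = 0`. -/
structure IsVerticalWave (f g : ℝ → ℝ) (φ : ℝ → ℝ → ℝ) : Prop where
  contDiffOn : ContDiffOn ℝ 2 (fun p : ℝ × ℝ => φ p.1 p.2) (Ici 0 ×ˢ Ioi 0)
  wave_eq : ∀ t > 0, ∀ z > 0,
    deriv (fun s => deriv (fun r => φ r z) s) t
      - deriv (fun y => y * deriv (fun x => φ t x) y) z / z = 0
  initial_value : ∀ z > 0, φ 0 z = f z
  initial_velocity : ∀ z > 0, derivWithin (fun s => φ s z) (Ici 0) 0 = g z
  memLp_time_deriv : ∀ t ≥ 0,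
    MemLp (fun z => derivWithin (fun s => φ s z) (Ici 0) t) 2 halfLineMeasure
  memLp_space_deriv : ∀ t ≥ 0,
    MemLp (fun z => deriv (fun y => φ t y) z) 2 halfLineMeasure

/-- The Gauss hypergeometric function `₂F₁(1/2, 1/2; 1; w)`. -/
def hypHalf (w : ℝ) : ℝ := ₂F₁ (1 / 2 : ℝ) (1 / 2 : ℝ) (1 : ℝ) w

/-- The Gauss hypergeometric function `₂F₁(3/2, 3/2; 2; w)`. -/
def hypThreeHalves (w : ℝ) : ℝ := ₂F₁ (3 / 2 : ℝ) (3 / 2 : ℝ) (2 : ℝ) w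

/-- First integrand for `t ≤ z`. -/
def earlyIntegrand₁ (f : ℝ → ℝ) (t z ζ : ℝ) : ℝ :=
  f ζ / √ζ * hypThreeHalves ((t ^ 2 - (ζ - z) ^ 2) / (4 * ζ * z))

/-- Second integrand for `t ≤ z`. -/
def earlyIntegrand₂ (g : ℝ → ℝ) (t z ζ : ℝ) : ℝ :=
  g ζ * √ζ * hypHalf ((t ^ 2 - (ζ - z) ^ 2) / (4 * ζ * z))

/-- First integrand for `z ≤ t`; the derivative of `f` is one-sided at `0`. -/
def lateIntegrand₁ (f g : ℝ → ℝ) (t z ζ : ℝ) : ℝ :=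
  (derivWithin f (Ici 0) ζ + g ζ) * (ζ / √(t ^ 2 - (ζ - z) ^ 2))
    * hypHalf (4 * ζ * z / (t ^ 2 - (ζ - z) ^ 2))

/-- Second integrand for `z ≤ t`. -/
def lateIntegrand₂ (f : ℝ → ℝ) (t z ζ : ℝ) : ℝ :=
  f ζ * (1 / ((t - z + ζ) * √(t ^ 2 - (ζ - z) ^ 2)))
    * hypHalf (4 * ζ * z / (t ^ 2 - (ζ - z) ^ 2))

/-- Third integrand for `z ≤ t`. -/
def lateIntegrand₃ (f : ℝ → ℝ) (t z ζ : ℝ) : ℝ :=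
  f ζ * (ζ * (t - z - ζ) / ((t - z + ζ) * (t ^ 2 - (ζ - z) ^ 2) ^ (3 / 2 : ℝ)))
    * hypThreeHalves (4 * ζ * z / (t ^ 2 - (ζ - z) ^ 2))

/-- Fourth integrand for `z ≤ t`. -/
def lateIntegrand₄ (f g : ℝ → ℝ) (t z ζ : ℝ) : ℝ :=
  (derivWithin f (Ici 0) ζ + g ζ + f ζ / (2 * ζ)) * √ζ
    * hypHalf ((t ^ 2 - (ζ - z) ^ 2) / (4 * ζ * z))

/-- Fifth integrand for `z ≤ t`. -/
def lateIntegrand₅ (f : ℝ → ℝ) (t z ζ : ℝ) : ℝ :=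
  f ζ * ((z ^ 2 - (t - ζ) ^ 2) / (ζ * √ζ))
    * hypThreeHalves ((t ^ 2 - (ζ - z) ^ 2) / (4 * ζ * z))

/-- Integrand of the boundary trace. -/
def traceIntegrand (f g : ℝ → ℝ) (t ζ : ℝ) : ℝ :=
  (t * derivWithin f (Ici 0) ζ + ζ * g ζ) / √(t ^ 2 - ζ ^ 2)

end

/-! ### Gauss hypergeometric functions -/

/-! A vertical wave is an axially symmetric wave in two space dimensions, with `z` the distance to
the axis. Superpositions of plane waves, `(1/π) ∫ P (t + z cos θ) dθ` over `θ ∈ [0, π]` (`axialMean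
0 P t z`), solve the equation when `P` is regular enough, and take the value `P t` on the axis. The
data `(f, g)` suggest the profile: its even part is an Abel transform of `f'` and its odd part one
of `g` (`waveProfile`). That this profile returns the data at `t = 0` is Archimedes' theorem on the
equidistribution of a coordinate on the sphere (`integral_integral_cos_mul_comp`). The proof then
has three independent pieces.

Representation (`IsVerticalWave.eq_axialMean`). The difference of a wave and the mean of its
putative profile has zero data; as the profile is only continuous, the difference is integrated in
time to obtain a classical first-order system (`IsRadialSystem`). Finite speed of propagation
confines it to `z ≤ t`. Its integral over a line at distance `y > 0` from the axis obeys the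
one-dimensional wave equation and, nothing coming in from infinity, is an outgoing wave `p (t - y)`.
Near the axis, finite energy forces the line integral to vary by `o(y)` (`exists_abs_chord_sub_le`);
this excludes a logarithmic source on the axis, whose line integrals have a corner at `y = 0`. So
`p' = 0`, all line integrals vanish, and by injectivity of the line transform on radial functions
(`eq_zero_of_chord_eq_zero`) the difference vanishes.

Evaluation. Substituting the Abel transforms into the mean and applying Fubini leaves, for each `ζ`,
the integral over `θ` of `1 / √((t + z cos θ)² - ζ²)`. This is a complete elliptic integral of a
quartic with roots `±ζ` and `t ± z` (`integral_inv_sqrt_quartic`), and its value changes form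
according to the order of the roots; this is why the two regimes and the moduli `w` and `1/w` occur.
The terms coming from the even part follow by differentiating such closed forms, which produces `G`
through `F' = G / 4`. The trace is the profile itself.

Existence (`isVerticalWave_axialMean`). Under the stronger hypotheses the profile is `C¹` with a
derivative that is `C¹` off the origin, so its mean is `C²` for `z > 0`. A weighted energy on a cone
decreases in time (`antitoneOn_coneEnergy`), which propagates square integrability from the data. -/

theorem hasFPowerSeriesOnBall_hypHalf :
    HasFPowerSeriesOnBall hypHalf (ordinaryHypergeometricSeries ℝ (1 / 2 : ℝ) (1 / 2) 1) 0 1 := by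
  have h : (ordinaryHypergeometricSeries ℝ (1 / 2 : ℝ) (1 / 2) 1).radius = 1 :=
    ordinaryHypergeometricSeries_radius_eq_one _ _ _ _ fun k =>
      ⟨by have : (0 : ℝ) ≤ k := k.cast_nonneg
          linarith, by have : (0 : ℝ) ≤ k := k.cast_nonneg
                       linarith, by have : (0 : ℝ) ≤ k := k.cast_nonneg
                                    linarith⟩
  have := (ordinaryHypergeometricSeries ℝ (1 / 2 : ℝ) (1 / 2) 1).hasFPowerSeriesOnBall (h ▸ one_pos)
  rwa [h] at this

theorem hasFPowerSeriesOnBall_hypThreeHalves :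
    HasFPowerSeriesOnBall hypThreeHalves
      (ordinaryHypergeometricSeries ℝ (3 / 2 : ℝ) (3 / 2) 2) 0 1 := by
  have h : (ordinaryHypergeometricSeries ℝ (3 / 2 : ℝ) (3 / 2) 2).radius = 1 :=
    ordinaryHypergeometricSeries_radius_eq_one _ _ _ _ fun k =>
      ⟨by have : (0 : ℝ) ≤ k := k.cast_nonneg
          linarith, by have : (0 : ℝ) ≤ k := k.cast_nonneg
                       linarith, by have : (0 : ℝ) ≤ k := k.cast_nonneg
                                    linarith⟩
  have := (ordinaryHypergeometricSeries ℝ (3 / 2 : ℝ) (3 / 2) 2).hasFPowerSeriesOnBall (h ▸ one_pos)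
  rwa [h] at this

theorem ordinaryHypergeometricCoefficient_succ {a b c : ℝ} (n : ℕ) :
    ordinaryHypergeometricCoefficient a b c (n + 1)
      = ordinaryHypergeometricCoefficient a b c n * ((a + n) * (b + n) / ((c + n) * (n + 1))) := by
  simp only [ordinaryHypergeometricCoefficient, ascPochhammer_succ_eval, Nat.factorial_succ,
    Nat.cast_mul, Nat.cast_succ, mul_inv, div_eq_mul_inv]
  ring

/-- This is `F' = G / 4` read on coefficients: passing from `n` to `n + 1` multiplies both sides by
`(n + 3/2)² / ((n + 2) (n + 1))`. -/
theorem succ_mul_hypergeometricCoefficient_half (n : ℕ) :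
    (n + 1) * ordinaryHypergeometricCoefficient (1 / 2 : ℝ) (1 / 2) 1 (n + 1)
      = ordinaryHypergeometricCoefficient (3 / 2 : ℝ) (3 / 2) 2 n / 4 := by
  induction n with
  | zero => simp [ordinaryHypergeometricCoefficient]; norm_num
  | succ n ih =>
    rw [ordinaryHypergeometricCoefficient_succ (n + 1),
      ordinaryHypergeometricCoefficient_succ (a := 3 / 2) n]
    have : ordinaryHypergeometricCoefficient (3 / 2 : ℝ) (3 / 2) 2 n
        = 4 * ((n + 1) * ordinaryHypergeometricCoefficient (1 / 2 : ℝ) (1 / 2) 1 (n + 1)) := by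
      rw [ih]; ring
    rw [this]
    push_cast
    field_simp
    ring

/-- Termwise differentiation of the power series. Every `hypThreeHalves` in the final formulas
enters by differentiating a closed form that contains `hypHalf`. -/
theorem hasDerivAt_hypHalf {x : ℝ} (hx : |x| < 1) :
    HasDerivAt hypHalf (hypThreeHalves x / 4) x := by
  have hmem : x ∈ Metric.eball (0 : ℝ) 1 := by
    simpa [← ofReal_norm, enorm_eq_nnnorm, ← NNReal.coe_lt_one] using! hx
  have hd : DifferentiableAt ℝ hypHalf x :=
    hasFPowerSeriesOnBall_hypHalf.differentiableOn.differentiableAt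
      (Metric.isOpen_eball.mem_nhds hmem)
  have h1 := (hasFPowerSeriesOnBall_hypHalf.fderiv).hasSum hmem
  have h2 := h1.mapL (ContinuousLinearMap.apply ℝ ℝ (1 : ℝ))
  have h3 := (hasFPowerSeriesOnBall_hypThreeHalves.hasSum hmem).div_const 4
  simp only [zero_add] at h2 h3
  have h4 : hypThreeHalves x / 4 = fderiv ℝ hypHalf x 1 := by
    suffices h : ∀ n, ContinuousLinearMap.apply ℝ ℝ (1 : ℝ)
        ((ordinaryHypergeometricSeries ℝ (1 / 2 : ℝ) (1 / 2) 1).derivSeries n fun _ => x)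
        = (ordinaryHypergeometricSeries ℝ (3 / 2 : ℝ) (3 / 2) 2 n fun _ => x) / 4 by
      simp only [h] at h2
      exact h3.unique h2
    intro n
    simp only [ContinuousLinearMap.apply_apply, FormalMultilinearSeries.apply_eq_pow_smul_coeff,
      FormalMultilinearSeries.derivSeries_coeff_one, smul_apply, smul_eq_mul, nsmul_eq_mul]
    rw [ordinaryHypergeometricSeries, ordinaryHypergeometricSeries,
      FormalMultilinearSeries.coeff_ofScalars, FormalMultilinearSeries.coeff_ofScalars]
    have := succ_mul_hypergeometricCoefficient_half n
    push_cast
    rw [this]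
    ring
  rw [h4]
  exact hd.hasDerivAt

theorem continuousOn_hypHalf : ContinuousOn hypHalf (Ioo (-1) 1) := fun _ hx =>
  (hasDerivAt_hypHalf (abs_lt.2 hx)).continuousAt.continuousWithinAt

theorem continuousOn_hypThreeHalves : ContinuousOn hypThreeHalves (Ioo (-1) 1) := by
  refine hasFPowerSeriesOnBall_hypThreeHalves.continuousOn.mono fun _ hx => ?_
  simpa [← ofReal_norm, enorm_eq_nnnorm, ← NNReal.coe_lt_one] using! abs_lt.2 hx

/-! ### The complete elliptic integral -/

/-- The generalized binomial coefficient is `(1/2)ₙ / n!`, the coefficient of `yⁿ` in `1 / √(1 -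
y)`; the ratio of two consecutive ones is read off the Pochhammer symbols. -/
theorem choose_half_add_succ (n : ℕ) :
    Ring.choose (1 / 2 + (n + 1 : ℕ) - 1 : ℝ) (n + 1)
      = Ring.choose (1 / 2 + n - 1 : ℝ) n * ((1 / 2 + n) / (n + 1)) := by
  have key : ∀ n : ℕ, (n.factorial : ℝ) * Ring.choose (1 / 2 + n - 1 : ℝ) n
      = (ascPochhammer ℝ n).eval (1 / 2) := by
    intro n
    have := Ring.factorial_nsmul_multichoose_eq_ascPochhammer (1 / 2 : ℝ) n
    rw [Polynomial.ascPochhammer_smeval_eq_eval] at this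
    rw [← this, nsmul_eq_mul, Ring.choose]
    congr 2
    ring
  have h1 := key (n + 1)
  rw [ascPochhammer_succ_eval, ← key n, Nat.factorial_succ] at h1
  have : (n.factorial : ℝ) ≠ 0 := by positivity
  push_cast at h1 ⊢
  field_simp at h1 ⊢
  linarith

theorem integral_sin_pow_half_period (n : ℕ) :
    ∫ x in 0..π / 2, sin x ^ n = 1 / 2 * ∫ x in 0..π, sin x ^ n := by
  rw [← EulerSine.integral_cos_pow_eq]
  have := intervalIntegral.integral_comp_sub_left (a := 0) (b := π / 2) (fun x => sin x ^ n) (π / 2)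
  simpa [sin_pi_div_two_sub] using this.symm

/-- The Wallis integral supplies a second factor `(1/2)ₙ / n!`, so the product is the `n`-th
coefficient of `F` up to `π / 2`. -/
theorem choose_half_mul_wallis (n : ℕ) :
    Ring.choose (1 / 2 + n - 1 : ℝ) n * ∫ x in 0..π / 2, sin x ^ (2 * n)
      = π / 2 * ordinaryHypergeometricCoefficient (1 / 2 : ℝ) (1 / 2) 1 n := by
  rw [integral_sin_pow_half_period, integral_sin_pow_even]
  induction n with
  | zero => simp [ordinaryHypergeometricCoefficient, inv_mul_eq_div]
  | succ n ih =>
    rw [choose_half_add_succ, Finset.prod_range_succ, ordinaryHypergeometricCoefficient_succ,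
      ← mul_assoc (π / 2), ← ih]
    field_simp
    ring

theorem integral_inv_sqrt_one_sub_mul_sin_sq {x : ℝ} (h0 : 0 ≤ x) (h1 : x < 1) :
    ∫ α in 0..π / 2, 1 / √(1 - x * sin α ^ 2) = π / 2 * hypHalf x := by
  have hmem : ∀ y : ℝ, |y| < 1 → y ∈ Metric.eball (0 : ℝ) 1 := fun y hy => by
    simpa [← ofReal_norm, enorm_eq_nnnorm, ← NNReal.coe_lt_one] using! hy
  have hx : |x| < 1 := by rwa [abs_of_nonneg h0]
  have hF := (hasFPowerSeriesOnBall_hypHalf.hasSum (hmem x hx)).mul_left (π / 2)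
  have hser : ∀ y : ℝ, |y| < 1 → HasSum (fun n : ℕ => Ring.choose (1 / 2 + n - 1 : ℝ) n * y ^ n)
      (1 / √(1 - y)) := by
    intro y hy
    have := (one_div_one_sub_rpow_hasFPowerSeriesOnBall_zero (1 / 2)).hasSum (hmem y hy)
    simp only [zero_add, FormalMultilinearSeries.apply_eq_pow_smul_coeff,
      FormalMultilinearSeries.coeff_ofScalars, smul_eq_mul] at this
    rw [sqrt_eq_rpow]
    simpa only [mul_comm] using this
  have hsin : ∀ α : ℝ, |x * sin α ^ 2| ≤ x := fun α => by
    rw [abs_mul, abs_of_nonneg h0, abs_of_nonneg (sq_nonneg _)]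
    exact mul_le_of_le_one_right h0 (sin_sq_le_one α)
  -- The binomial series is integrated term by term; each term is dominated by its absolute value at
  -- `sin α = 1`, and these sum because `x < 1`.
  have hI := intervalIntegral.hasSum_integral_of_dominated_convergence (a := 0) (b := π / 2)
    (μ := volume) (F := fun (n : ℕ) α => Ring.choose (1 / 2 + n - 1 : ℝ) n * (x * sin α ^ 2) ^ n)
    (f := fun α => 1 / √(1 - x * sin α ^ 2))
    (fun n _ => |Ring.choose (1 / 2 + n - 1 : ℝ) n * x ^ n|)
    (fun n => Continuous.aestronglyMeasurable (by fun_prop))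
    (fun n => .of_forall fun α _ => by
      rw [norm_eq_abs, abs_mul, abs_mul, abs_pow, abs_pow, abs_of_nonneg h0]
      gcongr
      exact hsin α)
    (.of_forall fun α _ => (hser x hx).summable.abs)
    intervalIntegrable_const
    (.of_forall fun α _ => hser _ ((hsin α).trans_lt h1))
  refine hI.unique ?_
  simp only [zero_add] at hF
  suffices h : ∀ n : ℕ, ∫ α in 0..π / 2,
      Ring.choose (1 / 2 + n - 1 : ℝ) n * (x * sin α ^ 2) ^ n = π / 2 *
        (ordinaryHypergeometricSeries ℝ (1 / 2 : ℝ) (1 / 2) 1 n fun _ => x) by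
    simpa only [h] using hF
  intro n
  rw [ordinaryHypergeometricSeries, FormalMultilinearSeries.apply_eq_pow_smul_coeff,
    FormalMultilinearSeries.coeff_ofScalars, smul_eq_mul, mul_left_comm, ← choose_half_mul_wallis,
    mul_left_comm, ← intervalIntegral.integral_const_mul, ← intervalIntegral.integral_const_mul]
  congr 1 with α
  ring

/-! ### Archimedes' theorem on an octant of the sphere -/

theorem continuous_integral_comp_cos_mul_sin {H : ℝ → ℝ} (hH : Continuous H) :
    Continuous fun θ : ℝ => ∫ α in 0..π / 2, H (cos θ * sin α) * cos θ :=
  intervalIntegral.continuous_parametric_intervalIntegral_of_continuous' (by fun_prop) _ _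

/-- For the Wallis integrals `Wₙ`, the recursion `(n + 2) Wₙ₊₂ = (n + 1) Wₙ` makes `(n + 1) Wₙ₊₁ Wₙ`
independent of `n`. -/
theorem integral_cos_pow_mul_integral_sin_pow (n : ℕ) :
    (∫ θ in 0..π / 2, cos θ ^ (n + 1)) * ∫ α in 0..π / 2, sin α ^ n = π / 2 * (1 / (n + 1)) := by
  rw [EulerSine.integral_cos_pow_eq, ← integral_sin_pow_half_period]
  induction n with
  | zero => simp
  | succ n ih =>
    rw [show n + 1 + 1 = n + 2 from rfl, integral_sin_pow]
    simp only [sin_zero, cos_zero, mul_one, cos_pi_div_two, mul_zero, sub_zero]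
    rw [zero_pow (by positivity), zero_div, zero_add, mul_assoc,
      mul_comm (∫ x in 0..π / 2, sin x ^ n), ih]
    push_cast
    field_simp
    ring

/-- With `θ` the latitude and `α` the longitude, `cos θ dα dθ` is the area element of the unit
sphere and `cos θ sin α` a Cartesian coordinate, which Archimedes' theorem says is uniformly
distributed; `π / 2` is the area of the octant. On monomials the identity is a product of Wallis
integrals, and Weierstrass approximation gives the rest. It is the tool that inverts the Abel
transforms of the data. -/
theorem integral_integral_cos_mul_comp {H : ℝ → ℝ} (hH : Continuous H) :
    ∫ θ in 0..π / 2, ∫ α in 0..π / 2, H (cos θ * sin α) * cos θ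
      = π / 2 * ∫ x in 0..1, H x := by
  have hπ : 0 ≤ π / 2 := by positivity
  have hpoly : ∀ p : Polynomial ℝ, ∫ θ in 0..π / 2, ∫ α in 0..π / 2,
      p.eval (cos θ * sin α) * cos θ = π / 2 * ∫ x in 0..1, p.eval x := by
    intro p
    induction p using Polynomial.induction_on' with
    | add p q hp hq =>
      have hi : ∀ r : Polynomial ℝ, ∀ θ : ℝ, IntervalIntegrable
          (fun α => r.eval (cos θ * sin α) * cos θ) volume 0 (π / 2) := fun r θ =>
        Continuous.intervalIntegrable (by have := r.continuous; fun_prop) _ _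
      have ho : ∀ r : Polynomial ℝ, IntervalIntegrable
          (fun θ => ∫ α in 0..π / 2, r.eval (cos θ * sin α) * cos θ) volume 0 (π / 2) := fun r =>
        (continuous_integral_comp_cos_mul_sin r.continuous).intervalIntegrable _ _
      simp only [Polynomial.eval_add, add_mul]
      rw [intervalIntegral.integral_add (p.continuous.intervalIntegrable _ _)
        (q.continuous.intervalIntegrable _ _), mul_add, ← hp, ← hq,
        ← intervalIntegral.integral_add (ho p) (ho q)]
      congr 1 with θ
      exact intervalIntegral.integral_add (hi p θ) (hi q θ)
    | monomial n c =>
      have : ∀ θ α : ℝ, (Polynomial.monomial n c).eval (cos θ * sin α) * cos θ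
          = c * cos θ ^ (n + 1) * sin α ^ n := fun θ α => by
        rw [Polynomial.eval_monomial, mul_pow, pow_succ]; ring
      simp only [this]
      simp only [intervalIntegral.integral_const_mul, intervalIntegral.integral_mul_const,
        Polynomial.eval_monomial]
      rw [mul_assoc, integral_cos_pow_mul_integral_sin_pow, integral_pow]
      simp
      ring
  -- A polynomial within `ε` of `H` costs at most `ε (π/2)²` in the double integral and `ε π/2` in
  -- the single one.
  have hbound : ∀ ε > 0, |(∫ θ in 0..π / 2, ∫ α in 0..π / 2, H (cos θ * sin α) * cos θ)
      - π / 2 * ∫ x in 0..1, H x| ≤ ε * ((π / 2) * (π / 2) + π / 2) := by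
    intro ε hε
    obtain ⟨p, hp⟩ := exists_polynomial_near_of_continuousOn 0 1 H hH.continuousOn ε hε
    have hq : Continuous fun x => H x - p.eval x := hH.sub p.continuous
    have e1 : (∫ θ in 0..π / 2, ∫ α in 0..π / 2, H (cos θ * sin α) * cos θ)
        - ∫ θ in 0..π / 2, ∫ α in 0..π / 2, p.eval (cos θ * sin α) * cos θ
        = ∫ θ in 0..π / 2, ∫ α in 0..π / 2,
          (H (cos θ * sin α) - p.eval (cos θ * sin α)) * cos θ := by
      rw [← intervalIntegral.integral_sub
        ((continuous_integral_comp_cos_mul_sin hH).intervalIntegrable _ _)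
        ((continuous_integral_comp_cos_mul_sin p.continuous).intervalIntegrable _ _)]
      congr 1 with θ
      rw [← intervalIntegral.integral_sub (Continuous.intervalIntegrable (by fun_prop) _ _)
        (Continuous.intervalIntegrable (by have := p.continuous; fun_prop) _ _)]
      simp only [sub_mul]
    have e2 : (∫ x in 0..1, H x) - ∫ x in 0..1, p.eval x = ∫ x in 0..1, (H x - p.eval x) :=
      (intervalIntegral.integral_sub (hH.intervalIntegrable _ _)
        (p.continuous.intervalIntegrable _ _)).symm
    have key : (∫ θ in 0..π / 2, ∫ α in 0..π / 2, H (cos θ * sin α) * cos θ)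
      - π / 2 * ∫ x in 0..1, H x = (∫ θ in 0..π / 2, ∫ α in 0..π / 2,
          (H (cos θ * sin α) - p.eval (cos θ * sin α)) * cos θ)
          - π / 2 * ∫ x in 0..1, (H x - p.eval x) := by
      rw [← e1, ← e2, hpoly p]; ring
    have b1 : |∫ x in 0..1, (H x - p.eval x)| ≤ ε := by
      have := intervalIntegral.norm_integral_le_of_norm_le_const (a := 0) (b := 1) (C := ε)
        (f := fun x => H x - p.eval x) fun x hx => by
          rw [uIoc_of_le zero_le_one] at hx
          rw [norm_eq_abs, abs_sub_comm]
          exact (hp x ⟨hx.1.le, hx.2⟩).le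
      simpa using this
    have b2 : |∫ θ in 0..π / 2, ∫ α in 0..π / 2,
          (H (cos θ * sin α) - p.eval (cos θ * sin α)) * cos θ| ≤ ε * (π / 2) * (π / 2) := by
      have := intervalIntegral.norm_integral_le_of_norm_le_const (a := 0) (b := π / 2)
        (C := ε * (π / 2)) (f := fun θ => ∫ α in 0..π / 2,
          (H (cos θ * sin α) - p.eval (cos θ * sin α)) * cos θ) fun θ hθ => by
          rw [uIoc_of_le hπ] at hθ
          have := intervalIntegral.norm_integral_le_of_norm_le_const (a := 0) (b := π / 2)
            (C := ε) (f := fun α =>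
            (H (cos θ * sin α) - p.eval (cos θ * sin α)) * cos θ) fun α hα => by
              rw [uIoc_of_le hπ] at hα
              have c0 := cos_nonneg_of_neg_pi_div_two_le_of_le (by linarith [hθ.1]) hθ.2
              have s0 := sin_nonneg_of_nonneg_of_le_pi hα.1.le (by linarith [hα.2])
              rw [norm_eq_abs, abs_mul, abs_sub_comm, abs_of_nonneg c0]
              calc _ ≤ ε * 1 := mul_le_mul (hp _ ⟨mul_nonneg c0 s0,
                    mul_le_one₀ (cos_le_one _) s0 (sin_le_one _)⟩).le (cos_le_one _) c0 hε.le
                _ = ε := mul_one ε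
          simpa [abs_of_nonneg hπ] using this
      simpa [abs_of_nonneg hπ] using this
    rw [key]
    refine (abs_sub _ _).trans ?_
    rw [abs_mul, abs_of_nonneg hπ]
    nlinarith
  have hC : 0 < π / 2 * (π / 2) + π / 2 := by positivity
  rw [← sub_eq_zero, ← abs_nonpos_iff]
  refine le_of_forall_pos_le_add fun ε hε => ?_
  have := hbound (ε / (π / 2 * (π / 2) + π / 2)) (by positivity)
  rwa [div_mul_cancel₀ _ hC.ne', ← zero_add ε] at this

/-! ### Angular means of functions of `t + z cos θ` -/

/-- The mean over `θ ∈ [0, π]` of `cos θ ^ j * P (t + z cos θ)`. -/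
noncomputable def axialMean (j : ℕ) (P : ℝ → ℝ) (t z : ℝ) : ℝ :=
  1 / π * ∫ θ in 0..π, cos θ ^ j * P (t + z * cos θ)

/-- `R` is a primitive of `S`, where `S` is locally bounded and continuous except possibly at `0`. -/
structure IsPiecewisePrimitive (R S : ℝ → ℝ) : Prop where
  continuous : Continuous R
  measurable : Measurable S
  continuousAt : ∀ s ≠ 0, ContinuousAt S s
  hasDerivAt : ∀ s ≠ 0, HasDerivAt R (S s) s
  bounded : ∀ M : ℝ, ∃ C : ℝ, ∀ s, |s| ≤ M → |S s| ≤ C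

theorem IsPiecewisePrimitive.of_continuous {R S : ℝ → ℝ} (hS : Continuous S)
    (h : ∀ s, HasDerivAt R (S s) s) : IsPiecewisePrimitive R S where
  continuous := continuous_iff_continuousAt.2 fun s => (h s).continuousAt
  measurable := hS.measurable
  continuousAt := fun _ _ => hS.continuousAt
  hasDerivAt := fun s _ => h s
  bounded := fun M => by
    obtain ⟨C, hC⟩ := (isCompact_Icc (a := -M) (b := M)).exists_bound_of_continuousOn
      hS.continuousOn
    exact ⟨C, fun s hs => hC s (abs_le.1 hs)⟩

theorem IsPiecewisePrimitive.intervalIntegrable {R S : ℝ → ℝ} (h : IsPiecewisePrimitive R S)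
    (a b : ℝ) : IntervalIntegrable S volume a b := by
  obtain ⟨C, hC⟩ := h.bounded (max |a| |b|)
  refine (intervalIntegrable_const (c := C)).mono_fun h.measurable.aestronglyMeasurable ?_
  refine (ae_restrict_iff' measurableSet_uIoc).2 (.of_forall fun x hx => ?_)
  exact (hC x (abs_le_max_abs_abs hx.1.le hx.2 |>.trans (by
    rcases le_total a b with h | h <;> simp [h, max_comm]))).trans (le_abs_self C)

/-- The fundamental theorem of calculus tolerates the exceptional point `0` because `R` is
continuous there. The resulting local Lipschitz bound replaces a derivative bound when
differentiating under the integral sign. -/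
theorem IsPiecewisePrimitive.abs_sub_le {R S : ℝ → ℝ} (h : IsPiecewisePrimitive R S) {M C : ℝ}
    (hC : ∀ s, |s| ≤ M → |S s| ≤ C) {a b : ℝ} (ha : |a| ≤ M) (hb : |b| ≤ M) :
    |R b - R a| ≤ C * |b - a| := by
  wlog hab : a ≤ b generalizing a b
  · rw [abs_sub_comm, abs_sub_comm b]
    exact this hb ha (le_of_not_ge hab)
  rw [← integral_eq_of_hasDerivAt_off_countable_of_le R S hab (countable_singleton 0)
    h.continuous.continuousOn (fun x hx => h.hasDerivAt x hx.2) (h.intervalIntegrable a b),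
    ← Real.norm_eq_abs (∫ x in a..b, S x)]
  refine intervalIntegral.norm_integral_le_of_norm_le_const fun x hx => ?_
  refine hC x ?_
  rw [uIoc_of_le hab] at hx
  exact abs_le.2 ⟨by linarith [(abs_le.1 ha).1, hx.1], by linarith [(abs_le.1 hb).2, hx.2]⟩

/-- Since `cos` is injective on `[0, π]`, at most one angle hits `c`. A jump at the origin is
therefore invisible to angular means with `z > 0`. -/
theorem ae_add_mul_cos_ne {t z : ℝ} (c : ℝ) (hz : 0 < z) :
    ∀ᵐ θ : ℝ, θ ∈ uIoc 0 π → t + z * cos θ ≠ c := by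
  have hs : {θ | θ ∈ uIoc 0 π ∧ t + z * cos θ = c}.Subsingleton := by
    rintro a ⟨ha, ha'⟩ b ⟨hb, hb'⟩
    rw [uIoc_of_le pi_pos.le] at ha hb
    refine injOn_cos ⟨ha.1.le, ha.2⟩ ⟨hb.1.le, hb.2⟩ ?_
    have : z * (cos a - cos b) = 0 := by linarith
    rcases mul_eq_zero.1 this with h | h <;> linarith
  refine (measure_eq_zero_iff_ae_notMem.1 (hs.measure_zero volume)).mono fun θ hθ hmem h => ?_
  exact hθ ⟨hmem, h⟩

theorem continuous_axialMean {P : ℝ → ℝ} (hP : Continuous P) (j : ℕ) :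
    Continuous fun p : ℝ × ℝ => axialMean j P p.1 p.2 :=
  continuous_const.mul
    (intervalIntegral.continuous_parametric_intervalIntegral_of_continuous' (by fun_prop) _ _)

theorem abs_add_mul_cos_le {t z M : ℝ} (h : |t| + |z| ≤ M) (θ : ℝ) : |t + z * cos θ| ≤ M := by
  refine (abs_add_le _ _).trans (le_trans ?_ h)
  rw [abs_mul]
  have := mul_le_of_le_one_right (abs_nonneg z) (abs_cos_le_one θ)
  linarith

theorem IsPiecewisePrimitive.continuousAt_axialMean {R S : ℝ → ℝ} (h : IsPiecewisePrimitive R S)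
    (j : ℕ) (t : ℝ) {z : ℝ} (hz : 0 < z) :
    ContinuousAt (fun p : ℝ × ℝ => axialMean j S p.1 p.2) (t, z) := by
  refine ContinuousAt.mul continuousAt_const ?_
  obtain ⟨C, hC⟩ := h.bounded (|t| + |z| + 1)
  refine intervalIntegral.continuousAt_of_dominated_interval (bound := fun _ => C) ?_ ?_
    intervalIntegrable_const ?_
  · refine .of_forall fun p => ?_
    exact (Measurable.mul (by fun_prop) (h.measurable.comp (by fun_prop))).aestronglyMeasurable
  · have : ∀ᶠ p : ℝ × ℝ in 𝓝 (t, z), |p.1| + |p.2| < |t| + |z| + 1 :=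
      ContinuousAt.eventually_lt (by fun_prop) continuousAt_const (by simp)
    filter_upwards [this] with p hp
    refine .of_forall fun θ _ => ?_
    rw [norm_mul, norm_pow]
    exact (mul_le_of_le_one_left (norm_nonneg _)
      (pow_le_one₀ (norm_nonneg _) (abs_cos_le_one θ))).trans (hC _ (abs_add_mul_cos_le hp.le θ))
  · filter_upwards [ae_add_mul_cos_ne (t := t) 0 hz] with θ hθ hmem
    refine ContinuousAt.mul continuousAt_const ?_
    exact ContinuousAt.comp (f := fun p : ℝ × ℝ => p.1 + p.2 * cos θ)
      (h.continuousAt _ (hθ hmem)) (by fun_prop)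

/-- The direction `(p, q)` treats the time and space derivatives at once. The Lipschitz version of
differentiation under the integral is needed because `R` is differentiable along the direction only
for almost every angle. -/
theorem IsPiecewisePrimitive.hasDerivAt_axialMean_comp {R S : ℝ → ℝ}
    (h : IsPiecewisePrimitive R S) (j : ℕ) (t : ℝ) {z : ℝ} (hz : 0 < z) (p q : ℝ) :
    HasDerivAt (fun x => 1 / π * ∫ θ in 0..π, cos θ ^ j * R (t + p * x + (z + q * x) * cos θ))
      (1 / π * ∫ θ in 0..π, cos θ ^ j * (S (t + z * cos θ) * (p + q * cos θ))) 0 := by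
  refine HasDerivAt.const_mul _ ?_
  obtain ⟨C, hC⟩ := h.bounded (|t| + |z| + |p| + |q|)
  have hC0 : 0 ≤ C := (abs_nonneg _).trans (hC 0 (by simp; positivity))
  refine (intervalIntegral.hasDerivAt_integral_of_dominated_loc_of_lip
    (bound := fun _ => C * (|p| + |q|)) (s := Metric.ball 0 1)
    (Metric.ball_mem_nhds 0 one_pos) ?_ ?_ ?_ ?_ intervalIntegrable_const ?_).2
  · have := h.continuous
    exact .of_forall fun x => Continuous.aestronglyMeasurable (by fun_prop)
  · have := h.continuous
    exact Continuous.intervalIntegrable (by fun_prop) _ _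
  · have := h.measurable
    exact (Measurable.mul (by fun_prop) (Measurable.mul (this.comp (by fun_prop))
      (by fun_prop))).aestronglyMeasurable
  · refine .of_forall fun θ _ => LipschitzOnWith.of_dist_le_mul fun x hx y hy => ?_
    have hb : ∀ x ∈ Metric.ball (0 : ℝ) 1, |t + p * x + (z + q * x) * cos θ|
        ≤ |t| + |z| + |p| + |q| := fun x hx => by
      refine abs_add_mul_cos_le ?_ θ
      have hx1 : |x| ≤ 1 := by simpa using (mem_ball_zero_iff.1 hx).le
      have h1 := (abs_add_le t (p * x))
      have h2 := (abs_add_le z (q * x))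
      rw [abs_mul] at h1 h2
      have h3 := mul_le_of_le_one_right (abs_nonneg p) hx1
      have h4 := mul_le_of_le_one_right (abs_nonneg q) hx1
      linarith
    rw [Real.dist_eq, Real.dist_eq, ← mul_sub, abs_mul, abs_pow, coe_nnabs,
      abs_of_nonneg (a := C * (|p| + |q|)) (by positivity)]
    refine (mul_le_of_le_one_left (abs_nonneg _)
      (pow_le_one₀ (abs_nonneg _) (abs_cos_le_one θ))).trans ?_
    refine (h.abs_sub_le hC (hb y hy) (hb x hx)).trans ?_
    rw [show t + p * x + (z + q * x) * cos θ - (t + p * y + (z + q * y) * cos θ)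
      = (p + q * cos θ) * (x - y) by ring, abs_mul, mul_assoc]
    gcongr
    refine (abs_add_le _ _).trans ?_
    rw [abs_mul]
    have := mul_le_of_le_one_right (abs_nonneg q) (abs_cos_le_one θ)
    linarith
  · filter_upwards [ae_add_mul_cos_ne (t := t) 0 hz] with θ hθ hmem
    refine HasDerivAt.const_mul _ ?_
    refine HasDerivAt.comp_of_eq (h₂ := R) (h := fun x => t + p * x + (z + q * x) * cos θ) 0
      (h.hasDerivAt _ (hθ hmem)) ?_ (by simp)
    have h1 := ((hasDerivAt_id (0 : ℝ)).const_mul p).const_add t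
    have h2 := (((hasDerivAt_id (0 : ℝ)).const_mul q).const_add z).mul_const (cos θ)
    simpa using! h1.add h2

theorem IsPiecewisePrimitive.hasDerivAt_axialMean_time {R S : ℝ → ℝ}
    (h : IsPiecewisePrimitive R S) (j : ℕ) (t : ℝ) {z : ℝ} (hz : 0 < z) :
    HasDerivAt (fun t => axialMean j R t z) (axialMean j S t z) t := by
  have := h.hasDerivAt_axialMean_comp j t hz 1 0
  have := HasDerivAt.comp_sub_const t t (f := _) (by rw [sub_self]; exact this)
  simpa [axialMean] using this

theorem IsPiecewisePrimitive.hasDerivAt_axialMean_space {R S : ℝ → ℝ}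
    (h : IsPiecewisePrimitive R S) (j : ℕ) (t : ℝ) {z : ℝ} (hz : 0 < z) :
    HasDerivAt (fun z => axialMean j R t z) (axialMean (j + 1) S t z) z := by
  have := h.hasDerivAt_axialMean_comp j t hz 0 1
  have := HasDerivAt.comp_sub_const z z (f := _) (by rw [sub_self]; exact this)
  simpa [axialMean, pow_succ, mul_assoc, mul_comm (cos _)] using this

theorem continuous_axialMean_right {P : ℝ → ℝ} (hP : Continuous P) (j : ℕ) (t : ℝ) :
    Continuous fun z => axialMean j P t z :=
  (continuous_axialMean hP j).comp (by fun_prop : Continuous fun z : ℝ => (t, z))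

theorem IsPiecewisePrimitive.intervalIntegrable_axial {R S : ℝ → ℝ}
    (h : IsPiecewisePrimitive R S) (t z : ℝ) {k : ℝ → ℝ} (hk : Continuous k) :
    IntervalIntegrable (fun θ => k θ * S (t + z * cos θ)) volume 0 π := by
  obtain ⟨C, hC⟩ := h.bounded (|t| + |z|)
  obtain ⟨D, hD⟩ := (isCompact_Icc (a := (0 : ℝ)) (b := π)).exists_bound_of_continuousOn
    hk.continuousOn
  refine (intervalIntegrable_const (c := D * C)).mono_fun
    (hk.measurable.mul (h.measurable.comp (by fun_prop))).aestronglyMeasurable ?_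
  refine (ae_restrict_iff' measurableSet_uIoc).2 (.of_forall fun θ hθ => ?_)
  rw [uIoc_of_le pi_pos.le] at hθ
  refine le_trans ?_ (le_abs_self _)
  simp only [norm_mul]
  have := hD θ ⟨hθ.1.le, hθ.2⟩
  exact mul_le_mul this (hC _ (abs_add_mul_cos_le le_rfl θ)) (norm_nonneg _)
    ((norm_nonneg _).trans this)

/-- Integration of `d/dθ (R (t + z cos θ) sin θ)` over `[0, π]`. If `R` is in turn the derivative of
`P`, the three means are `φ_zz`, `φ_tt` and `φ_z` for `φ` the mean of `P`, so this is the wave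
equation. -/
theorem IsPiecewisePrimitive.axialMean_add_two {R S : ℝ → ℝ}
    (h : IsPiecewisePrimitive R S) (t : ℝ) {z : ℝ} (hz : 0 < z) :
    axialMean 2 S t z = axialMean 0 S t z - axialMean 1 R t z / z := by
  have hR := h.continuous
  have hab := integral_eq_of_hasDerivAt_off_countable_of_le
    (fun θ => R (t + z * cos θ) * sin θ)
    (fun θ => -z * (sin θ ^ 2 * S (t + z * cos θ)) + cos θ * R (t + z * cos θ)) pi_pos.le
    (s := {θ | θ ∈ Ioo 0 π ∧ t + z * cos θ = 0}) ?_ (by fun_prop) ?_ ?_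
  · have i1 : IntervalIntegrable (fun θ => -z * (sin θ ^ 2 * S (t + z * cos θ))) volume 0 π :=
      (h.intervalIntegrable_axial t z (k := fun θ => sin θ ^ 2) (by fun_prop)).const_mul _
    have i2 : IntervalIntegrable (fun θ => cos θ * R (t + z * cos θ)) volume 0 π :=
      Continuous.intervalIntegrable (by fun_prop) _ _
    rw [intervalIntegral.integral_add i1 i2, intervalIntegral.integral_const_mul] at hab
    simp only [sin_pi, sin_zero, mul_zero, sub_zero] at hab
    have i3 := h.intervalIntegrable_axial t z (k := fun _ => 1) (by fun_prop)
    have i4 := h.intervalIntegrable_axial t z (k := fun θ => cos θ ^ 2) (by fun_prop)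
    have hs : ∫ θ in 0..π, sin θ ^ 2 * S (t + z * cos θ)
        = (∫ θ in 0..π, 1 * S (t + z * cos θ)) - ∫ θ in 0..π, cos θ ^ 2 * S (t + z * cos θ) := by
      rw [← intervalIntegral.integral_sub i3 i4]
      congr 1 with θ
      rw [sin_sq]; ring
    rw [hs] at hab
    simp only [axialMean, pow_zero, pow_one]
    have hz' := hz.ne'
    have : ∫ θ in 0..π, cos θ ^ 2 * S (t + z * cos θ) = (∫ θ in 0..π, 1 * S (t + z * cos θ))
        - (∫ θ in 0..π, cos θ * R (t + z * cos θ)) / z := by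
      rw [eq_sub_iff_add_eq, ← eq_sub_iff_add_eq', div_eq_iff hz']
      linarith
    rw [this]
    ring
  · refine Subsingleton.countable ?_
    rintro a ⟨ha, ha'⟩ b ⟨hb, hb'⟩
    refine injOn_cos ⟨ha.1.le, ha.2.le⟩ ⟨hb.1.le, hb.2.le⟩ ?_
    have : z * (cos a - cos b) = 0 := by linarith
    rcases mul_eq_zero.1 this with h | h <;> linarith
  · intro θ hθ
    have hne : t + z * cos θ ≠ 0 := fun h0 => hθ.2 ⟨hθ.1, h0⟩
    have h1 : HasDerivAt (fun θ => t + z * cos θ) (z * -sin θ) θ :=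
      ((hasDerivAt_cos θ).const_mul z).const_add t
    have h2 := ((h.hasDerivAt _ hne).comp θ h1).mul (hasDerivAt_sin θ)
    refine h2.congr_deriv ?_
    simp only [Function.comp_apply]
    ring
  · exact ((h.intervalIntegrable_axial t z (k := fun θ => sin θ ^ 2) (by fun_prop)).const_mul
      (-z)).add (Continuous.intervalIntegrable (by fun_prop) _ _)

/-! ### Abel transforms of the data -/

/-- The odd Abel transform `s ↦ ∫ ζ in 0..s, h ζ * ζ / √(s ^ 2 - ζ ^ 2)`. -/
noncomputable def abelOdd (h : ℝ → ℝ) (s : ℝ) : ℝ :=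
  s * ∫ α in 0..π / 2, sin α * h (|s| * sin α)

/-- The even Abel transform `s ↦ c + ∫ ζ in 0..|s|, |s| * k ζ / √(s ^ 2 - ζ ^ 2)`. -/
noncomputable def abelEven (c : ℝ) (k : ℝ → ℝ) (s : ℝ) : ℝ :=
  c + |s| * ∫ α in 0..π / 2, k (|s| * sin α)

/-- The values on the axis `z = 0` of the wave with initial value `c + ∫ k` and initial
velocity `g`. -/
noncomputable def axisProfile (c : ℝ) (k g : ℝ → ℝ) (s : ℝ) : ℝ :=
  abelEven c k s + abelOdd g s

theorem continuous_integral_comp_mul_sin {w h : ℝ → ℝ} (hw : Continuous w) (hh : Continuous h) :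
    Continuous fun s : ℝ => ∫ α in 0..π / 2, w α * h (s * sin α) :=
  intervalIntegral.continuous_parametric_intervalIntegral_of_continuous' (by fun_prop) _ _

theorem continuous_abelOdd {h : ℝ → ℝ} (hh : Continuous h) : Continuous (abelOdd h) :=
  continuous_id.mul ((continuous_integral_comp_mul_sin continuous_sin hh).comp continuous_abs)

theorem continuous_abelEven {k : ℝ → ℝ} (c : ℝ) (hk : Continuous k) :
    Continuous (abelEven c k) := by
  have := (continuous_integral_comp_mul_sin (continuous_const (y := (1 : ℝ))) hk).comp
    continuous_abs
  simp only [Function.comp_def, one_mul] at this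
  exact continuous_const.add (continuous_abs.mul this)

theorem continuous_axisProfile (c : ℝ) {k g : ℝ → ℝ} (hk : Continuous k) (hg : Continuous g) :
    Continuous (axisProfile c k g) :=
  (continuous_abelEven c hk).add (continuous_abelOdd hg)

theorem abelOdd_neg (h : ℝ → ℝ) (s : ℝ) : abelOdd h (-s) = -abelOdd h s := by
  simp [abelOdd]

theorem abelEven_neg (c : ℝ) (k : ℝ → ℝ) (s : ℝ) : abelEven c k (-s) = abelEven c k s := by
  simp [abelEven]

theorem hasDerivAt_integral_comp_mul_sin {w h h' : ℝ → ℝ} {a b : ℝ} (hw : Continuous w)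
    (hh : ∀ x, HasDerivAt h (h' x) x) (hh' : Continuous h') (s : ℝ) :
    HasDerivAt (fun s => ∫ α in a..b, w α * h (s * sin α))
      (∫ α in a..b, w α * (sin α * h' (s * sin α))) s := by
  have hc : Continuous h := continuous_iff_continuousAt.2 fun x => (hh x).continuousAt
  obtain ⟨C, hC⟩ := ((isCompact_closedBall s 1).prod (isCompact_uIcc (a := a) (b := b))
    ).exists_bound_of_continuousOn
    (f := fun p : ℝ × ℝ => w p.2 * (sin p.2 * h' (p.1 * sin p.2))) (by fun_prop)
  refine (intervalIntegral.hasDerivAt_integral_of_dominated_loc_of_deriv_le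
    (F' := fun s α => w α * (sin α * h' (s * sin α))) (bound := fun _ => C)
    (Metric.ball_mem_nhds s one_pos) (.of_forall fun x => Continuous.aestronglyMeasurable
      (by fun_prop)) (Continuous.intervalIntegrable (by fun_prop) _ _)
    (Continuous.aestronglyMeasurable (by fun_prop))
    (.of_forall fun α hα x hx => hC (x, α) ⟨Metric.ball_subset_closedBall hx,
      uIoc_subset_uIcc hα⟩) intervalIntegrable_const
    (.of_forall fun α hα x hx => ?_)).2
  have := ((hh (x * sin α)).comp x ((hasDerivAt_id x).mul_const (sin α))).const_mul (w α)
  exact this.congr_deriv (by ring)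

theorem integral_sin_mul_comp_mul_sin {h h' : ℝ → ℝ} (hh : ∀ x, HasDerivAt h (h' x) x)
    (hh' : Continuous h') (s : ℝ) :
    ∫ α in 0..π / 2, sin α * h (s * sin α)
      = h 0 + s * ∫ α in 0..π / 2, cos α ^ 2 * h' (s * sin α) := by
  have hc : Continuous h := continuous_iff_continuousAt.2 fun x => (hh x).continuousAt
  have hu : ∀ α ∈ uIcc 0 (π / 2), HasDerivAt (fun α => h (s * sin α))
      (h' (s * sin α) * (s * cos α)) α := fun α _ =>
    (hh _).comp α ((hasDerivAt_sin α).const_mul s)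
  have hv : ∀ α ∈ uIcc 0 (π / 2), HasDerivAt (fun α => -cos α) (sin α) α := fun α _ => by
    simpa using! (hasDerivAt_cos α).neg
  have := intervalIntegral.integral_mul_deriv_eq_deriv_mul hu hv
    (Continuous.intervalIntegrable (by fun_prop) _ _)
    (Continuous.intervalIntegrable (by fun_prop) _ _)
  simp only [mul_comm (sin _) (h _), this, cos_pi_div_two, neg_zero, mul_zero, sin_zero, cos_zero,
    mul_neg, mul_one, intervalIntegral.integral_neg, sub_neg_eq_add, zero_add]
  rw [← intervalIntegral.integral_const_mul]
  congr 1
  exact intervalIntegral.integral_congr fun α _ => by ring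

/-- For `s ≥ 0` the product rule, after an integration by parts, leaves the weights `sin² + cos² =
1`; negative `s` follow from parity. In terms of waves: the solution with initial value `h` at rest
is the time derivative of the one starting from zero with velocity `h`. -/
theorem hasDerivAt_abelOdd {h h' : ℝ → ℝ} (hh : ∀ x, HasDerivAt h (h' x) x)
    (hh' : Continuous h') (s : ℝ) :
    HasDerivAt (abelOdd h) (abelEven (h 0) h' s) s := by
  have hc : Continuous h := continuous_iff_continuousAt.2 fun x => (hh x).continuousAt
  have key : ∀ s : ℝ, HasDerivAt (fun s => s * ∫ α in 0..π / 2, sin α * h (s * sin α))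
      (h 0 + s * ∫ α in 0..π / 2, h' (s * sin α)) s := by
    intro s
    refine ((hasDerivAt_id s).mul (hasDerivAt_integral_comp_mul_sin (a := 0) (b := π / 2)
      continuous_sin hh hh' s)).congr_deriv ?_
    rw [id, integral_sin_mul_comp_mul_sin hh hh', one_mul, add_assoc, ← mul_add,
      ← intervalIntegral.integral_add (Continuous.intervalIntegrable (by fun_prop) _ _)
      (Continuous.intervalIntegrable (by fun_prop) _ _)]
    congr 3 with α
    linear_combination h' (s * sin α) * (sin_sq_add_cos_sq α)
  have hpos : ∀ s : ℝ, 0 ≤ s → HasDerivWithinAt (abelOdd h) (abelEven (h 0) h' s) (Ici 0) s := by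
    intro s hs
    have := (key s).hasDerivWithinAt (s := Ici 0)
    rw [abelEven, abs_of_nonneg hs]
    refine this.congr (fun x hx => ?_) ?_
    · simp only [abelOdd, abs_of_nonneg (mem_Ici.1 hx)]
    · simp only [abelOdd, abs_of_nonneg hs]
  have hneg : ∀ s : ℝ, s ≤ 0 → HasDerivWithinAt (abelOdd h) (abelEven (h 0) h' s) (Iic 0) s := by
    intro s hs
    have h1 := (hpos (-s) (by linarith)).comp (s := Iic 0) s (hasDerivAt_neg s).hasDerivWithinAt
      (fun x hx => by simpa using hx)
    have h2 := h1.neg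
    refine (h2.congr_deriv (by simp [abelEven_neg])).congr (fun x _ => ?_) ?_ <;>
    simp [abelOdd_neg]
  rcases lt_trichotomy s 0 with hs | rfl | hs
  · exact (hneg s hs.le).hasDerivAt (Iic_mem_nhds hs)
  · have := (hpos 0 le_rfl).union (hneg 0 le_rfl)
    rwa [Ici_union_Iic, hasDerivWithinAt_univ] at this
  · exact (hpos s hs.le).hasDerivAt (Ici_mem_nhds hs)

theorem integral_comp_cos_eq_add {E : ℝ → ℝ} (hE : Continuous E) :
    ∫ θ in 0..π, E (cos θ) = ∫ θ in 0..π / 2, (E (cos θ) + E (-cos θ)) := by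
  have hi : ∀ a b : ℝ, IntervalIntegrable (fun θ => E (cos θ)) volume a b := fun a b =>
    Continuous.intervalIntegrable (by fun_prop) _ _
  rw [← intervalIntegral.integral_add_adjacent_intervals (hi 0 (π / 2)) (hi (π / 2) π),
    intervalIntegral.integral_add (hi _ _) (Continuous.intervalIntegrable (by fun_prop) _ _)]
  congr 1
  have := intervalIntegral.integral_comp_sub_left (a := 0) (b := π / 2) (fun θ => E (cos θ)) π
  simp only [cos_pi_sub] at this
  rw [this]
  congr 1 <;> ring

theorem axialMean_zero_abelOdd {h : ℝ → ℝ} (hh : Continuous h) (z : ℝ) :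
    axialMean 0 (abelOdd h) 0 z = 0 := by
  have := continuous_abelOdd hh
  simp only [axialMean, pow_zero, one_mul, zero_add]
  rw [integral_comp_cos_eq_add (E := fun x => abelOdd h (z * x)) (by fun_prop)]
  simp [abelOdd_neg]

theorem axialMean_one_abelEven {k : ℝ → ℝ} (c : ℝ) (hk : Continuous k) (z : ℝ) :
    axialMean 1 (abelEven c k) 0 z = 0 := by
  have := continuous_abelEven c hk
  simp only [axialMean, pow_one, zero_add]
  rw [integral_comp_cos_eq_add (E := fun x => x * abelEven c k (z * x)) (by fun_prop)]
  simp [abelEven_neg]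

/-- Archimedes' theorem for `x ↦ k (z x)` collapses the double integral to `∫ k (z x) dx` over `[0,
1]`, which is `(f z - f 0) / z`. -/
theorem axialMean_zero_abelEven {f k : ℝ → ℝ} (hf : ∀ x, HasDerivAt f (k x) x)
    (hk : Continuous k) {z : ℝ} (hz : 0 < z) : axialMean 0 (abelEven (f 0) k) 0 z = f z := by
  have hc := continuous_abelEven (f 0) hk
  simp only [axialMean, pow_zero, one_mul, zero_add]
  rw [integral_comp_cos_eq_add (E := fun x => abelEven (f 0) k (z * x)) (by fun_prop)]
  have hA := integral_integral_cos_mul_comp (H := fun x => k (z * x)) (by fun_prop)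
  have e : ∫ θ in 0..π / 2, (abelEven (f 0) k (z * cos θ) + abelEven (f 0) k (z * -cos θ))
      = ∫ θ in 0..π / 2,
        (2 * f 0 + 2 * z * ∫ α in 0..π / 2, k (z * (cos θ * sin α)) * cos θ) := by
    refine intervalIntegral.integral_congr fun θ hθ => ?_
    rw [uIcc_of_le (by positivity)] at hθ
    have hcos := cos_nonneg_of_neg_pi_div_two_le_of_le (by linarith [hθ.1, pi_pos]) hθ.2
    simp only [mul_neg, abelEven_neg]
    simp only [abelEven, abs_of_nonneg (mul_nonneg hz.le hcos),
      intervalIntegral.integral_mul_const, mul_assoc]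
    ring
  rw [e, intervalIntegral.integral_add intervalIntegrable_const
    (((continuous_integral_comp_cos_mul_sin (H := fun x => k (z * x))
      (by fun_prop)).const_mul _).intervalIntegrable _ _),
    intervalIntegral.integral_const_mul (2 * z), hA, intervalIntegral.integral_comp_mul_left _ hz.ne',
    mul_zero, mul_one, intervalIntegral.integral_eq_sub_of_hasDerivAt (fun x _ => hf x)
      (hk.intervalIntegrable _ _), intervalIntegral.integral_const]
  simp only [smul_eq_mul, sub_zero]
  field_simp
  ring

/-- The initial velocity in integrated form. The mean with weight `cos θ` is used because the
profile of a merely continuous `h` need not be differentiable, so its time derivative at `0` is not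
directly available. -/
theorem axialMean_one_abelOdd {h : ℝ → ℝ} (hh : Continuous h) {z : ℝ} (hz : 0 < z) :
    axialMean 1 (abelOdd h) 0 z = (∫ ζ in 0..z, ζ * h ζ) / z := by
  have hc := continuous_abelOdd hh
  simp only [axialMean, pow_one, zero_add]
  rw [integral_comp_cos_eq_add (E := fun x => x * abelOdd h (z * x)) (by fun_prop)]
  have hA := integral_integral_cos_mul_comp (H := fun x => (z * x) * h (z * x)) (by fun_prop)
  have e : ∫ θ in 0..π / 2, (cos θ * abelOdd h (z * cos θ) + -cos θ * abelOdd h (z * -cos θ))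
      = ∫ θ in 0..π / 2, (2 * ∫ α in 0..π / 2,
        z * (cos θ * sin α) * h (z * (cos θ * sin α)) * cos θ) := by
    refine intervalIntegral.integral_congr fun θ hθ => ?_
    rw [uIcc_of_le (by positivity)] at hθ
    have hcos := cos_nonneg_of_neg_pi_div_two_le_of_le (by linarith [hθ.1, pi_pos]) hθ.2
    have e2 : ∀ α : ℝ, z * (cos θ * sin α) * h (z * (cos θ * sin α)) * cos θ
      = z * cos θ ^ 2 * (sin α * h (z * cos θ * sin α)) := fun α => by
      rw [mul_assoc z (cos θ)]; ring
    simp only [mul_neg, abelOdd_neg]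
    simp only [abelOdd, abs_of_nonneg (mul_nonneg hz.le hcos), e2,
      intervalIntegral.integral_const_mul]
    ring
  rw [e, intervalIntegral.integral_const_mul, hA,
    intervalIntegral.integral_comp_mul_left (fun x => x * h x) hz.ne', mul_zero, mul_one]
  simp only [smul_eq_mul]
  field_simp

theorem axialMean_add {P Q : ℝ → ℝ} (hP : Continuous P) (hQ : Continuous Q) (j : ℕ) (t z : ℝ) :
    axialMean j (fun s => P s + Q s) t z = axialMean j P t z + axialMean j Q t z := by
  simp only [axialMean, mul_add]
  rw [intervalIntegral.integral_add (Continuous.intervalIntegrable (by fun_prop) _ _)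
    (Continuous.intervalIntegrable (by fun_prop) _ _), mul_add]

theorem axialMean_zero_axisProfile {f k g : ℝ → ℝ} (hf : ∀ x, HasDerivAt f (k x) x)
    (hk : Continuous k) (hg : Continuous g) {z : ℝ} (hz : 0 < z) :
    axialMean 0 (axisProfile (f 0) k g) 0 z = f z := by
  unfold axisProfile
  rw [axialMean_add (continuous_abelEven _ hk) (continuous_abelOdd hg),
    axialMean_zero_abelEven hf hk hz, axialMean_zero_abelOdd hg, add_zero]

theorem axialMean_one_axisProfile (c : ℝ) {k g : ℝ → ℝ} (hk : Continuous k) (hg : Continuous g)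
    {z : ℝ} (hz : 0 < z) :
    axialMean 1 (axisProfile c k g) 0 z = (∫ ζ in 0..z, ζ * g ζ) / z := by
  unfold axisProfile
  rw [axialMean_add (continuous_abelEven _ hk) (continuous_abelOdd hg),
    axialMean_one_abelEven c hk, axialMean_one_abelOdd hg hz, zero_add]

theorem axialMean_right_zero (P : ℝ → ℝ) (t : ℝ) : axialMean 0 P t 0 = P t := by
  simp [axialMean, pi_ne_zero]

/-! ### Integrals depending on a parameter -/

theorem exists_closedBall_bound {X : Type*} [PseudoMetricSpace X] [ProperSpace X]
    {F : X → ℝ → ℝ} {U : Set X} {a b : ℝ} {s : X} (hU : IsOpen U) (hs : s ∈ U)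
    (hF : ContinuousOn (fun p : X × ℝ => F p.1 p.2) (U ×ˢ uIcc a b)) :
    ∃ r > 0, Metric.closedBall s r ⊆ U ∧
      ∃ C, ∀ x ∈ Metric.closedBall s r, ∀ α ∈ uIcc a b, ‖F x α‖ ≤ C := by
  obtain ⟨r, hr, hrU⟩ := Metric.nhds_basis_closedBall.mem_iff.1 (hU.mem_nhds hs)
  obtain ⟨C, hC⟩ := ((isCompact_closedBall s r).prod (isCompact_uIcc (a := a) (b := b))
    ).exists_bound_of_continuousOn (hF.mono (prod_mono hrU Subset.rfl))
  exact ⟨r, hr, hrU, C, fun x hx α hα => hC (x, α) ⟨hx, hα⟩⟩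

theorem continuousOn_intervalIntegral {X : Type*} [PseudoMetricSpace X] [ProperSpace X]
    {F : X → ℝ → ℝ} {U : Set X} {a b : ℝ} (hU : IsOpen U)
    (hF : ContinuousOn (fun p : X × ℝ => F p.1 p.2) (U ×ˢ uIcc a b)) :
    ContinuousOn (fun x => ∫ α in a..b, F x α) U := by
  intro s hs
  obtain ⟨r, hr, hrU, C, hC⟩ := exists_closedBall_bound hU hs hF
  refine ContinuousAt.continuousWithinAt ?_
  have hball : Metric.closedBall s r ∈ 𝓝 s := Metric.closedBall_mem_nhds s hr
  refine intervalIntegral.continuousAt_of_dominated_interval (bound := fun _ => C) ?_ ?_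
    intervalIntegrable_const ?_
  · filter_upwards [hball] with x hx
    refine ContinuousOn.aestronglyMeasurable ?_ measurableSet_uIoc
    exact hF.comp (f := fun α => (x, α)) (by fun_prop) fun α hα => ⟨hrU hx, uIoc_subset_uIcc hα⟩
  · filter_upwards [hball] with x hx
    exact .of_forall fun α hα => hC x hx α (uIoc_subset_uIcc hα)
  · refine .of_forall fun α hα => ?_
    have : ContinuousOn (fun x => F x α) U :=
      hF.comp (f := fun x => (x, α)) (by fun_prop) fun x hx => ⟨hx, uIoc_subset_uIcc hα⟩
    exact this.continuousAt (hU.mem_nhds hs)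

theorem hasDerivAt_intervalIntegral {F F' : ℝ → ℝ → ℝ} {U : Set ℝ} {a b s : ℝ} (hU : IsOpen U)
    (hs : s ∈ U) (hF : ∀ x ∈ U, ContinuousOn (F x) (uIcc a b))
    (hF' : ContinuousOn (fun p : ℝ × ℝ => F' p.1 p.2) (U ×ˢ uIcc a b))
    (hd : ∀ x ∈ U, ∀ α ∈ uIcc a b, HasDerivAt (fun x => F x α) (F' x α) x) :
    HasDerivAt (fun x => ∫ α in a..b, F x α) (∫ α in a..b, F' s α) s := by
  obtain ⟨r, hr, hrU, C, hC⟩ := exists_closedBall_bound hU hs hF'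
  have hball : Metric.closedBall s r ∈ 𝓝 s := Metric.closedBall_mem_nhds s hr
  refine (intervalIntegral.hasDerivAt_integral_of_dominated_loc_of_deriv_le (F' := F')
    (bound := fun _ => C) hball ?_ (hF s hs).intervalIntegrable ?_ ?_ intervalIntegrable_const ?_).2
  · filter_upwards [hball] with x hx
    exact ((hF x (hrU hx)).mono uIoc_subset_uIcc).aestronglyMeasurable measurableSet_uIoc
  · refine ContinuousOn.aestronglyMeasurable ?_ measurableSet_uIoc
    exact hF'.comp (f := fun α => (s, α)) (by fun_prop) fun α hα => ⟨hs, uIoc_subset_uIcc hα⟩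
  · exact .of_forall fun α hα x hx => hC x hx α (uIoc_subset_uIcc hα)
  · exact .of_forall fun α hα x hx => hd x (hrU hx) α (uIoc_subset_uIcc hα)

/-! ### Differentiability of the axis profile away from the origin -/

/-- For small `α` the argument `s sin α` approaches `0`, where `h'` may be unbounded; there the
factor `w = cos · v` allows an integration by parts that replaces `h` by its primitive `H`, so that
only `h` appears after differentiating in `s`. On `[π/4, π/2]` the argument stays away from `0` and
`h` is differentiated directly. -/
theorem exists_hasDerivAt_integral_comp_mul_sin {w v v' h h' H : ℝ → ℝ} (hw : Continuous w)
    (hv : ∀ α ∈ Icc 0 (π / 4), HasDerivAt v (v' α) α) (hv' : ContinuousOn v' (Icc 0 (π / 4)))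
    (hwv : ∀ α ∈ Icc 0 (π / 4), w α = cos α * v α)
    (hH : ∀ x, HasDerivAt H (h x) x) (hh : Continuous h)
    (hh' : ∀ x > 0, HasDerivAt h (h' x) x) (hhc : ContinuousOn h' (Ioi 0)) :
    ∃ Q : ℝ → ℝ, ContinuousOn Q (Ioi 0) ∧
      ∀ s > 0, HasDerivAt (fun s => s * ∫ α in 0..π / 2, w α * h (s * sin α)) (Q s) s := by
  have hπ : 0 ≤ π / 4 := by positivity
  have hHc : Continuous H := continuous_iff_continuousAt.2 fun x => (hH x).continuousAt
  have hvc : ContinuousOn v (Icc 0 (π / 4)) := fun α hα => (hv α hα).continuousAt.continuousWithinAt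
  have hsplit : ∀ s : ℝ, s * ∫ α in 0..π / 2, w α * h (s * sin α)
      = (H (s * sin (π / 4)) * v (π / 4) - H 0 * v 0 - ∫ α in 0..π / 4, H (s * sin α) * v' α)
        + ∫ α in π / 4..π / 2, s * (w α * h (s * sin α)) := by
    intro s
    have hi : ∀ a b : ℝ, IntervalIntegrable (fun α => w α * h (s * sin α)) volume a b :=
      fun a b => Continuous.intervalIntegrable (by fun_prop) _ _
    rw [← intervalIntegral.integral_add_adjacent_intervals (hi 0 (π / 4)) (hi (π / 4) (π / 2)),
      mul_add, intervalIntegral.integral_const_mul s]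
    congr 1
    have hp := intervalIntegral.integral_deriv_mul_eq_sub_of_hasDeriv_right (a := 0) (b := π / 4)
      (u := fun α => H (s * sin α)) (u' := fun α => h (s * sin α) * (s * cos α)) (v := v)
      (v' := v') (by fun_prop) (by rwa [uIcc_of_le hπ])
      (fun α _ => ((hH _).comp α ((hasDerivAt_sin α).const_mul s)).hasDerivWithinAt)
      (fun α hα => (hv α ⟨by simpa [hπ] using hα.1.le, by simpa [hπ] using hα.2.le⟩
        ).hasDerivWithinAt)
      (Continuous.intervalIntegrable (by fun_prop) _ _)
      (ContinuousOn.intervalIntegrable (by rwa [uIcc_of_le hπ]))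
    have hi1 : IntervalIntegrable (fun α => h (s * sin α) * (s * cos α) * v α) volume 0 (π / 4) :=
      ContinuousOn.intervalIntegrable (by
        rw [uIcc_of_le hπ]; exact ContinuousOn.mul (by fun_prop) hvc)
    have hi2 : IntervalIntegrable (fun α => H (s * sin α) * v' α) volume 0 (π / 4) :=
      ContinuousOn.intervalIntegrable (by
        rw [uIcc_of_le hπ]; exact ContinuousOn.mul (by fun_prop) hv')
    rw [intervalIntegral.integral_add hi1 hi2] at hp
    simp only [sin_zero, mul_zero] at hp
    rw [← intervalIntegral.integral_const_mul, ← hp, add_sub_cancel_right]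
    refine intervalIntegral.integral_congr fun α hα => ?_
    rw [uIcc_of_le hπ] at hα
    simp only [hwv α hα]
    ring
  have hsin : ∀ α ∈ uIcc (π / 4) (π / 2), 0 < sin α := fun α hα => by
    rw [uIcc_of_le (by linarith)] at hα
    exact sin_pos_of_pos_of_lt_pi (by linarith [pi_pos, hα.1]) (by linarith [pi_pos, hα.2])
  have hc2 : ContinuousOn (fun p : ℝ × ℝ => h' (p.1 * sin p.2))
      (Ioi 0 ×ˢ uIcc (π / 4) (π / 2)) :=
    hhc.comp (by fun_prop) fun p hp => mul_pos hp.1 (hsin p.2 hp.2)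
  have hc3 : ContinuousOn (fun p : ℝ × ℝ => w p.2 * h (p.1 * sin p.2)
      + p.1 * (w p.2 * (h' (p.1 * sin p.2) * sin p.2))) (Ioi 0 ×ˢ uIcc (π / 4) (π / 2)) :=
    ContinuousOn.add (by fun_prop) (ContinuousOn.mul (by fun_prop)
      (ContinuousOn.mul (by fun_prop) (hc2.mul (by fun_prop))))
  refine ⟨fun s => (h (s * sin (π / 4)) * sin (π / 4) * v (π / 4)
      - ∫ α in 0..π / 4, h (s * sin α) * sin α * v' α)
      + ∫ α in π / 4..π / 2, (w α * h (s * sin α) + s * (w α * (h' (s * sin α) * sin α))), ?_, ?_⟩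
  · refine ContinuousOn.add (ContinuousOn.sub (by fun_prop) ?_) ?_
    · refine continuousOn_intervalIntegral isOpen_Ioi ?_
      refine ContinuousOn.mul (by fun_prop) (hv'.comp continuousOn_snd fun p hp => ?_)
      simpa [uIcc_of_le hπ] using hp.2
    · exact continuousOn_intervalIntegral isOpen_Ioi hc3
  · intro s hs
    rw [funext hsplit]
    refine ((HasDerivAt.sub_const _ ?_).sub ?_).add ?_
    · refine HasDerivAt.mul_const ?_ _
      refine ((hH _).comp s ((hasDerivAt_id s).mul_const _)).congr_deriv ?_
      simp
    · refine hasDerivAt_intervalIntegral (F' := fun s α => h (s * sin α) * sin α * v' α)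
        isOpen_univ (mem_univ s) (fun x _ => ?_) ?_ fun x _ α _ => ?_
      · rw [uIcc_of_le hπ]; exact ContinuousOn.mul (by fun_prop) hv'
      · refine ContinuousOn.mul (by fun_prop) (hv'.comp continuousOn_snd fun p hp => ?_)
        simpa [uIcc_of_le hπ] using hp.2
      · refine HasDerivAt.mul_const ?_ _
        refine ((hH _).comp x ((hasDerivAt_id x).mul_const _)).congr_deriv ?_
        simp
    · refine hasDerivAt_intervalIntegral
        (F' := fun s α => w α * h (s * sin α) + s * (w α * (h' (s * sin α) * sin α)))
        isOpen_Ioi hs (fun x _ => by fun_prop) hc3 fun x hx α hα => ?_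
      have h1 := (((hh' _ (mul_pos hx (hsin α hα))).comp x
        ((hasDerivAt_id x).mul_const (sin α))).const_mul (w α))
      refine ((hasDerivAt_id x).mul h1).congr_deriv ?_
      simp

theorem exists_primitive {h : ℝ → ℝ} (hh : Continuous h) : ∃ H, ∀ x, HasDerivAt H (h x) x :=
  ⟨fun x => ∫ y in 0..x, h y, fun _ => (hh.integral_hasStrictDerivAt 0 _).hasDerivAt⟩

/-- A `C²` wave makes `f'` and `g` continuously differentiable only for `z > 0`, so the profile is
differentiated only at `s > 0`; this suffices near the axis at positive times. The weights `1` and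
`sin` are `cos · v` with `v = 1 / cos` and `v = tan`. -/
theorem exists_hasDerivAt_axisProfile (c : ℝ) {k g k' g' : ℝ → ℝ} (hk : Continuous k)
    (hg : Continuous g) (hkd : ∀ x > 0, HasDerivAt k (k' x) x) (hkc : ContinuousOn k' (Ioi 0))
    (hgd : ∀ x > 0, HasDerivAt g (g' x) x) (hgc : ContinuousOn g' (Ioi 0)) :
    ∃ Q : ℝ → ℝ, ContinuousOn Q (Ioi 0) ∧
      ∀ s > 0, HasDerivAt (axisProfile c k g) (Q s) s := by
  have hcos : ∀ α ∈ Icc 0 (π / 4), cos α ≠ 0 := fun α hα =>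
    (cos_pos_of_mem_Ioo ⟨by linarith [pi_pos, hα.1], by linarith [pi_pos, hα.2]⟩).ne'
  obtain ⟨K, hK⟩ := exists_primitive hk
  obtain ⟨G, hG⟩ := exists_primitive hg
  obtain ⟨Q₁, hQ₁, hQ₁'⟩ := exists_hasDerivAt_integral_comp_mul_sin (w := fun _ => 1)
    (v := fun α => (cos α)⁻¹) (v' := fun α => -(-sin α) / cos α ^ 2) continuous_const
    (fun α hα => (hasDerivAt_cos α).inv (hcos α hα))
    (ContinuousOn.div (by fun_prop) (by fun_prop) fun α hα => pow_ne_zero 2 (hcos α hα))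
    (fun α hα => (mul_inv_cancel₀ (hcos α hα)).symm) hK hk hkd hkc
  obtain ⟨Q₂, hQ₂, hQ₂'⟩ := exists_hasDerivAt_integral_comp_mul_sin (w := sin)
    (v := tan) (v' := fun α => 1 / cos α ^ 2) continuous_sin
    (fun α hα => hasDerivAt_tan (hcos α hα))
    (ContinuousOn.div (by fun_prop) (by fun_prop) fun α hα => pow_ne_zero 2 (hcos α hα))
    (fun α hα => by rw [mul_comm, tan_mul_cos (hcos α hα)]) hG hg hgd hgc
  refine ⟨fun s => Q₁ s + Q₂ s, hQ₁.add hQ₂, fun s hs => ?_⟩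
  refine (((hQ₁' s hs).const_add c).add (hQ₂' s hs)).congr_of_eventuallyEq ?_
  filter_upwards [lt_mem_nhds hs] with x hx
  simp [axisProfile, abelEven, abelOdd, abs_of_pos hx]

/-! ### Radial first-order systems -/

/-- Chain rule for a function with continuous partial derivatives on `z > 0`. -/
theorem hasDerivAt_comp_of_partial {F Ft Fz : ℝ → ℝ → ℝ}
    (ht : ∀ t, ∀ z > 0, HasDerivAt (fun t => F t z) (Ft t z) t)
    (hz : ∀ t, ∀ z > 0, HasDerivAt (fun z => F t z) (Fz t z) z)
    (hct : ContinuousOn (fun p : ℝ × ℝ => Ft p.1 p.2) (univ ×ˢ Ioi 0))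
    (hcz : ContinuousOn (fun p : ℝ × ℝ => Fz p.1 p.2) (univ ×ˢ Ioi 0))
    {τ ρ : ℝ → ℝ} {τ' ρ' s : ℝ} (hτ : HasDerivAt τ τ' s) (hρ : HasDerivAt ρ ρ' s)
    (hpos : 0 < ρ s) :
    HasDerivAt (fun s => F (τ s) (ρ s)) (Ft (τ s) (ρ s) * τ' + Fz (τ s) (ρ s) * ρ') s := by
  have hopen : IsOpen (univ ×ˢ Ioi 0 : Set (ℝ × ℝ)) := isOpen_univ.prod isOpen_Ioi
  have hmem : (τ s, ρ s) ∈ (univ ×ˢ Ioi 0 : Set (ℝ × ℝ)) := ⟨mem_univ _, hpos⟩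
  have hnhds := hopen.mem_nhds hmem
  have := hasStrictFDerivAt_uncurry_coprod (𝕜 := ℝ) (u := (τ s, ρ s)) (f := F)
    (f₁ := fun t z => ContinuousLinearMap.toSpanSingleton ℝ (Ft t z))
    (f₂ := fun t z => ContinuousLinearMap.toSpanSingleton ℝ (Fz t z))
    (by filter_upwards [hnhds] with v hv using (ht v.1 v.2 hv.2).hasFDerivAt)
    (by filter_upwards [hnhds] with v hv using (hz v.1 v.2 hv.2).hasFDerivAt)
    ((ContinuousLinearMap.toSpanSingletonCLE (𝕜 := ℝ) (E := ℝ)).continuous.continuousAt.comp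
      (hct.continuousAt hnhds))
    ((ContinuousLinearMap.toSpanSingletonCLE (𝕜 := ℝ) (E := ℝ)).continuous.continuousAt.comp
      (hcz.continuousAt hnhds))
  have h2 := this.hasFDerivAt.comp_hasDerivAt s (hτ.prodMk hρ)
  refine h2.congr_deriv ?_
  simp [Function.HasUncurry.uncurry, mul_comm]

/-- A solution of the first-order system behind `∂ₜₜ w = z⁻¹ ∂_z (z ∂_z w)` which vanishes for
`t ≤ 0`: one may think of `W₁ = ∂ₜ w`, `V = ∂_z w`, `W₀ = ∂ₜₜ w` and `Y = ∂ₜ ∂_z w`. -/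
structure IsRadialSystem (W₀ W₁ V Y : ℝ → ℝ → ℝ) : Prop where
  continuousOn_W₀ : ContinuousOn (fun p : ℝ × ℝ => W₀ p.1 p.2) (univ ×ˢ Ioi 0)
  continuousOn_Y : ContinuousOn (fun p : ℝ × ℝ => Y p.1 p.2) (univ ×ˢ Ioi 0)
  continuousOn_V : ContinuousOn (fun p : ℝ × ℝ => V p.1 p.2) (univ ×ˢ Ioi 0)
  time_W₁ : ∀ t, ∀ z > 0, HasDerivAt (fun t => W₁ t z) (W₀ t z) t
  space_W₁ : ∀ t, ∀ z > 0, HasDerivAt (fun z => W₁ t z) (Y t z) z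
  time_V : ∀ t, ∀ z > 0, HasDerivAt (fun t => V t z) (Y t z) t
  space_V : ∀ t, ∀ z > 0, HasDerivAt (fun z => V t z) (W₀ t z - V t z / z) z
  zero_W₁ : ∀ t ≤ 0, ∀ z > 0, W₁ t z = 0
  zero_V : ∀ t ≤ 0, ∀ z > 0, V t z = 0

namespace IsRadialSystem

variable {W₀ W₁ V Y : ℝ → ℝ → ℝ}

theorem continuousOn_space_V (h : IsRadialSystem W₀ W₁ V Y) :
    ContinuousOn (fun p : ℝ × ℝ => W₀ p.1 p.2 - V p.1 p.2 / p.2) (univ ×ˢ Ioi 0) :=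
  h.continuousOn_W₀.sub (h.continuousOn_V.div continuousOn_snd fun _ hp => (mem_Ioi.1 hp.2).ne')

theorem hasDerivAt_W₁ (h : IsRadialSystem W₀ W₁ V Y) {τ ρ : ℝ → ℝ} {τ' ρ' s : ℝ}
    (hτ : HasDerivAt τ τ' s) (hρ : HasDerivAt ρ ρ' s) (hpos : 0 < ρ s) :
    HasDerivAt (fun s => W₁ (τ s) (ρ s)) (W₀ (τ s) (ρ s) * τ' + Y (τ s) (ρ s) * ρ') s :=
  hasDerivAt_comp_of_partial h.time_W₁ h.space_W₁ h.continuousOn_W₀ h.continuousOn_Y hτ hρ hpos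

theorem hasDerivAt_V (h : IsRadialSystem W₀ W₁ V Y) {τ ρ : ℝ → ℝ} {τ' ρ' s : ℝ}
    (hτ : HasDerivAt τ τ' s) (hρ : HasDerivAt ρ ρ' s) (hpos : 0 < ρ s) :
    HasDerivAt (fun s => V (τ s) (ρ s))
      (Y (τ s) (ρ s) * τ' + (W₀ (τ s) (ρ s) - V (τ s) (ρ s) / ρ s) * ρ') s :=
  hasDerivAt_comp_of_partial h.time_V h.space_V h.continuousOn_Y h.continuousOn_space_V hτ hρ hpos

theorem continuousOn_W₁ (h : IsRadialSystem W₀ W₁ V Y) :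
    ContinuousOn (fun p : ℝ × ℝ => W₁ p.1 p.2) (univ ×ˢ Ioi 0) := by
  intro u hu
  have hopen : IsOpen (univ ×ˢ Ioi 0 : Set (ℝ × ℝ)) := isOpen_univ.prod isOpen_Ioi
  have hnhds := hopen.mem_nhds hu
  exact (hasStrictFDerivAt_uncurry_coprod (𝕜 := ℝ) (u := u) (f := W₁)
    (f₁ := fun t z => ContinuousLinearMap.toSpanSingleton ℝ (W₀ t z))
    (f₂ := fun t z => ContinuousLinearMap.toSpanSingleton ℝ (Y t z))
    (by filter_upwards [hnhds] with v hv using (h.time_W₁ v.1 v.2 hv.2).hasFDerivAt)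
    (by filter_upwards [hnhds] with v hv using (h.space_W₁ v.1 v.2 hv.2).hasFDerivAt)
    ((ContinuousLinearMap.toSpanSingletonCLE (𝕜 := ℝ) (E := ℝ)).continuous.continuousAt.comp
      (h.continuousOn_W₀.continuousAt hnhds))
    ((ContinuousLinearMap.toSpanSingletonCLE (𝕜 := ℝ) (E := ℝ)).continuous.continuousAt.comp
      (h.continuousOn_Y.continuousAt hnhds))).continuousAt.continuousWithinAt

/-- Finite speed of propagation. -/
theorem eq_zero_of_lt (h : IsRadialSystem W₀ W₁ V Y) {t z : ℝ} (hz : 0 < z) (htz : t < z) :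
    W₁ t z = 0 ∧ V t z = 0 := by
  rcases le_or_gt t 0 with ht | ht
  · exact ⟨h.zero_W₁ t ht z hz, h.zero_V t ht z hz⟩
  -- The smallest radius in the backward cone of `(t, z)`, so that `1 / r ≤ 1 / m` throughout it.
  set m := z - t with hm
  have hm0 : 0 < m := by linarith
  have hsub : (Icc 0 t ×ˢ Icc (z - t) (z + t) : Set (ℝ × ℝ)) ⊆ univ ×ˢ Ioi 0 := fun p hp =>
    ⟨mem_univ _, hm0.trans_le hp.2.1⟩
  obtain ⟨C₁, hC₁⟩ := (isCompact_Icc.prod isCompact_Icc).exists_bound_of_continuousOn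
    (h.continuousOn_W₁.mono hsub)
  obtain ⟨C₂, hC₂⟩ := (isCompact_Icc.prod isCompact_Icc).exists_bound_of_continuousOn
    (h.continuousOn_V.mono hsub)
  have hC0 : 0 ≤ C₁ + C₂ := add_nonneg
    ((norm_nonneg _).trans (hC₁ (0, z) ⟨⟨le_rfl, ht.le⟩, by simp [ht.le]⟩))
    ((norm_nonneg _).trans (hC₂ (0, z) ⟨⟨le_rfl, ht.le⟩, by simp [ht.le]⟩))
  -- Along the two characteristics `W₁ + V` and `W₁ - V` vary only through `V / r`, and `V` is half
  -- their difference. Each integration from the zero data gains a factor `s / m` and a further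
  -- denominator, as in Picard iteration.
  have key : ∀ n : ℕ, ∀ s x : ℝ, 0 ≤ s → |x - z| ≤ t - s →
      |W₁ s x + V s x| ≤ (C₁ + C₂) * ((s / m) ^ n / n.factorial) ∧
      |W₁ s x - V s x| ≤ (C₁ + C₂) * ((s / m) ^ n / n.factorial) := by
    intro n
    induction n with
    | zero =>
      intro s x hs hx
      have hx' := abs_le.1 hx
      have hmem : (s, x) ∈ (Icc 0 t ×ˢ Icc (z - t) (z + t) : Set (ℝ × ℝ)) :=
        ⟨⟨hs, by linarith [abs_nonneg (x - z)]⟩, by constructor <;> linarith [hx'.1, hx'.2]⟩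
      have h1 := hC₁ _ hmem
      have h2 := hC₂ _ hmem
      simp only [norm_eq_abs] at h1 h2
      simp only [pow_zero, Nat.factorial_zero, Nat.cast_one, div_one, mul_one]
      exact ⟨(abs_add_le _ _).trans (add_le_add h1 h2), (abs_sub _ _).trans (add_le_add h1 h2)⟩
    | succ n ih =>
      have hV : ∀ s x : ℝ, 0 ≤ s → |x - z| ≤ t - s →
          ‖V s x / x‖ ≤ (C₁ + C₂) * ((s / m) ^ n / n.factorial) * m⁻¹ := by
        intro s x hs hx
        have hxm : m ≤ x := by linarith [(abs_le.1 hx).1]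
        obtain ⟨h1, h2⟩ := ih s x hs hx
        rw [norm_eq_abs, abs_div, abs_of_pos (hm0.trans_le hxm), div_eq_mul_inv]
        refine mul_le_mul ?_ (inv_anti₀ hm0 hxm) (inv_nonneg.2 (hm0.trans_le hxm).le) (by positivity)
        rw [abs_le] at h1 h2 ⊢
        constructor <;> linarith [h1.1, h1.2, h2.1, h2.2]
      have hB : ∀ σ : ℝ, HasDerivAt
          (fun σ => (C₁ + C₂) * ((σ / m) ^ (n + 1) / (n + 1).factorial))
          ((C₁ + C₂) * ((σ / m) ^ n / n.factorial) * m⁻¹) σ := by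
        intro σ
        refine (((((hasDerivAt_id σ).div_const m).pow (n + 1)).div_const
          ((n + 1).factorial : ℝ)).const_mul (C₁ + C₂)).congr_deriv ?_
        rw [Nat.factorial_succ]
        push_cast
        field_simp
        simp
      intro s x hs hx
      constructor
      · have hd : ∀ σ : ℝ, 0 ≤ σ → σ ≤ s → HasDerivAt
            (fun σ => W₁ σ (x + s - σ) + V σ (x + s - σ))
            (V σ (x + s - σ) / (x + s - σ)) σ := by
          intro σ h0 hσ
          have hp : 0 < x + s - σ := by linarith [(abs_le.1 hx).1]
          have hρ : HasDerivAt (fun σ => x + s - σ) (-1) σ := (hasDerivAt_id σ).const_sub _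
          exact ((h.hasDerivAt_W₁ (hasDerivAt_id σ) hρ hp).add
            (h.hasDerivAt_V (hasDerivAt_id σ) hρ hp)).congr_deriv (by simp)
        have := image_norm_le_of_norm_deriv_right_le_deriv_boundary (a := 0) (b := s)
          (fun σ hσ => (hd σ hσ.1 hσ.2).continuousAt.continuousWithinAt)
          (fun σ hσ => (hd σ hσ.1 hσ.2.le).hasDerivWithinAt) (by
            have hp : 0 < x + s - 0 := by linarith [(abs_le.1 hx).1]
            rw [h.zero_W₁ 0 le_rfl _ hp, h.zero_V 0 le_rfl _ hp]
            simp) hB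
          (fun σ hσ => hV σ _ hσ.1 (by
            rw [abs_le] at hx ⊢
            constructor <;> linarith [hx.1, hx.2, hσ.2])) ⟨hs, le_rfl⟩
        simpa using this
      · have hd : ∀ σ : ℝ, 0 ≤ σ → σ ≤ s → HasDerivAt
            (fun σ => W₁ σ (x - s + σ) - V σ (x - s + σ))
            (V σ (x - s + σ) / (x - s + σ)) σ := by
          intro σ h0 hσ
          have hp : 0 < x - s + σ := by linarith [(abs_le.1 hx).1]
          have hρ : HasDerivAt (fun σ => x - s + σ) 1 σ := (hasDerivAt_id σ).const_add _
          exact ((h.hasDerivAt_W₁ (hasDerivAt_id σ) hρ hp).sub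
            (h.hasDerivAt_V (hasDerivAt_id σ) hρ hp)).congr_deriv (by simp; ring)
        have := image_norm_le_of_norm_deriv_right_le_deriv_boundary (a := 0) (b := s)
          (fun σ hσ => (hd σ hσ.1 hσ.2).continuousAt.continuousWithinAt)
          (fun σ hσ => (hd σ hσ.1 hσ.2.le).hasDerivWithinAt) (by
            have hp : 0 < x - s + 0 := by linarith [(abs_le.1 hx).1]
            rw [h.zero_W₁ 0 le_rfl _ hp, h.zero_V 0 le_rfl _ hp]
            simp) hB
          (fun σ hσ => hV σ _ hσ.1 (by
            rw [abs_le] at hx ⊢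
            constructor <;> linarith [hx.1, hx.2, hσ.2])) ⟨hs, le_rfl⟩
        simpa using this
  have hlim : Tendsto (fun n : ℕ => (C₁ + C₂) * ((t / m) ^ n / n.factorial)) atTop (𝓝 0) := by
    simpa using (FloorSemiring.tendsto_pow_div_factorial_atTop (t / m)).const_mul (C₁ + C₂)
  have h1 := abs_nonpos_iff.1 (ge_of_tendsto' hlim fun n => (key n t z ht.le (by simp)).1)
  have h2 := abs_nonpos_iff.1 (ge_of_tendsto' hlim fun n => (key n t z ht.le (by simp)).2)
  constructor <;> linarith

theorem W₀_eq_zero_of_lt (h : IsRadialSystem W₀ W₁ V Y) {t z : ℝ} (hz : 0 < z) (htz : t < z) :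
    W₀ t z = 0 := by
  refine (h.time_W₁ t z hz).unique ((hasDerivAt_const t (0 : ℝ)).congr_of_eventuallyEq ?_)
  filter_upwards [gt_mem_nhds htz] with s hs using (h.eq_zero_of_lt hz hs).1

end IsRadialSystem

/-! ### Integrals over chords -/

theorem sqrt_sq_add_sq_pos (x : ℝ) {y : ℝ} (hy : 0 < y) : 0 < √(x ^ 2 + y ^ 2) := by positivity

theorem le_sqrt_sq_add_sq {L : ℝ} (y : ℝ) : L ≤ √(L ^ 2 + y ^ 2) :=
  le_sqrt_of_sq_le (by nlinarith)

theorem hasDerivAt_sqrt_sq_add_sq (x : ℝ) {y : ℝ} (hy : 0 < y) :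
    HasDerivAt (fun y => √(x ^ 2 + y ^ 2)) (y / √(x ^ 2 + y ^ 2)) y := by
  have := ((hasDerivAt_id y).fun_pow 2).const_add (x ^ 2)
  refine (this.sqrt (by simp only [id]; positivity)).congr_deriv ?_
  simp
  field_simp

theorem hasDerivAt_sqrt_sq_add_sq_left (x : ℝ) {y : ℝ} (hy : 0 < y) :
    HasDerivAt (fun x => √(x ^ 2 + y ^ 2)) (x / √(x ^ 2 + y ^ 2)) x := by
  have := ((hasDerivAt_id x).fun_pow 2).add_const (y ^ 2)
  refine (this.sqrt (by simp only [id]; positivity)).congr_deriv ?_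
  simp
  field_simp

theorem continuousOn_comp_chord {E : ℝ → ℝ → ℝ} {X : Type*} [TopologicalSpace X] {s : Set X}
    (hE : ContinuousOn (fun p : ℝ × ℝ => E p.1 p.2) (univ ×ˢ Ioi 0)) {τ x y : X → ℝ}
    (hτ : ContinuousOn τ s) (hx : ContinuousOn x s) (hy : ContinuousOn y s)
    (hpos : ∀ p ∈ s, 0 < y p) :
    ContinuousOn (fun p => E (τ p) √(x p ^ 2 + y p ^ 2)) s :=
  hE.comp (f := fun p => (τ p, √(x p ^ 2 + y p ^ 2)))
    (hτ.prodMk ((hx.pow 2).add (hy.pow 2)).sqrt) fun p hp =>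
    ⟨mem_univ _, sqrt_sq_add_sq_pos _ (hpos p hp)⟩

namespace IsRadialSystem

variable {W₀ W₁ V Y : ℝ → ℝ → ℝ}

/-- The line integral `U (t, y)` of a potential `w` with `W₁ = ∂ₜ w`, `V = ∂_z w` solves the
one-dimensional wave equation, so `(∂ₜ + ∂_y) U` is constant along `t + y = const`. Followed back to
time `0`, it meets zero data. -/
theorem chord_system_zero (h : IsRadialSystem W₀ W₁ V Y) {L t y : ℝ} (hy : 0 < y) (htL : t < L) :
    ∫ x in (-L)..L, (W₁ t √(x ^ 2 + y ^ 2)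
      + V t √(x ^ 2 + y ^ 2) * (y / √(x ^ 2 + y ^ 2))) = 0 := by
  rcases le_or_gt t 0 with ht | ht
  · rw [← intervalIntegral.integral_zero (a := -L) (b := L)]
    refine intervalIntegral.integral_congr fun x _ => ?_
    have hr := sqrt_sq_add_sq_pos x hy
    simp only [h.zero_W₁ t ht _ hr, h.zero_V t ht _ hr, zero_mul, add_zero]
  set Z : ℝ → ℝ → ℝ := fun s x => W₁ (t - s) √(x ^ 2 + (y + s) ^ 2)
      + V (t - s) √(x ^ 2 + (y + s) ^ 2) * ((y + s) / √(x ^ 2 + (y + s) ^ 2)) with hZ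
  set Z' : ℝ → ℝ → ℝ := fun s x =>
      -(W₀ (t - s) √(x ^ 2 + (y + s) ^ 2) * (x / √(x ^ 2 + (y + s) ^ 2)) ^ 2
        - V (t - s) √(x ^ 2 + (y + s) ^ 2) * (x ^ 2 / √(x ^ 2 + (y + s) ^ 2) ^ 3)
        + V (t - s) √(x ^ 2 + (y + s) ^ 2) * ((y + s) ^ 2 / √(x ^ 2 + (y + s) ^ 2) ^ 3)) with hZ'
  have hpos : ∀ s ∈ Ioi (-y), 0 < y + s := fun s hs => by linarith [mem_Ioi.1 hs]
  have hcont : ∀ {E : ℝ → ℝ → ℝ}, ContinuousOn (fun p : ℝ × ℝ => E p.1 p.2) (univ ×ˢ Ioi 0) →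
      ContinuousOn (fun p : ℝ × ℝ => E (t - p.1) √(p.2 ^ 2 + (y + p.1) ^ 2))
        (Ioi (-y) ×ˢ uIcc (-L) L) := fun hE =>
    continuousOn_comp_chord hE (by fun_prop) (by fun_prop) (by fun_prop) fun p hp => hpos _ hp.1
  have hne : ∀ p ∈ Ioi (-y) ×ˢ uIcc (-L) L, √(p.2 ^ 2 + (y + p.1) ^ 2) ≠ 0 := fun p hp =>
    (sqrt_sq_add_sq_pos _ (hpos _ hp.1)).ne'
  have hcZ : ContinuousOn (fun p : ℝ × ℝ => Z p.1 p.2) (Ioi (-y) ×ˢ uIcc (-L) L) :=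
    (hcont h.continuousOn_W₁).add ((hcont h.continuousOn_V).mul
      (ContinuousOn.div (by fun_prop) (by fun_prop) hne))
  have hcZ' : ContinuousOn (fun p : ℝ × ℝ => Z' p.1 p.2) (Ioi (-y) ×ˢ uIcc (-L) L) := by
    refine ContinuousOn.neg (ContinuousOn.add (ContinuousOn.sub
      ((hcont h.continuousOn_W₀).mul ((ContinuousOn.div (by fun_prop) (by fun_prop) hne).pow 2))
      ((hcont h.continuousOn_V).mul ?_)) ((hcont h.continuousOn_V).mul ?_)) <;>
    exact ContinuousOn.div (by fun_prop) (by fun_prop) fun p hp => pow_ne_zero 3 (hne p hp)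
  have hd : ∀ s ∈ Ioi (-y), ∀ x ∈ uIcc (-L) L, HasDerivAt (fun s => Z s x) (Z' s x) s := by
    intro s hs x _
    have hys := hpos s hs
    have hr := sqrt_sq_add_sq_pos x hys
    have hr2 : √(x ^ 2 + (y + s) ^ 2) ^ 2 = x ^ 2 + (y + s) ^ 2 := sq_sqrt (by positivity)
    have hτ : HasDerivAt (fun s => t - s) (-1) s := (hasDerivAt_id s).const_sub t
    have hy' : HasDerivAt (fun s => y + s) 1 s := (hasDerivAt_id s).const_add y
    have hρ := (hasDerivAt_sqrt_sq_add_sq x hys).comp s hy'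
    have h1 := h.hasDerivAt_W₁ hτ hρ hr
    have h2 := (h.hasDerivAt_V hτ hρ hr).mul (hy'.div hρ hr.ne')
    refine (h1.add h2).congr_deriv ?_
    simp only [hZ', Function.comp_apply, Pi.div_apply]
    field_simp
    linear_combination (-W₀ (t - s) √(x ^ 2 + (y + s) ^ 2) * √(x ^ 2 + (y + s) ^ 2)
      + V (t - s) √(x ^ 2 + (y + s) ^ 2)) * hr2
  -- The derivative along the characteristic is exact in `x`, with primitive `-V x / r`; the end
  -- points `±L` lie outside the region reached at time `t - s`.
  have hZ'0 : ∀ s, 0 ≤ s → ∫ x in (-L)..L, Z' s x = 0 := by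
    intro s hs
    have hys : 0 < y + s := by linarith
    have hprim : ∀ x : ℝ, HasDerivAt (fun x => -(V (t - s) √(x ^ 2 + (y + s) ^ 2)
        * (x / √(x ^ 2 + (y + s) ^ 2)))) (Z' s x) x := by
      intro x
      have hr := sqrt_sq_add_sq_pos x hys
      have hr2 : √(x ^ 2 + (y + s) ^ 2) ^ 2 = x ^ 2 + (y + s) ^ 2 := sq_sqrt (by positivity)
      have hρ := hasDerivAt_sqrt_sq_add_sq_left x hys
      have h2 := (h.hasDerivAt_V (hasDerivAt_const x (t - s)) hρ hr).mul
        ((hasDerivAt_id x).div hρ hr.ne')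
      refine h2.neg.congr_deriv ?_
      simp only [hZ', id, Pi.div_apply]
      field_simp
      linear_combination (-V (t - s) √(x ^ 2 + (y + s) ^ 2)) * hr2
    rw [intervalIntegral.integral_eq_sub_of_hasDerivAt (fun x _ => hprim x)
      (ContinuousOn.intervalIntegrable (hcZ'.comp (f := fun x => (s, x)) (by fun_prop)
        fun x hx => ⟨by simp; linarith, hx⟩))]
    have hv : ∀ x : ℝ, L ≤ |x| → V (t - s) √(x ^ 2 + (y + s) ^ 2) = 0 := fun x hx =>
      (h.eq_zero_of_lt (sqrt_sq_add_sq_pos _ hys) (by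
        rw [← sq_abs x]
        have := le_sqrt_sq_add_sq (L := |x|) (y + s)
        linarith)).2
    rw [hv L (le_abs_self L), hv (-L) (by rw [abs_neg]; exact le_abs_self L)]
    simp
  have hder : ∀ s ∈ Ioi (-y), HasDerivAt (fun s => ∫ x in (-L)..L, Z s x)
      (∫ x in (-L)..L, Z' s x) s := fun s hs =>
    hasDerivAt_intervalIntegral isOpen_Ioi hs (fun s hs => hcZ.comp (f := fun x => (s, x))
      (by fun_prop) fun x hx => ⟨hs, hx⟩) hcZ' hd
  have hconst := constant_of_has_deriv_right_zero (a := 0) (b := t)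
    (f := fun s => ∫ x in (-L)..L, Z s x)
    (fun s hs => (hder s (by simp; linarith [hs.1])).continuousAt.continuousWithinAt)
    (fun s hs => by
      have := hder s (by simp; linarith [hs.1])
      rw [hZ'0 s hs.1] at this
      exact this.hasDerivWithinAt) t ⟨ht.le, le_rfl⟩
  have hend : ∫ x in (-L)..L, Z t x = 0 := by
    rw [← intervalIntegral.integral_zero (a := -L) (b := L)]
    refine intervalIntegral.integral_congr fun x _ => ?_
    have hr := sqrt_sq_add_sq_pos x (show 0 < y + t by linarith)
    simp only [hZ, sub_self, h.zero_W₁ 0 le_rfl _ hr, h.zero_V 0 le_rfl _ hr, zero_mul, add_zero]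
  rw [hend] at hconst
  simpa [hZ] using hconst.symm

/-- The slope `c` is used with two values: `1` follows the outgoing characteristic, `0`
differentiates in time alone. -/
theorem hasDerivAt_chord_W₁ (h : IsRadialSystem W₀ W₁ V Y) (L : ℝ) {t y : ℝ} (hy : 0 < y) (c : ℝ) :
    HasDerivAt (fun s => ∫ x in (-L)..L, W₁ (t + s) √(x ^ 2 + (y + c * s) ^ 2))
      (∫ x in (-L)..L, (W₀ t √(x ^ 2 + y ^ 2)
        + c * (Y t √(x ^ 2 + y ^ 2) * (y / √(x ^ 2 + y ^ 2))))) 0 := by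
  set U := {s : ℝ | 0 < y + c * s} with hU
  have hUo : IsOpen U := isOpen_lt continuous_const (by fun_prop)
  have h0 : (0 : ℝ) ∈ U := by simpa [hU] using hy
  have hcont : ∀ {E : ℝ → ℝ → ℝ}, ContinuousOn (fun p : ℝ × ℝ => E p.1 p.2) (univ ×ˢ Ioi 0) →
      ContinuousOn (fun p : ℝ × ℝ => E (t + p.1) √(p.2 ^ 2 + (y + c * p.1) ^ 2))
        (U ×ˢ uIcc (-L) L) := fun hE =>
    continuousOn_comp_chord hE (by fun_prop) (by fun_prop) (by fun_prop) fun p hp => hp.1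
  have := hasDerivAt_intervalIntegral (s := 0) (a := -L) (b := L)
    (F := fun s x => W₁ (t + s) √(x ^ 2 + (y + c * s) ^ 2))
    (F' := fun s x => W₀ (t + s) √(x ^ 2 + (y + c * s) ^ 2)
      + c * (Y (t + s) √(x ^ 2 + (y + c * s) ^ 2) * ((y + c * s) / √(x ^ 2 + (y + c * s) ^ 2))))
    hUo h0 (fun s hs => (hcont h.continuousOn_W₁).comp (f := fun x => (s, x))
      (by fun_prop) fun x hx => ⟨hs, hx⟩)
    ((hcont h.continuousOn_W₀).add (continuousOn_const.mul ((hcont h.continuousOn_Y).mul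
      (ContinuousOn.div (by fun_prop) (by fun_prop) fun p hp =>
        (sqrt_sq_add_sq_pos _ hp.1).ne')))) (fun s hs x _ => by
      replace hs : 0 < y + c * s := hs
      have hr := sqrt_sq_add_sq_pos x hs
      have hy' : HasDerivAt (fun s => y + c * s) c s := by
        simpa using ((hasDerivAt_id s).const_mul c).const_add y
      have hρ := (hasDerivAt_sqrt_sq_add_sq x hs).comp s hy'
      refine (h.hasDerivAt_W₁ ((hasDerivAt_id s).const_add t) hρ hr).congr_deriv ?_
      simp only [Function.comp_apply, id]
      ring)
  simpa using this

end IsRadialSystem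

/-! ### Chord integrals depend on `t - y` only -/

namespace IsRadialSystem

variable {W₀ W₁ V Y : ℝ → ℝ → ℝ}

/-- Time differentiation of `chord_system_zero`: it now says that `∂ₜ + ∂_y` annihilates the chord
integral of `W₁`. -/
theorem chord_system_deriv_zero (h : IsRadialSystem W₀ W₁ V Y) {L t y : ℝ} (hy : 0 < y)
    (htL : t < L) :
    ∫ x in (-L)..L, (W₀ t √(x ^ 2 + y ^ 2)
      + Y t √(x ^ 2 + y ^ 2) * (y / √(x ^ 2 + y ^ 2))) = 0 := by
  have hcont : ∀ {E : ℝ → ℝ → ℝ}, ContinuousOn (fun p : ℝ × ℝ => E p.1 p.2) (univ ×ˢ Ioi 0) →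
      Continuous (fun p : ℝ × ℝ => E p.1 √(p.2 ^ 2 + y ^ 2)) := fun hE => by
    rw [← continuousOn_univ]
    exact continuousOn_comp_chord hE (by fun_prop) (by fun_prop) (by fun_prop) fun p _ => hy
  have hne : ∀ x, √(x ^ 2 + y ^ 2) ≠ 0 := fun x => (sqrt_sq_add_sq_pos _ hy).ne'
  have hq : Continuous fun p : ℝ × ℝ => y / √(p.2 ^ 2 + y ^ 2) :=
    Continuous.div (by fun_prop) (by fun_prop) fun p => hne _
  have hF := (hcont h.continuousOn_W₁).add ((hcont h.continuousOn_V).mul hq)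
  have := hasDerivAt_intervalIntegral (s := t) (a := -L) (b := L)
    (F := fun t x => W₁ t √(x ^ 2 + y ^ 2) + V t √(x ^ 2 + y ^ 2) * (y / √(x ^ 2 + y ^ 2)))
    (F' := fun t x => W₀ t √(x ^ 2 + y ^ 2) + Y t √(x ^ 2 + y ^ 2) * (y / √(x ^ 2 + y ^ 2)))
    isOpen_univ (mem_univ t)
    (fun s _ => (hF.comp (by fun_prop : Continuous fun x : ℝ => (s, x))).continuousOn)
    (((hcont h.continuousOn_W₀).add ((hcont h.continuousOn_Y).mul hq)).continuousOn)
    (fun s _ x _ => (h.time_W₁ s _ (sqrt_sq_add_sq_pos x hy)).add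
      ((h.time_V s _ (sqrt_sq_add_sq_pos x hy)).mul_const _))
  refine this.unique ((hasDerivAt_const t (0 : ℝ)).congr_of_eventuallyEq ?_)
  filter_upwards [gt_mem_nhds htL] with s hs using h.chord_system_zero hy hs

theorem chord_W₁_translate (h : IsRadialSystem W₀ W₁ V Y) {L t y s : ℝ} (hy : 0 < y) (hs : 0 ≤ s)
    (hL : t + s < L) :
    ∫ x in (-L)..L, W₁ (t + s) √(x ^ 2 + (y + s) ^ 2) = ∫ x in (-L)..L, W₁ t √(x ^ 2 + y ^ 2) := by
  have hd : ∀ σ ∈ Icc 0 s, HasDerivAt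
      (fun σ => ∫ x in (-L)..L, W₁ (t + σ) √(x ^ 2 + (y + σ) ^ 2)) 0 σ := by
    intro σ hσ
    have hyσ : 0 < y + σ := by linarith [hσ.1]
    have h1 := h.hasDerivAt_chord_W₁ L (t := t + σ) hyσ 1
    simp only [one_mul] at h1
    rw [h.chord_system_deriv_zero hyσ (by linarith [hσ.2])] at h1
    have h2 := HasDerivAt.comp_sub_const σ σ (f := _) (by rw [sub_self]; exact h1)
    simpa only [add_assoc, add_sub_cancel] using h2
  have := constant_of_has_deriv_right_zero (a := 0) (b := s)
    (fun σ hσ => (hd σ hσ).continuousAt.continuousWithinAt)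
    (fun σ hσ => (hd σ ⟨hσ.1, hσ.2.le⟩).hasDerivWithinAt) s ⟨hs, le_rfl⟩
  simpa using this

/-- A radial system provides no derivatives of `W₀`, so invariance is not proved for it directly: it
is obtained by differentiating that of `W₁` in time. -/
theorem chord_W₀_translate (h : IsRadialSystem W₀ W₁ V Y) {L t y s : ℝ} (hy : 0 < y) (hs : 0 ≤ s)
    (hL : t + s < L) :
    ∫ x in (-L)..L, W₀ (t + s) √(x ^ 2 + (y + s) ^ 2) = ∫ x in (-L)..L, W₀ t √(x ^ 2 + y ^ 2) := by
  have h1 := h.hasDerivAt_chord_W₁ L (t := t) hy 0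
  have h2 := h.hasDerivAt_chord_W₁ L (t := t + s) (y := y + s) (by linarith) 0
  simp only [zero_mul, add_zero] at h1 h2
  refine h2.unique (h1.congr_of_eventuallyEq ?_)
  filter_upwards [gt_mem_nhds (show (0 : ℝ) < L - (t + s) by linarith)] with σ hσ
  have := h.chord_W₁_translate (L := L) (t := t + σ) hy hs (by linarith)
  rwa [add_right_comm] at this

end IsRadialSystem

/-- Injectivity of the chord transform of radial functions. -/
theorem eq_zero_of_chord_eq_zero {E : ℝ → ℝ} {L : ℝ} (hL : 0 < L) (hE : ContinuousOn E (Ioi 0))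
    (hsupp : ∀ r, L ≤ r → E r = 0)
    (h0 : ∀ y > 0, ∫ x in (-L)..L, E √(x ^ 2 + y ^ 2) = 0) {z : ℝ} (hz : 0 < z) : E z = 0 := by
  -- The function `E √(x² + y² + z²)` is integrated over the `(x, y)`-plane in two ways. Each line
  -- `y = const` gives a chord integral at distance `√(y² + z²)`, hence `0`; polar coordinates give
  -- `2π` times the tail `∫ r E r` from `z`.
  have key : ∀ z > 0, ∫ r in z..L, r * E r = 0 := by
    intro z hz
    have hpos : ∀ q : ℝ, 0 ≤ q → 0 < √(q + z ^ 2) := fun q hq => by positivity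
    have hc : Continuous fun p : ℝ × ℝ => E √(p.1 ^ 2 + p.2 ^ 2 + z ^ 2) :=
      hE.comp_continuous (by fun_prop) fun p => hpos _ (by positivity)
    have hs : HasCompactSupport fun p : ℝ × ℝ => E √(p.1 ^ 2 + p.2 ^ 2 + z ^ 2) := by
      refine HasCompactSupport.intro (isCompact_closedBall (0 : ℝ × ℝ) L) fun p hp => hsupp _ ?_
      rw [mem_closedBall_zero_iff, not_le, Prod.norm_def, lt_max_iff] at hp
      refine le_sqrt_of_sq_le ?_
      rcases hp with hp | hp
      · have := sq_lt_sq' (by linarith) hp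
        rw [norm_eq_abs, sq_abs] at this
        nlinarith [sq_nonneg p.2, sq_nonneg z]
      · have := sq_lt_sq' (by linarith) hp
        rw [norm_eq_abs, sq_abs] at this
        nlinarith [sq_nonneg p.1, sq_nonneg z]
    have hi : Integrable (fun p : ℝ × ℝ => E √(p.1 ^ 2 + p.2 ^ 2 + z ^ 2)) (volume.prod volume) :=
      hc.integrable_of_hasCompactSupport hs
    have hline : ∀ y : ℝ, ∫ x, E √(x ^ 2 + y ^ 2 + z ^ 2) = 0 := by
      intro y
      have hy := hpos (y ^ 2) (by positivity)
      have := h0 _ hy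
      simp only [sq_sqrt (show 0 ≤ y ^ 2 + z ^ 2 by positivity), ← add_assoc] at this
      rw [← this, intervalIntegral.integral_of_le (by linarith)]
      refine (setIntegral_eq_integral_of_forall_compl_eq_zero fun x hx => hsupp _ ?_).symm
      refine le_sqrt_of_sq_le ?_
      have : L ≤ |x| := by
        by_contra! hlt
        exact hx ⟨(abs_lt.1 hlt).1, (abs_lt.1 hlt).2.le⟩
      have h2 := pow_le_pow_left₀ hL.le this 2
      rw [sq_abs] at h2
      nlinarith [sq_nonneg y, sq_nonneg z]
    have htot : ∫ p : ℝ × ℝ, E √(p.1 ^ 2 + p.2 ^ 2 + z ^ 2) = 0 := by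
      rw [Measure.volume_eq_prod, integral_prod_symm _ hi]
      simp [hline]
    rw [← integral_comp_polarCoord_symm] at htot
    have hpol : ∀ p : ℝ × ℝ, p.1 • E √((polarCoord.symm p).1 ^ 2 + (polarCoord.symm p).2 ^ 2
        + z ^ 2) = p.1 * E √(p.1 ^ 2 + z ^ 2) * 1 := fun p => by
      simp only [polarCoord_symm_apply, smul_eq_mul, mul_one]
      congr 3
      linear_combination (p.1 ^ 2) * (sin_sq_add_cos_sq p.2)
    simp only [hpol, polarCoord_target] at htot
    rw [Measure.volume_eq_prod, setIntegral_prod_mul (fun r => r * E √(r ^ 2 + z ^ 2)) (fun _ => 1)]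
      at htot
    have htwo : ∫ _ in Ioo (-π) π, (1 : ℝ) = 2 * π := by
      simp [pi_pos.le]; ring
    rw [htwo] at htot
    have hr : ∫ r in Ioi 0, r * E √(r ^ 2 + z ^ 2) = 0 := by
      rcases mul_eq_zero.1 htot with h | h
      · exact h
      · exact absurd h (by positivity)
    have hr' : ∫ r in 0..L, r * E √(r ^ 2 + z ^ 2) = 0 := by
      have hsd : ∀ r ∈ Ioi 0 \ Ioc 0 L, r * E √(r ^ 2 + z ^ 2) = 0 := fun r hr => by
        rw [hsupp, mul_zero]
        have : L ≤ r := by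
          by_contra! hlt
          exact hr.2 ⟨hr.1, hlt.le⟩
        exact this.trans (le_sqrt_sq_add_sq z)
      rw [intervalIntegral.integral_of_le hL.le]
      exact (setIntegral_eq_of_subset_of_forall_sdiff_eq_zero measurableSet_Ioi
        Ioc_subset_Ioi_self hsd).symm.trans hr
    have hsub := intervalIntegral.integral_comp_mul_deriv'' (a := 0) (b := L)
      (f := fun r => √(r ^ 2 + z ^ 2)) (f' := fun r => r / √(r ^ 2 + z ^ 2))
      (g := fun r => r * E r) (by fun_prop)
      (fun r _ => (hasDerivAt_sqrt_sq_add_sq_left r hz).hasDerivWithinAt)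
      (ContinuousOn.div (by fun_prop) (by fun_prop) fun r _ => (sqrt_sq_add_sq_pos r hz).ne')
      (ContinuousOn.mul (by fun_prop) (hE.mono (by
        rintro _ ⟨r, _, rfl⟩
        exact sqrt_sq_add_sq_pos r hz)))
    have hcongr : ∫ r in 0..L, ((fun r => r * E r) ∘ fun r => √(r ^ 2 + z ^ 2)) r
        * (r / √(r ^ 2 + z ^ 2)) = ∫ r in 0..L, r * E √(r ^ 2 + z ^ 2) := by
      refine intervalIntegral.integral_congr fun r _ => ?_
      have := (sqrt_sq_add_sq_pos r hz).ne'
      simp only [Function.comp_apply]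
      field_simp
    rw [hcongr, hr'] at hsub
    have hz0 : √((0 : ℝ) ^ 2 + z ^ 2) = z := by simp [sqrt_sq hz.le]
    rw [hz0] at hsub
    have hcr : ContinuousOn (fun r => r * E r) (Ioi 0) := continuousOn_id.mul hE
    have hint : ∀ a b : ℝ, 0 < a → 0 < b → IntervalIntegrable (fun r => r * E r) volume a b :=
      fun a b ha hb => (hcr.mono fun r hr => (lt_min ha hb).trans_le hr.1).intervalIntegrable
    rw [← intervalIntegral.integral_add_adjacent_intervals (hint z L hz hL)
      (hint L _ hL (sqrt_sq_add_sq_pos L hz))] at hsub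
    have htail : ∫ r in L..√(L ^ 2 + z ^ 2), r * E r = 0 := by
      rw [← intervalIntegral.integral_zero (a := L) (b := √(L ^ 2 + z ^ 2))]
      refine intervalIntegral.integral_congr fun r hr => ?_
      rw [uIcc_of_le (le_sqrt_sq_add_sq z)] at hr
      simp [hsupp r hr.1]
    linarith
  have hcr : ContinuousOn (fun r => r * E r) (Ioi 0) := continuousOn_id.mul hE
  -- Differentiating the vanishing tail integral in its lower limit leaves `-z * E z = 0`.
  have hd := intervalIntegral.integral_hasDerivAt_left (a := z) (b := L) (f := fun r => r * E r)
    ((hcr.mono fun r hr => (lt_min hz hL).trans_le hr.1).intervalIntegrable)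
    (hcr.stronglyMeasurableAtFilter isOpen_Ioi z hz) (hcr.continuousAt (Ioi_mem_nhds hz))
  have := hd.unique ((hasDerivAt_const z (0 : ℝ)).congr_of_eventuallyEq
    (by filter_upwards [lt_mem_nhds hz] with y hy using key y hy))
  rcases mul_eq_zero.1 (neg_eq_zero.1 this) with h | h
  · exact absurd h hz.ne'
  · exact h

/-! ### The chord transform near the axis -/

/-- Integration by parts in `x` trades `E`, on which no bound near the axis is known, for its
derivative `d`, which the energy controls; then `r = √(x² + y²)`. -/
theorem integral_chord_inner {E d : ℝ → ℝ} {y η : ℝ} (hy : 0 < y) (hyη : y < η)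
    (hd : ∀ r ∈ Ioc 0 η, HasDerivAt E (d r) r) (hdc : ContinuousOn d (Ioc 0 η)) :
    ∫ x in 0..√(η ^ 2 - y ^ 2), E √(x ^ 2 + y ^ 2)
      = √(η ^ 2 - y ^ 2) * E η - ∫ r in y..η, d r * √(r ^ 2 - y ^ 2) := by
  have hη : 0 < η := hy.trans hyη
  set X := √(η ^ 2 - y ^ 2) with hX
  have hX0 : 0 ≤ X := sqrt_nonneg _
  have hX2 : X ^ 2 = η ^ 2 - y ^ 2 := sq_sqrt (by nlinarith)
  have hXη : √(X ^ 2 + y ^ 2) = η := by rw [hX2, sub_add_cancel, sqrt_sq hη.le]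
  have h0y : √((0 : ℝ) ^ 2 + y ^ 2) = y := by simp [sqrt_sq hy.le]
  have hr : ∀ x ∈ uIcc 0 X, √(x ^ 2 + y ^ 2) ∈ Ioc 0 η := fun x hx => by
    rw [uIcc_of_le hX0] at hx
    refine ⟨sqrt_sq_add_sq_pos x hy, sqrt_le_iff.2 ⟨hη.le, ?_⟩⟩
    nlinarith [pow_le_pow_left₀ hx.1 hx.2 2]
  have hdc' : ContinuousOn (fun x => d √(x ^ 2 + y ^ 2)) (uIcc 0 X) :=
    hdc.comp (by fun_prop) hr
  have hq : ContinuousOn (fun x => x / √(x ^ 2 + y ^ 2)) (uIcc 0 X) :=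
    ContinuousOn.div (by fun_prop) (by fun_prop) fun x _ => (sqrt_sq_add_sq_pos x hy).ne'
  have hEd : ∀ x ∈ uIcc 0 X, HasDerivAt (fun x => E √(x ^ 2 + y ^ 2))
      (d √(x ^ 2 + y ^ 2) * (x / √(x ^ 2 + y ^ 2))) x := fun x hx =>
    (hd _ (hr x hx)).comp x (hasDerivAt_sqrt_sq_add_sq_left x hy)
  have hparts := intervalIntegral.integral_mul_deriv_eq_deriv_mul (v := fun x => x)
    (v' := fun _ => 1) hEd (fun x _ => hasDerivAt_id x) (hdc'.mul hq).intervalIntegrable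
    intervalIntegrable_const
  simp only [mul_one, mul_zero, sub_zero, hXη] at hparts
  rw [hparts, mul_comm X]
  congr 1
  have hsub := intervalIntegral.integral_comp_mul_deriv'' (a := 0) (b := X)
    (f := fun x => √(x ^ 2 + y ^ 2)) (f' := fun x => x / √(x ^ 2 + y ^ 2))
    (g := fun r => d r * √(r ^ 2 - y ^ 2)) (by fun_prop)
    (fun x _ => (hasDerivAt_sqrt_sq_add_sq_left x hy).hasDerivWithinAt) hq
    (ContinuousOn.mul (hdc.mono (by rintro _ ⟨x, hx, rfl⟩; exact hr x hx)) (by fun_prop))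
  rw [hXη, h0y] at hsub
  rw [← hsub]
  refine intervalIntegral.integral_congr fun x hx => ?_
  rw [uIcc_of_le hX0] at hx
  have : √(√(x ^ 2 + y ^ 2) ^ 2 - y ^ 2) = x := by
    rw [sq_sqrt (by positivity), add_sub_cancel_right, sqrt_sq hx.1]
  simp only [Function.comp_apply, this]
  ring

/-- In the variable `r` the distance `y` enters only through `y²`, in a kernel that is regular on `r
≥ η`. The substitution ends at `√(L² + y²)` rather than at `L`, but `E` vanishes in between. -/
theorem integral_chord_outer {E : ℝ → ℝ} {y η L : ℝ} (hy : 0 < y) (hyη : y < η) (hηL : η ≤ L)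
    (hE : ContinuousOn E (Ioi 0)) (hsupp : ∀ r, L ≤ r → E r = 0) :
    ∫ x in √(η ^ 2 - y ^ 2)..L, E √(x ^ 2 + y ^ 2)
      = ∫ r in η..L, E r * (r / √(r ^ 2 - y ^ 2)) := by
  have hη : 0 < η := hy.trans hyη
  have hpos : ∀ r ∈ Ici η, 0 < r ^ 2 - y ^ 2 := fun r hr => by
    have : η ≤ r := hr
    nlinarith
  have hL0 : 0 < L := hη.trans_le hηL
  set M := √(L ^ 2 + y ^ 2) with hM
  have hLM : L ≤ M := le_sqrt_sq_add_sq y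
  have hM2 : √(M ^ 2 - y ^ 2) = L := by
    rw [hM, sq_sqrt (by positivity), add_sub_cancel_right, sqrt_sq hL0.le]
  have hmem : ∀ r ∈ uIcc η M, r ∈ Ici η := fun r hr => by
    rw [uIcc_of_le (hηL.trans hLM)] at hr; exact hr.1
  have hder : ∀ r ∈ Ici η, HasDerivAt (fun r => √(r ^ 2 - y ^ 2)) (r / √(r ^ 2 - y ^ 2)) r :=
    fun r hr => by
      have := ((hasDerivAt_id r).fun_pow 2).sub_const (y ^ 2)
      refine (this.sqrt (hpos r hr).ne').congr_deriv ?_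
      simp
      field_simp
  have hq : ContinuousOn (fun r => r / √(r ^ 2 - y ^ 2)) (Ici η) :=
    ContinuousOn.div (by fun_prop) (by fun_prop) fun r hr => (sqrt_pos.2 (hpos r hr)).ne'
  have hsub := intervalIntegral.integral_comp_mul_deriv'' (a := η) (b := M)
    (f := fun r => √(r ^ 2 - y ^ 2)) (f' := fun r => r / √(r ^ 2 - y ^ 2))
    (g := fun x => E √(x ^ 2 + y ^ 2)) (by fun_prop)
    (fun r hr => (hder r (hmem r ⟨hr.1.le, hr.2.le⟩)).hasDerivWithinAt)
    (hq.mono hmem)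
    (hE.comp (by fun_prop) fun x _ => sqrt_sq_add_sq_pos x hy)
  rw [hM2] at hsub
  rw [← hsub]
  have hcongr : ∫ r in η..M, ((fun x => E √(x ^ 2 + y ^ 2)) ∘ fun r => √(r ^ 2 - y ^ 2)) r
      * (r / √(r ^ 2 - y ^ 2)) = ∫ r in η..M, E r * (r / √(r ^ 2 - y ^ 2)) := by
    refine intervalIntegral.integral_congr fun r hr => ?_
    have hr := hmem r hr
    simp only [Function.comp_apply, sq_sqrt (hpos r hr).le, sub_add_cancel,
      sqrt_sq (hη.le.trans hr)]
  have hc : ContinuousOn (fun r => E r * (r / √(r ^ 2 - y ^ 2))) (Ici η) :=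
    (hE.mono fun r hr => hη.trans_le hr).mul hq
  rw [hcongr, ← intervalIntegral.integral_add_adjacent_intervals (b := L)
    (hc.mono fun r hr => by rw [uIcc_of_le hηL] at hr; exact hr.1).intervalIntegrable
    (hc.mono fun r hr => by rw [uIcc_of_le hLM] at hr; exact hηL.trans hr.1).intervalIntegrable]
  rw [add_eq_left, ← intervalIntegral.integral_zero (a := L) (b := M)]
  refine intervalIntegral.integral_congr fun r hr => ?_
  rw [uIcc_of_le hLM] at hr
  simp [hsupp r hr.1]

theorem sqrt_sub_sqrt_le {r y y' : ℝ} (hr : 0 < r) :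
    √(r ^ 2 - y' ^ 2) - √(r ^ 2 - y ^ 2) ≤ min r (y ^ 2 / r) := by
  have h1 : √(r ^ 2 - y' ^ 2) ≤ r := sqrt_le_iff.2 ⟨hr.le, by nlinarith⟩
  have h2 := sqrt_nonneg (r ^ 2 - y ^ 2)
  refine le_min (by linarith) ((le_div_iff₀ hr).2 ?_)
  rcases le_or_gt (r ^ 2) (y ^ 2) with h | h
  · nlinarith
  · have h3 := sq_sqrt (sub_pos.2 h).le
    have h4 : √(r ^ 2 - y ^ 2) ≤ r := sqrt_le_iff.2 ⟨hr.le, by nlinarith⟩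
    nlinarith

/-- Replaces the minimum by a rational kernel whose primitive is `y² arctan (r² / y²)`. -/
theorem min_sq_le {r y : ℝ} (hr : 0 < r) (hy : 0 < y) :
    min r (y ^ 2 / r) ^ 2 ≤ r * (2 * r * y ^ 4 / (r ^ 4 + y ^ 4)) := by
  rw [← mul_div_assoc, le_div_iff₀ (by positivity)]
  rcases le_total r y with h | h
  · have h4 : r ^ 4 ≤ y ^ 4 := pow_le_pow_left₀ hr.le h 4
    have : min r (y ^ 2 / r) ^ 2 ≤ r ^ 2 :=
      pow_le_pow_left₀ (le_min hr.le (by positivity)) (min_le_left _ _) 2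
    calc _ ≤ r ^ 2 * (2 * y ^ 4) := by gcongr; linarith
      _ = _ := by ring
  · have h4 : y ^ 4 ≤ r ^ 4 := pow_le_pow_left₀ hy.le h 4
    have : min r (y ^ 2 / r) ^ 2 ≤ (y ^ 2 / r) ^ 2 :=
      pow_le_pow_left₀ (le_min hr.le (by positivity)) (min_le_right _ _) 2
    calc _ ≤ (y ^ 2 / r) ^ 2 * (r ^ 4 + y ^ 4) := by gcongr
      _ ≤ (y ^ 2 / r) ^ 2 * (2 * r ^ 4) := by gcongr; linarith
      _ = _ := by field_simp

theorem integral_arctan_kernel_le {y η : ℝ} (hy : 0 < y) :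
    ∫ r in 0..η, 2 * r * y ^ 4 / (r ^ 4 + y ^ 4) ≤ y ^ 2 * (π / 2) := by
  have hd : ∀ r : ℝ, HasDerivAt (fun r => y ^ 2 * arctan (r ^ 2 / y ^ 2))
      (2 * r * y ^ 4 / (r ^ 4 + y ^ 4)) r := fun r => by
    have := ((((hasDerivAt_id r).fun_pow 2).div_const (y ^ 2)).arctan).const_mul (y ^ 2)
    refine this.congr_deriv ?_
    simp
    field_simp
    ring
  rw [intervalIntegral.integral_eq_sub_of_hasDerivAt (fun r _ => hd r)
    (Continuous.intervalIntegrable (Continuous.div (by fun_prop) (by fun_prop)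
      fun r => by positivity) _ _)]
  simp only [ne_eq, OfNat.ofNat_ne_zero, not_false_eq_true, zero_pow, zero_div, arctan_zero,
    mul_zero, sub_zero]
  gcongr
  exact (arctan_lt_pi_div_two _).le

/-- The difference of the two roots is at most `m = min r (y² / r)`, and the weighted inequality
`|d| m ≤ (y μ / 2) r d² + m² / (2 y μ r)` separates the energy from the kernel, whose integral is at
most `y² π / 2`. The free `μ` lets both contributions be made small compared with `y`. -/
theorem abs_integral_inner_sub_le {d : ℝ → ℝ} {y y' η μ : ℝ} (hy' : 0 < y') (hyy : y' < y)
    (hyη : y < η) (hμ : 0 < μ) (hdc : ContinuousOn d (Ioc 0 η))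
    (hdi : IntervalIntegrable (fun r => r * d r ^ 2) volume 0 η) :
    |(∫ r in y..η, d r * √(r ^ 2 - y ^ 2)) - ∫ r in y'..η, d r * √(r ^ 2 - y' ^ 2)|
      ≤ y * (μ / 2 * (∫ r in 0..η, r * d r ^ 2) + π / (4 * μ)) := by
  have hy : 0 < y := hy'.trans hyy
  have hη : 0 < η := hy.trans hyη
  have hint : ∀ q : ℝ → ℝ, Continuous q → (∀ r ∈ Ioc 0 η, |q r| ≤ r) →
      IntervalIntegrable (fun r => d r * q r) volume 0 η := by
    intro q hq hqr
    rw [intervalIntegrable_iff_integrableOn_Ioc_of_le hη.le] at hdi ⊢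
    refine Integrable.mono' (hdi.add (continuous_id.integrableOn_Ioc (a := 0) (b := η)))
      ((hdc.mul hq.continuousOn).aestronglyMeasurable measurableSet_Ioc) ?_
    refine (ae_restrict_iff' measurableSet_Ioc).2 (.of_forall fun r hr => ?_)
    rw [norm_eq_abs, abs_mul]
    have h1 := hqr r hr
    have h2 : |d r| * |q r| ≤ |d r| * r := by gcongr
    simp only [Pi.add_apply, id]
    have h3 := sq_abs (d r)
    nlinarith [sq_nonneg (|d r| - 1), hr.1, abs_nonneg (d r)]
  have hroot : ∀ y r : ℝ, r ∈ Ioc 0 η → |√(r ^ 2 - y ^ 2)| ≤ r := fun y r hr => by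
    rw [abs_of_nonneg (sqrt_nonneg _)]
    exact sqrt_le_iff.2 ⟨hr.1.le, by nlinarith⟩
  have hext : ∀ y, 0 < y → y < η → ∫ r in y..η, d r * √(r ^ 2 - y ^ 2)
      = ∫ r in 0..η, d r * √(r ^ 2 - y ^ 2) := by
    intro y hy hyη
    have hi := hint (fun r => √(r ^ 2 - y ^ 2)) (by fun_prop) (hroot y)
    have hs : uIcc 0 y ⊆ uIcc 0 η := by
      rw [uIcc_of_le hy.le, uIcc_of_le hη.le]; exact Icc_subset_Icc_right hyη.le
    have hs' : uIcc y η ⊆ uIcc 0 η := by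
      rw [uIcc_of_le hyη.le, uIcc_of_le hη.le]; exact Icc_subset_Icc_left hy.le
    have h0 : ∫ r in 0..y, d r * √(r ^ 2 - y ^ 2) = ∫ _ in 0..y, (0 : ℝ) := by
      refine intervalIntegral.integral_congr fun r hr => ?_
      rw [uIcc_of_le hy.le] at hr
      rw [sqrt_eq_zero_of_nonpos (by nlinarith [hr.1, hr.2]), mul_zero]
    rw [← intervalIntegral.integral_add_adjacent_intervals (hi.mono_set hs) (hi.mono_set hs'), h0,
      intervalIntegral.integral_zero, zero_add]
  rw [hext y hy hyη, hext y' hy' (hyy.trans hyη), ← intervalIntegral.integral_sub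
    (hint _ (by fun_prop) (hroot y)) (hint _ (by fun_prop) (hroot y'))]
  have hk : IntervalIntegrable (fun r => 2 * r * y ^ 4 / (r ^ 4 + y ^ 4)) volume 0 η :=
    Continuous.intervalIntegrable (Continuous.div (by fun_prop) (by fun_prop)
      fun r => by positivity) _ _
  have hb := intervalIntegral.norm_integral_le_of_norm_le (E := ℝ) (a := 0) (b := η) (μ := volume)
    (f := fun r => d r * √(r ^ 2 - y ^ 2) - d r * √(r ^ 2 - y' ^ 2))
    (g := fun r => y * μ / 2 * (r * d r ^ 2)
      + 1 / (2 * y * μ) * (2 * r * y ^ 4 / (r ^ 4 + y ^ 4))) hη.le (.of_forall fun r hr => ?_)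
    ((hdi.const_mul _).add (hk.const_mul _))
  · refine hb.trans ?_
    rw [intervalIntegral.integral_add (hdi.const_mul _) (hk.const_mul _),
      intervalIntegral.integral_const_mul, intervalIntegral.integral_const_mul]
    have := integral_arctan_kernel_le (η := η) hy
    calc _ ≤ y * μ / 2 * (∫ r in 0..η, r * d r ^ 2) + 1 / (2 * y * μ) * (y ^ 2 * (π / 2)) := by
          gcongr
      _ = _ := by field_simp; ring
  · have hr0 := hr.1
    have hm0 : 0 ≤ min r (y ^ 2 / r) := le_min hr0.le (by positivity)
    have h1 : |√(r ^ 2 - y ^ 2) - √(r ^ 2 - y' ^ 2)| ≤ min r (y ^ 2 / r) := by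
      rw [abs_sub_comm, abs_of_nonneg (sub_nonneg.2 (sqrt_le_sqrt (by nlinarith)))]
      exact sqrt_sub_sqrt_le hr0
    have h2 := min_sq_le hr0 hy
    set m := min r (y ^ 2 / r)
    set κ := 2 * r * y ^ 4 / (r ^ 4 + y ^ 4)
    have hκ : m ^ 2 / r ≤ κ := (div_le_iff₀ hr0).2 (by linarith)
    rw [norm_eq_abs, ← mul_sub, abs_mul]
    calc _ ≤ |d r| * m := by gcongr
      _ ≤ y * μ / 2 * (r * d r ^ 2) + 1 / (2 * y * μ) * (m ^ 2 / r) := by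
        have : 0 ≤ (y * μ * r * |d r| - m) ^ 2 / (2 * y * μ * r) := by positivity
        have e : (y * μ * r * |d r| - m) ^ 2 / (2 * y * μ * r)
            = y * μ / 2 * (r * |d r| ^ 2) + 1 / (2 * y * μ) * (m ^ 2 / r) - |d r| * m := by
          field_simp
          ring
        rw [e, sq_abs] at this
        linarith
      _ ≤ _ := by gcongr

/-- Differentiability in `v` at `0`. Used with `v = y²`, it bounds the variation of the outer
contribution by `O(y²)`, hence by `o(y)`. -/
theorem exists_integral_chord_outer_sub_le {E : ℝ → ℝ} {η L : ℝ} (hη : 0 < η) (hηL : η ≤ L)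
    (hE : ContinuousOn E (Ioi 0)) :
    ∃ C ≥ 0, ∃ δ > 0, ∀ v, |v| < δ →
      |(√(η ^ 2 - v) * E η + ∫ r in η..L, E r * (r / √(r ^ 2 - v)))
        - (√(η ^ 2 - 0) * E η + ∫ r in η..L, E r * (r / √(r ^ 2 - 0)))| ≤ C * |v| := by
  have hmem : ∀ r ∈ uIcc η L, η ≤ r := fun r hr => by
    rw [uIcc_of_le hηL] at hr; exact hr.1
  have hpos : ∀ v ∈ Iio (η ^ 2), ∀ r, η ≤ r → 0 < r ^ 2 - v := fun v hv r hr => by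
    have : v < η ^ 2 := hv
    nlinarith
  have h0 : (0 : ℝ) ∈ Iio (η ^ 2) := show (0 : ℝ) < η ^ 2 by positivity
  have hE' : ContinuousOn E (uIcc η L) := hE.mono fun r hr => hη.trans_le (hmem r hr)
  have hroot : ∀ v ∈ Iio (η ^ 2), ∀ r, η ≤ r →
      HasDerivAt (fun v => √(r ^ 2 - v)) (-1 / (2 * √(r ^ 2 - v))) v := fun v hv r hr =>
    ((hasDerivAt_id v).const_sub (r ^ 2)).sqrt (hpos v hv r hr).ne'
  have hint := hasDerivAt_intervalIntegral (F := fun v r => E r * (r / √(r ^ 2 - v)))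
    (F' := fun v r => E r * (r / (2 * √(r ^ 2 - v) ^ 3))) (a := η) (b := L) isOpen_Iio h0
    (fun v hv => hE'.mul (ContinuousOn.div (by fun_prop) (by fun_prop)
      fun r hr => (sqrt_pos.2 (hpos v hv r (hmem r hr))).ne'))
    (ContinuousOn.mul (hE'.comp continuousOn_snd fun p hp => hp.2)
      (ContinuousOn.div (by fun_prop) (by fun_prop) fun p hp => by
        have := sqrt_pos.2 (hpos p.1 hp.1 p.2 (hmem _ hp.2))
        positivity))
    (fun v hv r hr => by
      have hp := sqrt_pos.2 (hpos v hv r (hmem r hr))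
      have := ((hasDerivAt_const v r).fun_div (hroot v hv r (hmem r hr)) hp.ne').const_mul (E r)
      refine this.congr_deriv ?_
      field_simp
      ring)
  have hd := ((hroot 0 h0 η le_rfl).mul_const (E η)).add hint
  obtain ⟨C, hC0, hC⟩ := hd.isBigO_sub.exists_nonneg
  obtain ⟨δ, hδ, hball⟩ := Metric.eventually_nhds_iff.1 hC.bound
  refine ⟨C, hC0, δ, hδ, fun v hv => ?_⟩
  have := hball (y := v) (by simpa [Real.dist_eq] using hv)
  simpa [norm_eq_abs] using this

theorem integral_chord_eq {E d : ℝ → ℝ} {y η L : ℝ} (hy : 0 < y) (hyη : y < η) (hηL : η ≤ L)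
    (hE : ContinuousOn E (Ioi 0)) (hsupp : ∀ r, L ≤ r → E r = 0)
    (hd : ∀ r ∈ Ioc 0 η, HasDerivAt E (d r) r) (hdc : ContinuousOn d (Ioc 0 η)) :
    ∫ x in (-L)..L, E √(x ^ 2 + y ^ 2)
      = 2 * ((√(η ^ 2 - y ^ 2) * E η + ∫ r in η..L, E r * (r / √(r ^ 2 - y ^ 2)))
        - ∫ r in y..η, d r * √(r ^ 2 - y ^ 2)) := by
  have hc : Continuous fun x => E √(x ^ 2 + y ^ 2) :=
    hE.comp_continuous (by fun_prop) fun x => sqrt_sq_add_sq_pos x hy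
  have hi := fun a b => hc.intervalIntegrable (μ := volume) a b
  have hneg : ∫ x in (-L)..0, E √(x ^ 2 + y ^ 2) = ∫ x in 0..L, E √(x ^ 2 + y ^ 2) := by
    have := intervalIntegral.integral_comp_neg (a := 0) (b := L) fun x => E √(x ^ 2 + y ^ 2)
    simp only [neg_sq, neg_zero] at this
    exact this.symm
  rw [← intervalIntegral.integral_add_adjacent_intervals (hi (-L) 0) (hi 0 L), hneg, ← two_mul,
    ← intervalIntegral.integral_add_adjacent_intervals (hi 0 √(η ^ 2 - y ^ 2)) (hi _ L),
    integral_chord_inner hy hyη hd hdc, integral_chord_outer hy hyη hηL hE hsupp]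
  ring

/-- This is where finite energy acts. A singularity `log r` would give chord integrals with a corner
`π |y|` at the axis; it is excluded because `r (1 / r)²` is not integrable at `0`. -/
theorem exists_abs_chord_sub_le {E d : ℝ → ℝ} {η L : ℝ} (hη : 0 < η) (hL : 0 < L)
    (hE : ContinuousOn E (Ioi 0)) (hsupp : ∀ r, L ≤ r → E r = 0)
    (hd : ∀ r ∈ Ioc 0 η, HasDerivAt E (d r) r) (hdc : ContinuousOn d (Ioc 0 η))
    (hdi : IntervalIntegrable (fun r => r * d r ^ 2) volume 0 η) {ε : ℝ} (hε : 0 < ε) :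
    ∃ δ > 0, ∀ y y', 0 < y' → y' < y → y < δ →
      |(∫ x in (-L)..L, E √(x ^ 2 + y ^ 2)) - ∫ x in (-L)..L, E √(x ^ 2 + y' ^ 2)| ≤ ε * y := by
  -- This value makes `π / (4 μ) = ε / 8`; then `ρ` is taken so small that the energy term is also
  -- at most `ε / 8`, and `y` so small that `C y ≤ ε / 8`. With the factor `2` for the two
  -- half-chords, the total is `2 (2 · ε/8 + 2 · ε/8) y = ε y`.
  set μ := 2 * π / ε with hμ
  have hμ0 : 0 < μ := by positivity
  obtain ⟨ρ, hρ0, hρη, hρL, hρ⟩ : ∃ ρ > 0, ρ ≤ η ∧ ρ ≤ L ∧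
      μ * ∫ r in 0..ρ, r * d r ^ 2 ≤ ε / 4 := by
    have hc := intervalIntegral.continuousOn_primitive_interval'
      (μ := volume) (a := 0) hdi (by rw [uIcc_of_le hη.le]; exact ⟨le_rfl, hη.le⟩)
    rw [uIcc_of_le hη.le] at hc
    have ht : Tendsto (fun ρ => μ * ∫ r in 0..ρ, r * d r ^ 2) (𝓝[>] 0) (𝓝 0) := by
      have h1 := (hc 0 ⟨le_rfl, hη.le⟩).tendsto.const_mul μ
      rw [intervalIntegral.integral_same, mul_zero] at h1
      refine h1.mono_left ?_
      rw [← nhdsWithin_Ioc_eq_nhdsGT hη]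
      exact nhdsWithin_mono _ Ioc_subset_Icc_self
    have h2 := (ht.eventually_lt_const (show 0 < ε / 4 by positivity)).and
      (Ioo_mem_nhdsGT (lt_min hη hL))
    obtain ⟨ρ, h1, h3, h4⟩ := h2.exists
    exact ⟨ρ, h3, h4.le.trans (min_le_left _ _), h4.le.trans (min_le_right _ _), h1.le⟩
  obtain ⟨C, hC0, δ, hδ, hC⟩ := exists_integral_chord_outer_sub_le hρ0 hρL hE
  have hsub : Ioc 0 ρ ⊆ Ioc 0 η := Ioc_subset_Ioc_right hρη
  refine ⟨min (min 1 δ) (min ρ (ε / (8 * C + 1))), by positivity, fun y y' hy' hyy hyδ => ?_⟩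
  have hy := hy'.trans hyy
  obtain ⟨⟨hy1, hyδ'⟩, hyρ, hyC⟩ : (y < 1 ∧ y < δ) ∧ y < ρ ∧ y < ε / (8 * C + 1) := by
    simpa only [lt_min_iff] using hyδ
  rw [lt_div_iff₀ (by positivity)] at hyC
  have hv : |y ^ 2| < δ := by rw [abs_of_pos (by positivity)]; nlinarith
  have hv' : |y' ^ 2| < δ := by rw [abs_of_pos (by positivity)]; nlinarith
  have h1 := hC _ hv
  have h2 := hC _ hv'
  rw [abs_of_nonneg (sq_nonneg y)] at h1
  rw [abs_of_nonneg (sq_nonneg y')] at h2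
  have h3 := abs_integral_inner_sub_le hy' hyy hyρ hμ0 (hdc.mono hsub) (hdi.mono_set (by
    rw [uIcc_of_le hρ0.le, uIcc_of_le hη.le]; exact Icc_subset_Icc_right hρη))
  rw [integral_chord_eq hy hyρ hρL hE hsupp (fun r hr => hd r (hsub hr)) (hdc.mono hsub),
    integral_chord_eq hy' (hyy.trans hyρ) hρL hE hsupp (fun r hr => hd r (hsub hr))
      (hdc.mono hsub)]
  have h4 : y * (μ / 2 * (∫ r in 0..ρ, r * d r ^ 2) + π / (4 * μ)) ≤ y * (ε / 4) := by
    have : π / (4 * μ) = ε / 8 := by rw [hμ]; field_simp; norm_num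
    rw [this]
    gcongr
    linarith
  have h5 : C * y' ^ 2 ≤ C * y ^ 2 := by gcongr
  have h6 : C * y ^ 2 ≤ ε / 8 * y := by nlinarith
  rw [abs_le] at *
  constructor <;> linarith [h1.1, h1.2, h2.1, h2.2, h3.1, h3.2]

/-! ### Vanishing of radial systems of finite energy -/

namespace IsRadialSystem

variable {W₀ W₁ V Y : ℝ → ℝ → ℝ}

/-- A radial system whose first component has finite energy near the axis vanishes. -/
theorem eq_zero (h : IsRadialSystem W₀ W₁ V Y)
    (hfin : ∀ t > 0, ∃ η > 0, ∃ d : ℝ → ℝ, (∀ r ∈ Ioc 0 η, HasDerivAt (W₀ t) (d r) r) ∧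
      ContinuousOn d (Ioc 0 η) ∧ IntervalIntegrable (fun r => r * d r ^ 2) volume 0 η)
    (T : ℝ) {z : ℝ} (hz : 0 < z) : W₀ T z = 0 := by
  rcases le_or_gt T 0 with hT | hT
  · exact h.W₀_eq_zero_of_lt hz (hT.trans_lt hz)
  -- The profile `p` below samples the system at distance `1`, hence at times up to `T + 1`; the
  -- chord must reach beyond the support at all of these.
  set L := T + 2 with hL
  have hL0 : 0 < L := by linarith
  have hcont : ∀ t, ContinuousOn (W₀ t) (Ioi 0) := fun t =>
    h.continuousOn_W₀.comp (f := fun r => (t, r)) (by fun_prop) fun r hr => ⟨mem_univ _, hr⟩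
  set p : ℝ → ℝ := fun s => ∫ x in (-L)..L, W₀ (s + 1) √(x ^ 2 + 1 ^ 2) with hp
  have hpc : Continuous p := by
    rw [← continuousOn_univ]
    exact continuousOn_intervalIntegral isOpen_univ (continuousOn_comp_chord h.continuousOn_W₀
      (by fun_prop) (by fun_prop) (by fun_prop) fun _ _ => one_pos)
  have hU : ∀ t ≤ T, ∀ y > 0, ∫ x in (-L)..L, W₀ t √(x ^ 2 + y ^ 2) = p (t - y) := by
    intro t ht y hy
    rcases le_total y 1 with hy1 | hy1
    · have := h.chord_W₀_translate (L := L) (t := t) (s := 1 - y) hy (by linarith) (by linarith)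
      rw [← this]
      simp only [hp, add_sub_cancel]
      rw [show t + (1 - y) = t - y + 1 by ring]
    · have := h.chord_W₀_translate (L := L) (t := t - y + 1) (s := y - 1) one_pos (by linarith)
        (by linarith)
      simp only [hp, ← this, add_sub_cancel]
      rw [show t - y + 1 + (y - 1) = t by ring]
  have hneg : ∀ s < 0, p s = 0 := by
    intro s hs
    simp only [hp]
    rw [← intervalIntegral.integral_zero (a := -L) (b := L)]
    refine intervalIntegral.integral_congr fun x _ => ?_
    have h1 : (1 : ℝ) ≤ √(x ^ 2 + 1 ^ 2) := le_sqrt_of_sq_le (by nlinarith [sq_nonneg x])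
    exact h.W₀_eq_zero_of_lt (by linarith) (by linarith)
  have hzero : p 0 = 0 := by
    have h1 : Tendsto p (𝓝[<] 0) (𝓝 (p 0)) := hpc.continuousAt.tendsto.mono_left inf_le_left
    refine tendsto_nhds_unique h1 (tendsto_const_nhds.congr' ?_)
    filter_upwards [self_mem_nhdsWithin] with s hs using (hneg s hs).symm
  -- At fixed `t`, the chord integrals at distances `y' < y` are `p (t - y')` and `p (t - y)` and
  -- differ by at most `ε y`. Letting `y' → 0` gives `p (t - y) - p t = o(y)`.
  have hder : ∀ t ∈ Ioc 0 T, HasDerivWithinAt p 0 (Iic t) t := by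
    intro t ht
    obtain ⟨η, hη, d, hd, hdc, hdi⟩ := hfin t ht.1
    rw [hasDerivWithinAt_iff_isLittleO, Asymptotics.isLittleO_iff]
    intro ε hε
    obtain ⟨δ, hδ, hbound⟩ := exists_abs_chord_sub_le hη hL0 (hcont t)
      (fun r hr => h.W₀_eq_zero_of_lt (by linarith) (by linarith [ht.2])) hd hdc hdi hε
    filter_upwards [self_mem_nhdsWithin, mem_nhdsWithin_of_mem_nhds (Ioi_mem_nhds
      (show t - δ < t by linarith))] with s hs hs'
    rcases (show s ≤ t from hs).eq_or_lt with rfl | hlt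
    · simp
    simp only [smul_zero, sub_zero, norm_eq_abs]
    have hy : 0 < t - s := by linarith
    rw [abs_sub_comm s t, abs_of_pos hy]
    have hlim : Tendsto (fun y' => |p s - p (t - y')|) (𝓝[>] 0) (𝓝 |p s - p t|) := by
      have h1 : Continuous fun y' => |p s - p (t - y')| := by fun_prop
      have := h1.tendsto 0
      rw [sub_zero] at this
      exact this.mono_left inf_le_left
    refine le_of_tendsto hlim ?_
    filter_upwards [Ioo_mem_nhdsGT hy] with y' hy'
    have h1 := hbound (t - s) y' hy'.1 hy'.2 (by have : t - δ < s := hs'; linarith)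
    rwa [hU t ht.2 _ hy, hU t ht.2 _ hy'.1, sub_sub_cancel] at h1
  have hpos : ∀ s ∈ Icc 0 T, p s = 0 := by
    -- Only left derivatives of `p` are known; the reflection `x ↦ -x` turns them into right
    -- derivatives, from which constancy follows.
    have hq : ∀ x ∈ Icc (-T) 0, p (-x) = p (- -T) := by
      refine constant_of_has_deriv_right_zero (f := fun x => p (-x)) (by fun_prop) fun x hx => ?_
      have h1 := hder (-x) ⟨by linarith [hx.2], by linarith [hx.1]⟩
      have := h1.scomp x (h := fun x => -x) (h' := -1) (s := Ici x)
        (hasDerivAt_neg x).hasDerivWithinAt fun u hu =>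
        neg_le_neg (show x ≤ u from hu)
      simpa using! this
    intro s hs
    have h1 := hq (-s) ⟨by linarith [hs.2], by linarith [hs.1]⟩
    have h2 := hq 0 ⟨by linarith, le_rfl⟩
    rw [neg_neg] at h1
    rw [h1, ← h2, neg_zero, hzero]
  refine eq_zero_of_chord_eq_zero hL0 (hcont T)
    (fun r hr => h.W₀_eq_zero_of_lt (by linarith) (by linarith)) (fun y hy => ?_) hz
  rw [hU T le_rfl y hy]
  rcases lt_or_ge (T - y) 0 with h1 | h1
  · exact hneg _ h1
  · exact hpos _ ⟨h1, by linarith⟩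

end IsRadialSystem

/-! ### Regularity of a vertical wave -/

theorem ContDiffOn.exists_partials {n : WithTop ℕ∞} {H : ℝ → ℝ → ℝ}
    (hH : ContDiffOn ℝ (n + 1) (fun p : ℝ × ℝ => H p.1 p.2) (Ici 0 ×ˢ Ioi 0)) :
    ∃ Ht Hz : ℝ → ℝ → ℝ, ContDiffOn ℝ n (fun p : ℝ × ℝ => Ht p.1 p.2) (Ici 0 ×ˢ Ioi 0) ∧
      ContDiffOn ℝ n (fun p : ℝ × ℝ => Hz p.1 p.2) (Ici 0 ×ˢ Ioi 0) ∧
      (∀ t ≥ 0, ∀ z > 0, HasDerivWithinAt (fun s => H s z) (Ht t z) (Ici 0) t) ∧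
      ∀ t ≥ 0, ∀ z > 0, HasDerivAt (H t) (Hz t z) z := by
  set S : Set (ℝ × ℝ) := Ici 0 ×ˢ Ioi 0 with hS
  have hu : UniqueDiffOn ℝ S := (uniqueDiffOn_Ici 0).prod isOpen_Ioi.uniqueDiffOn
  set F : ℝ × ℝ → ℝ := fun p => H p.1 p.2 with hF
  have hF' := hH.fderivWithin hu le_rfl
  have hd : ∀ p ∈ S, HasFDerivWithinAt F (fderivWithin ℝ F S p) S p := fun p hp =>
    (hH.differentiableOn (by simp) p hp).hasFDerivWithinAt
  refine ⟨fun t z => fderivWithin ℝ F S (t, z) (1, 0), fun t z => fderivWithin ℝ F S (t, z) (0, 1),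
    hF'.clm_apply contDiffOn_const, hF'.clm_apply contDiffOn_const, fun t ht z hz => ?_,
    fun t ht z hz => ?_⟩
  · have h1 : HasDerivWithinAt (fun s : ℝ => (s, z)) ((1 : ℝ), (0 : ℝ)) (Ici 0) t :=
      (hasDerivWithinAt_id t _).prodMk (hasDerivWithinAt_const t _ z)
    exact (hd (t, z) ⟨ht, hz⟩).comp_hasDerivWithinAt (f := fun s : ℝ => (s, z)) t h1
      fun s hs => ⟨hs, hz⟩
  · have h1 : HasDerivWithinAt (fun y : ℝ => (t, y)) ((0 : ℝ), (1 : ℝ)) (Ioi 0) z :=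
      (hasDerivWithinAt_const z _ t).prodMk (hasDerivWithinAt_id z _)
    exact ((hd (t, z) ⟨ht, hz⟩).comp_hasDerivWithinAt (f := fun y : ℝ => (t, y)) z h1
      fun y hy => ⟨ht, hy⟩).hasDerivAt (Ioi_mem_nhds hz)

/-- The partial derivatives of a vertical wave: `A = φ_t`, `B = φ_z`, `D = φ_tt`, `M = φ_tz`,
`N = φ_zz`. -/
structure IsWaveJet (φ A B D M N : ℝ → ℝ → ℝ) : Prop where
  continuousOn : ContinuousOn (fun p : ℝ × ℝ => φ p.1 p.2) (Ici 0 ×ˢ Ioi 0)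
  continuousOn_B : ContinuousOn (fun p : ℝ × ℝ => B p.1 p.2) (Ici 0 ×ˢ Ioi 0)
  continuousOn_D : ContinuousOn (fun p : ℝ × ℝ => D p.1 p.2) (Ici 0 ×ˢ Ioi 0)
  continuousOn_M : ContinuousOn (fun p : ℝ × ℝ => M p.1 p.2) (Ici 0 ×ˢ Ioi 0)
  continuousOn_N : ContinuousOn (fun p : ℝ × ℝ => N p.1 p.2) (Ici 0 ×ˢ Ioi 0)
  time : ∀ t ≥ 0, ∀ z > 0, HasDerivWithinAt (fun s => φ s z) (A t z) (Ici 0) t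
  space : ∀ t ≥ 0, ∀ z > 0, HasDerivAt (φ t) (B t z) z
  time_A : ∀ t ≥ 0, ∀ z > 0, HasDerivWithinAt (fun s => A s z) (D t z) (Ici 0) t
  space_A : ∀ t ≥ 0, ∀ z > 0, HasDerivAt (A t) (M t z) z
  space_B : ∀ t ≥ 0, ∀ z > 0, HasDerivAt (B t) (N t z) z
  wave : ∀ t > 0, ∀ z > 0, D t z = N t z + B t z / z

theorem IsVerticalWave.exists_jet {f g : ℝ → ℝ} {φ : ℝ → ℝ → ℝ} (h : IsVerticalWave f g φ) :
    ∃ A B D M N, IsWaveJet φ A B D M N := by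
  obtain ⟨A, B, hA, hB, htime, hspace⟩ :=
    ContDiffOn.exists_partials (n := 1) (H := φ) (by simpa [one_add_one_eq_two] using h.contDiffOn)
  obtain ⟨D, M, hD, hM, htA, hsA⟩ :=
    ContDiffOn.exists_partials (n := 0) (H := A) (by simpa using hA)
  obtain ⟨M', N, hM', hN, htB, hsB⟩ :=
    ContDiffOn.exists_partials (n := 0) (H := B) (by simpa using hB)
  refine ⟨A, B, D, M, N, h.contDiffOn.continuousOn, hB.continuousOn, hD.continuousOn,
    hM.continuousOn, hN.continuousOn, htime, hspace, htA, hsA, hsB, fun t ht z hz => ?_⟩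
  have hw := h.wave_eq t ht z hz
  have h1 : deriv (fun s => deriv (fun r => φ r z) s) t = D t z := by
    have : (fun s => deriv (fun r => φ r z) s) =ᶠ[𝓝 t] fun s => A s z := by
      filter_upwards [Ioi_mem_nhds ht] with s hs
      exact ((htime s (le_of_lt hs) z hz).hasDerivAt (Ici_mem_nhds hs)).deriv
    rw [this.deriv_eq]
    exact ((htA t ht.le z hz).hasDerivAt (Ici_mem_nhds ht)).deriv
  have h2 : deriv (fun y => y * deriv (fun x => φ t x) y) z = B t z + z * N t z := by
    have : (fun y => y * deriv (fun x => φ t x) y) =ᶠ[𝓝 z] fun y => y * B t y := by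
      filter_upwards [Ioi_mem_nhds hz] with y hy
      rw [(hspace t ht.le y hy).deriv]
    rw [this.deriv_eq]
    simpa using! ((hasDerivAt_id z).mul (hsB t ht.le z hz)).deriv
  rw [h1, h2] at hw
  field_simp at hw ⊢
  linarith

namespace IsWaveJet

variable {φ A B D M N : ℝ → ℝ → ℝ}

/-- Taylor's formula with integral remainder; it allows the wave equation to be used after
integrating twice in time. -/
theorem integral_sub_mul (h : IsWaveJet φ A B D M N) {t z : ℝ} (ht : 0 ≤ t) (hz : 0 < z) :
    ∫ s in 0..t, (t - s) * D s z = φ t z - φ 0 z - t * A 0 z := by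
  have hmaps : MapsTo (fun s : ℝ => (s, z)) (Icc 0 t) (Ici 0 ×ˢ Ioi 0) := fun s hs => ⟨hs.1, hz⟩
  have hDc : ContinuousOn (fun s => D s z) (Icc 0 t) :=
    h.continuousOn_D.comp (f := fun s : ℝ => (s, z)) (by fun_prop) hmaps
  have hφc : ContinuousOn (fun s => φ s z) (Icc 0 t) := fun s hs =>
    ((h.time s hs.1 z hz).continuousWithinAt).mono Icc_subset_Ici_self
  have hAc : ContinuousOn (fun s => A s z) (Icc 0 t) := fun s hs =>
    ((h.time_A s hs.1 z hz).continuousWithinAt).mono Icc_subset_Ici_self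
  have := intervalIntegral.integral_eq_sub_of_hasDerivAt_of_le
    (f := fun s => φ s z + (t - s) * A s z) (f' := fun s => (t - s) * D s z) ht
    (hφc.add (ContinuousOn.mul (by fun_prop) hAc)) (fun s hs => ?_)
    (ContinuousOn.intervalIntegrable (by
      rw [uIcc_of_le ht]; exact ContinuousOn.mul (by fun_prop) hDc))
  · rw [this]; ring
  · have h1 := (h.time s hs.1.le z hz).hasDerivAt (Ici_mem_nhds hs.1)
    have h2 := (h.time_A s hs.1.le z hz).hasDerivAt (Ici_mem_nhds hs.1)
    refine (h1.add (((hasDerivAt_id s).const_sub t).mul h2)).congr_deriv ?_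
    simp only [id]
    ring

theorem integral_wave (h : IsWaveJet φ A B D M N) {t z : ℝ} (ht : 0 ≤ t) (hz : 0 < z) :
    ∫ s in 0..t, (t - s) * (N s z + B s z / z) = φ t z - φ 0 z - t * A 0 z := by
  rw [← h.integral_sub_mul ht hz]
  refine intervalIntegral.integral_congr_ae (.of_forall fun s hs => ?_)
  rw [uIoc_of_le ht] at hs
  rw [h.wave s hs.1 z hz]

end IsWaveJet

/-- Continuing by a constant to negative times creates no corner, because the derivative at `0`
vanishes. This is how a system with zero data is extended to all times. -/
theorem hasDerivAt_comp_max {h h' : ℝ → ℝ} (hd : ∀ t ≥ 0, HasDerivWithinAt h (h' t) (Ici 0) t)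
    (h0 : h' 0 = 0) (t : ℝ) :
    HasDerivAt (fun t => h (max t 0)) (h' (max t 0)) t := by
  rcases lt_trichotomy t 0 with ht | rfl | ht
  · rw [max_eq_right ht.le, h0]
    refine (hasDerivAt_const t (h 0)).congr_of_eventuallyEq ?_
    filter_upwards [gt_mem_nhds ht] with s hs using by rw [max_eq_right hs.le]
  · rw [max_self, ← hasDerivWithinAt_univ, ← Iic_union_Ici (a := (0 : ℝ))]
    refine HasDerivWithinAt.union ?_ ?_
    · rw [h0]
      refine (hasDerivWithinAt_const 0 _ (h 0)).congr (fun s hs => ?_) (by simp)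
      rw [max_eq_right hs]
    · refine (hd 0 le_rfl).congr (fun s hs => ?_) (by simp)
      rw [max_eq_left hs]
  · rw [max_eq_left ht.le]
    refine ((hd t ht.le).hasDerivAt (Ici_mem_nhds ht)).congr_of_eventuallyEq ?_
    filter_upwards [lt_mem_nhds ht] with s hs using by rw [max_eq_left hs.le]

theorem continuousOn_timePrimitive {B : ℝ → ℝ → ℝ}
    (hB : ContinuousOn (fun p : ℝ × ℝ => B p.1 p.2) (univ ×ˢ Ioi 0)) :
    ContinuousOn (fun p : ℝ × ℝ => ∫ s in 0..p.1, B s p.2) (univ ×ˢ Ioi 0) := by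
  have h1 : ContinuousOn (fun p : ℝ × ℝ => ∫ u in 0..1, B (p.1 * u) p.2) (univ ×ˢ Ioi 0) :=
    continuousOn_intervalIntegral (isOpen_univ.prod isOpen_Ioi)
      (hB.comp (f := fun q : (ℝ × ℝ) × ℝ => (q.1.1 * q.2, q.1.2)) (by fun_prop)
        fun q hq => ⟨mem_univ _, hq.1.2⟩)
  refine (continuousOn_fst.mul h1).congr fun p _ => ?_
  have := intervalIntegral.mul_integral_comp_mul_left (f := fun s => B s p.2) (a := 0) (b := 1) p.1
  simpa using! this.symm

theorem hasDerivAt_timeIntegral {F F' : ℝ → ℝ → ℝ} (t : ℝ) {z : ℝ} (hz : 0 < z)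
    (hF : ContinuousOn (fun p : ℝ × ℝ => F p.1 p.2) (univ ×ˢ Ioi 0))
    (hF' : ContinuousOn (fun p : ℝ × ℝ => F' p.1 p.2) (univ ×ˢ Ioi 0))
    (hd : ∀ s, ∀ z > 0, HasDerivAt (F s) (F' s z) z) :
    HasDerivAt (fun z => ∫ s in 0..t, F s z) (∫ s in 0..t, F' s z) z :=
  hasDerivAt_intervalIntegral (F := fun z s => F s z) (F' := fun z s => F' s z) isOpen_Ioi hz
    (fun z hz => hF.comp (f := fun s => (s, z)) (by fun_prop) fun s _ => ⟨mem_univ _, hz⟩)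
    (hF'.comp (f := fun p : ℝ × ℝ => (p.2, p.1)) (by fun_prop) fun p hp => ⟨mem_univ _, hp.1⟩)
    (fun z hz s _ => hd s z hz)

/-! ### From a wave to a radial system -/

namespace IsWaveJet

variable {φ A B D M N : ℝ → ℝ → ℝ}

theorem continuousOn_comp_max {F : ℝ → ℝ → ℝ}
    (hF : ContinuousOn (fun p : ℝ × ℝ => F p.1 p.2) (Ici 0 ×ˢ Ioi 0)) :
    ContinuousOn (fun p : ℝ × ℝ => F (max p.1 0) p.2) (univ ×ˢ Ioi 0) :=
  hF.comp (f := fun p : ℝ × ℝ => (max p.1 0, p.2)) (by fun_prop) fun p hp =>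
    ⟨le_max_right p.1 0, hp.2⟩

theorem continuous_time_slice {F : ℝ → ℝ → ℝ}
    (hF : ContinuousOn (fun p : ℝ × ℝ => F p.1 p.2) (univ ×ˢ Ioi 0)) {z : ℝ} (hz : 0 < z) :
    Continuous fun s => F s z :=
  hF.comp_continuous (f := fun s => (s, z)) (by fun_prop) fun _ => ⟨mem_univ _, hz⟩

/-- The difference of a wave and the axial mean of its putative axis values, integrated in time,
gives a radial system. -/
theorem isRadialSystem (h : IsWaveJet φ A B D M N) {P P₁ γ : ℝ → ℝ} (hP : Continuous P)
    (hP₁ : ∀ s, HasDerivAt P₁ (P s) s) (hzero : ∀ z > 0, axialMean 0 P 0 z = φ 0 z)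
    (hone : ∀ z > 0, axialMean 1 P 0 z = γ z)
    (hγ : ∀ z > 0, HasDerivAt γ (A 0 z - γ z / z) z) :
    IsRadialSystem (fun t z => φ (max t 0) z - axialMean 0 P (max t 0) z)
      (fun t z => (∫ s in 0..max t 0, φ (max s 0) z)
        - (axialMean 0 P₁ (max t 0) z - axialMean 0 P₁ 0 z))
      (fun t z => (max t 0 * (∫ s in 0..max t 0, B (max s 0) z)
          - ∫ s in 0..max t 0, s * B (max s 0) z)
        - (axialMean 1 P₁ (max t 0) z - axialMean 1 P₁ 0 z) + max t 0 * γ z)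
      (fun t z => (∫ s in 0..max t 0, B (max s 0) z) - axialMean 1 P (max t 0) z + γ z) := by
  -- The potential behind the system is the twofold time integral of the difference. Since time and
  -- space derivatives of means both differentiate the profile, its `z`-derivative can be expressed
  -- through the primitive `P₁`, and `γ` records the mean of `P` with weight `cos θ` at time `0`. No
  -- derivative of `P` is needed.
  have hpp : IsPiecewisePrimitive P₁ P := .of_continuous hP hP₁
  have hφ := continuousOn_comp_max h.continuousOn
  have hB := continuousOn_comp_max h.continuousOn_B
  have hN := continuousOn_comp_max h.continuousOn_N
  have hsB : ContinuousOn (fun p : ℝ × ℝ => p.1 * B (max p.1 0) p.2) (univ ×ˢ Ioi 0) :=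
    continuousOn_fst.mul hB
  have hsN : ContinuousOn (fun p : ℝ × ℝ => p.1 * N (max p.1 0) p.2) (univ ×ˢ Ioi 0) :=
    continuousOn_fst.mul hN
  have hγc : ContinuousOn (fun p : ℝ × ℝ => γ p.2) (univ ×ˢ Ioi 0) := fun p hp =>
    ((hγ p.2 hp.2).continuousAt.comp continuousAt_snd).continuousWithinAt
  have hmax : ContinuousOn (fun p : ℝ × ℝ => (max p.1 0, p.2)) (univ ×ˢ Ioi 0) := by fun_prop
  have hmaps : MapsTo (fun p : ℝ × ℝ => (max p.1 0, p.2)) (univ ×ˢ Ioi 0) (univ ×ˢ Ioi 0) :=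
    fun p hp => ⟨mem_univ _, hp.2⟩
  have hIB := (continuousOn_timePrimitive (B := fun s z => B (max s 0) z) hB).comp hmax hmaps
  have hIsB := (continuousOn_timePrimitive (B := fun s z => s * B (max s 0) z) hsB).comp hmax hmaps
  have hmean : ∀ (j : ℕ) {Q : ℝ → ℝ}, Continuous Q →
      Continuous fun p : ℝ × ℝ => axialMean j Q (max p.1 0) p.2 := fun j Q hQ =>
    (continuous_axialMean hQ j).comp (f := fun p : ℝ × ℝ => (max p.1 0, p.2)) (by fun_prop)
  have hmean0 : ∀ (j : ℕ) {Q : ℝ → ℝ}, Continuous Q →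
      Continuous fun p : ℝ × ℝ => axialMean j Q 0 p.2 := fun j Q hQ =>
    (continuous_axialMean hQ j).comp (f := fun p : ℝ × ℝ => (0, p.2)) (by fun_prop)
  have hFTC : ∀ {F : ℝ → ℝ} (t : ℝ), Continuous F →
      HasDerivAt (fun t => ∫ s in 0..t, F s) (F t) t := fun t hF =>
    (hF.integral_hasStrictDerivAt 0 t).hasDerivAt
  refine ⟨hφ.sub (hmean 0 hP).continuousOn, (hIB.sub (hmean 1 hP).continuousOn).add hγc,
    ((((by fun_prop : Continuous fun p : ℝ × ℝ => max p.1 0).continuousOn.mul hIB).sub hIsB).sub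
      ((hmean 1 hpp.continuous).sub (hmean0 1 hpp.continuous)).continuousOn).add
      ((by fun_prop : Continuous fun p : ℝ × ℝ => max p.1 0).continuousOn.mul hγc),
    fun t z hz => ?_, fun t z hz => ?_, fun t z hz => ?_, fun t z hz => ?_, fun t ht z hz => ?_,
    fun t ht z hz => ?_⟩
  · refine hasDerivAt_comp_max (h := fun t => (∫ s in 0..t, φ (max s 0) z)
        - (axialMean 0 P₁ t z - axialMean 0 P₁ 0 z))
      (h' := fun t => φ (max t 0) z - axialMean 0 P t z) (fun t ht => ?_) ?_ t |>.congr_deriv ?_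
    · exact ((hFTC t (continuous_time_slice (F := fun s z => φ (max s 0) z) hφ hz)).sub
        ((hpp.hasDerivAt_axialMean_time 0 t hz).sub_const _)).hasDerivWithinAt
    · simp [hzero z hz]
    · simp
  · refine ((hasDerivAt_timeIntegral (max t 0) hz hφ hB
      fun s z hz => h.space _ (le_max_right s 0) z hz).sub
      ((hpp.hasDerivAt_axialMean_space 0 (max t 0) hz).sub
        (hpp.hasDerivAt_axialMean_space 0 0 hz))).congr_deriv ?_
    rw [zero_add, hone z hz]
    ring
  · refine hasDerivAt_comp_max (h := fun t => (t * (∫ s in 0..t, B (max s 0) z)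
          - ∫ s in 0..t, s * B (max s 0) z)
        - (axialMean 1 P₁ t z - axialMean 1 P₁ 0 z) + t * γ z)
      (h' := fun t => (∫ s in 0..t, B (max s 0) z) - axialMean 1 P t z + γ z) (fun t ht => ?_) ?_ t
    · refine (((((hasDerivAt_id t).mul (hFTC t (continuous_time_slice (F := fun s z => B (max s 0) z) hB hz))).sub
        (hFTC t (continuous_time_slice (F := fun s z => s * B (max s 0) z) hsB hz))).sub
        ((hpp.hasDerivAt_axialMean_time 1 t hz).sub_const _)).add
        ((hasDerivAt_id t).mul_const (γ z))).hasDerivWithinAt.congr_deriv ?_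
      simp only [id]
      ring
    · simp [hone z hz]
  -- The equation `V_z = W₀ - V / z` combines three facts: the twice integrated wave equation for
  -- `φ`, the identity `axialMean_add_two` at times `τ` and `0` for the mean, and the equation for
  -- `γ` for the part linear in time.
  · have h0 : ∀ t, axialMean 2 P t z = axialMean 0 P t z - axialMean 1 P₁ t z / z :=
      fun t => hpp.axialMean_add_two t hz
    set τ := max t 0 with hτ
    have hτ0 : 0 ≤ τ := le_max_right _ _
    refine (((((hasDerivAt_timeIntegral τ hz hB hN
      fun s z hz => h.space_B _ (le_max_right s 0) z hz).const_mul τ).sub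
      (hasDerivAt_timeIntegral (F := fun s z => s * B (max s 0) z)
        (F' := fun s z => s * N (max s 0) z) τ hz hsB hsN
        fun s z hz => (h.space_B _ (le_max_right s 0) z hz).const_mul s)).sub
      ((hpp.hasDerivAt_axialMean_space 1 τ hz).sub
        (hpp.hasDerivAt_axialMean_space 1 0 hz))).add ((hγ z hz).const_mul τ)).congr_deriv ?_
    have hBi := (continuous_time_slice (F := fun s z => B (max s 0) z) hB hz).intervalIntegrable (μ := volume) 0 τ
    have hNi := (continuous_time_slice (F := fun s z => N (max s 0) z) hN hz).intervalIntegrable (μ := volume) 0 τ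
    have hsBi := (continuous_time_slice (F := fun s z => s * B (max s 0) z) hsB hz
      ).intervalIntegrable (μ := volume) 0 τ
    have hsNi := (continuous_time_slice (F := fun s z => s * N (max s 0) z) hsN hz
      ).intervalIntegrable (μ := volume) 0 τ
    have hw := h.integral_wave hτ0 hz
    have hw' : ∫ s in 0..τ, (τ - s) * (N s z + B s z / z)
        = τ * (∫ s in 0..τ, N (max s 0) z) - (∫ s in 0..τ, s * N (max s 0) z)
          + (τ * (∫ s in 0..τ, B (max s 0) z) - ∫ s in 0..τ, s * B (max s 0) z) / z := by
      rw [← intervalIntegral.integral_const_mul, ← intervalIntegral.integral_const_mul,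
        ← intervalIntegral.integral_sub (hNi.const_mul τ) hsNi,
        ← intervalIntegral.integral_sub (hBi.const_mul τ) hsBi,
        ← intervalIntegral.integral_div,
        ← intervalIntegral.integral_add ((hNi.const_mul τ).sub hsNi)
          (((hBi.const_mul τ).sub hsBi).div_const z)]
      refine intervalIntegral.integral_congr fun s hs => ?_
      rw [uIcc_of_le hτ0] at hs
      simp only [max_eq_left hs.1]
      ring
    have h00 := hzero z hz
    have h1 := h0 τ
    have h2 := h0 0
    simp only [Nat.reduceAdd]
    rw [h1, h2, h00]
    rw [hw'] at hw
    linear_combination hw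
  · simp [max_eq_right ht]
  · simp [max_eq_right ht]

end IsWaveJet

/-! ### A vertical wave is the axial mean of its axis values -/

/-- For `|z| < t` the argument `t + z cos θ` stays positive, so the behaviour of the profile at the
origin plays no role. -/
theorem hasDerivAt_axialMean_of_pos {P Q : ℝ → ℝ} (hP : Continuous P) (hQ : ContinuousOn Q (Ioi 0))
    (hd : ∀ s > 0, HasDerivAt P (Q s) s) (t : ℝ) :
    ContinuousOn (axialMean 1 Q t) (Ioo (-t) t) ∧
      ∀ z ∈ Ioo (-t) t, HasDerivAt (axialMean 0 P t) (axialMean 1 Q t z) z := by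
  have hpos : ∀ z ∈ Ioo (-t) t, ∀ θ : ℝ, 0 < t + z * cos θ := fun z hz θ => by
    have h1 : |z * cos θ| ≤ |z| := by
      rw [abs_mul]; exact mul_le_of_le_one_right (abs_nonneg z) (abs_cos_le_one θ)
    have h2 := abs_lt.2 hz
    linarith [neg_abs_le (z * cos θ)]
  have hQc : ContinuousOn (fun p : ℝ × ℝ => cos p.2 ^ 1 * Q (t + p.1 * cos p.2))
      (Ioo (-t) t ×ˢ uIcc 0 π) :=
    ContinuousOn.mul (by fun_prop) (hQ.comp (by fun_prop) fun p hp => hpos p.1 hp.1 p.2)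
  refine ⟨continuousOn_const.mul (continuousOn_intervalIntegral isOpen_Ioo hQc), fun z hz => ?_⟩
  refine HasDerivAt.const_mul _ (hasDerivAt_intervalIntegral
    (F := fun z θ => cos θ ^ 0 * P (t + z * cos θ))
    (F' := fun z θ => cos θ ^ 1 * Q (t + z * cos θ)) isOpen_Ioo hz
    (fun z _ => Continuous.continuousOn (by fun_prop)) hQc fun z hz θ _ => ?_)
  have h1 : HasDerivAt (fun z => t + z * cos θ) (cos θ) z := by
    simpa using ((hasDerivAt_id z).mul_const (cos θ)).const_add t
  have h2 := ((hd _ (hpos z hz θ)).comp z h1).const_mul (cos θ ^ 0)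
  exact h2.congr_deriv (by ring)

theorem MemLp.intervalIntegrable_mul_sq {u : ℝ → ℝ} (hu : MemLp u 2 halfLineMeasure) {η : ℝ}
    (hη : 0 ≤ η) : IntervalIntegrable (fun r => r * u r ^ 2) volume 0 η := by
  have h1 := hu.integrable_sq
  rw [halfLineMeasure, integrable_withDensity_iff (by fun_prop) (by simp)] at h1
  rw [intervalIntegrable_iff_integrableOn_Ioc_of_le hη]
  refine (IntegrableOn.mono_set h1 Ioc_subset_Ioi_self).congr_fun (fun r hr => ?_) measurableSet_Ioc
  simp only
  rw [ENNReal.toReal_ofReal hr.1.le, mul_comm]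

theorem exists_primitive_of_contDiffOn {f : ℝ → ℝ} (hf : ContDiffOn ℝ 1 f (Ici 0)) :
    Continuous (fun x => derivWithin f (Ici 0) |x|) ∧ ∃ F : ℝ → ℝ,
      (∀ x, HasDerivAt F (derivWithin f (Ici 0) |x|) x) ∧ ∀ x ≥ 0, F x = f x := by
  have hk : Continuous fun x => derivWithin f (Ici 0) |x| :=
    (hf.continuousOn_derivWithin (uniqueDiffOn_Ici 0) le_rfl).comp_continuous continuous_abs
      fun x => abs_nonneg x
  refine ⟨hk, fun x => f 0 + ∫ y in 0..x, derivWithin f (Ici 0) |y|, fun x =>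
    ((hk.integral_hasStrictDerivAt 0 x).hasDerivAt).const_add (f 0), fun x hx => ?_⟩
  have : ∫ y in 0..x, derivWithin f (Ici 0) |y| = f x - f 0 := by
    refine intervalIntegral.integral_eq_sub_of_hasDeriv_right_of_le hx
      (hf.continuousOn.mono Icc_subset_Ici_self) (fun y hy => ?_) (hk.intervalIntegrable _ _)
    rw [abs_of_pos hy.1]
    exact ((hf.differentiableOn (by simp) y hy.1.le).hasDerivWithinAt.hasDerivAt
      (Ici_mem_nhds hy.1)).hasDerivWithinAt
  simp only [this]
  ring

/-- The axis values of the wave with data `(f, g)`. -/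
noncomputable def waveProfile (f g : ℝ → ℝ) : ℝ → ℝ :=
  axisProfile (f 0) (fun x => derivWithin f (Ici 0) |x|) (fun x => g |x|)

theorem continuous_waveProfile {f g : ℝ → ℝ} (hf : ContDiffOn ℝ 1 f (Ici 0))
    (hg : ContinuousOn g (Ici 0)) : Continuous (waveProfile f g) :=
  continuous_axisProfile _ (exists_primitive_of_contDiffOn hf).1
    (hg.comp_continuous continuous_abs fun x => abs_nonneg x)

theorem axialMean_zero_waveProfile {f g : ℝ → ℝ} (hf : ContDiffOn ℝ 1 f (Ici 0))
    (hg : ContinuousOn g (Ici 0)) {z : ℝ} (hz : 0 < z) :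
    axialMean 0 (waveProfile f g) 0 z = f z := by
  obtain ⟨hk, F, hF, hFf⟩ := exists_primitive_of_contDiffOn hf
  rw [waveProfile, ← hFf 0 le_rfl, ← hFf z hz.le]
  exact axialMean_zero_axisProfile hF hk
    (hg.comp_continuous continuous_abs fun x => abs_nonneg x) hz

/-- The difference of `φ` and the mean belongs to a radial system with zero data. The `L²` bound on
`∂_z φ` alone provides the finiteness at the axis that makes it vanish. -/
theorem IsVerticalWave.eq_axialMean {f g : ℝ → ℝ} {φ : ℝ → ℝ → ℝ} (hf : ContDiffOn ℝ 1 f (Ici 0))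
    (hg : ContinuousOn g (Ici 0)) (h : IsVerticalWave f g φ) {t z : ℝ} (ht : 0 ≤ t) (hz : 0 < z) :
    φ t z = axialMean 0 (waveProfile f g) t z := by
  obtain ⟨A, B, D, M, N, hj⟩ := h.exists_jet
  have hk := (exists_primitive_of_contDiffOn hf).1
  have hg' : Continuous fun x => g |x| :=
    hg.comp_continuous continuous_abs fun x => abs_nonneg x
  have hP := continuous_waveProfile hf hg
  have hA : ∀ z > 0, A 0 z = g z := fun z hz => by
    rw [← h.initial_velocity z hz,
      (hj.time 0 le_rfl z hz).derivWithin (uniqueDiffOn_Ici 0 0 self_mem_Ici)]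
  have hnear : ∀ z > (0 : ℝ), ∀ᶠ y in 𝓝 z, |y| = y ∧ 0 < y := fun z hz => by
    filter_upwards [lt_mem_nhds hz] with y hy using ⟨abs_of_pos hy, hy⟩
  have hB : ∀ z > 0, B 0 z = derivWithin f (Ici 0) z := fun z hz => by
    rw [derivWithin_of_mem_nhds (Ici_mem_nhds hz), ← (hj.space 0 le_rfl z hz).deriv]
    refine Filter.EventuallyEq.deriv_eq ?_
    filter_upwards [hnear z hz] with y hy using h.initial_value y hy.2
  -- The data inherit extra regularity for `z > 0` from the wave: `f'` and `g` are restrictions of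
  -- `φ_z` and `φ_t` to `t = 0`.
  have hkd : ∀ z > 0, HasDerivAt (fun x => derivWithin f (Ici 0) |x|) (N 0 z) z := fun z hz => by
    refine (hj.space_B 0 le_rfl z hz).congr_of_eventuallyEq ?_
    filter_upwards [hnear z hz] with y hy
    rw [hy.1, hB y hy.2]
  have hgd : ∀ z > 0, HasDerivAt (fun x => g |x|) (M 0 z) z := fun z hz => by
    refine (hj.space_A 0 le_rfl z hz).congr_of_eventuallyEq ?_
    filter_upwards [hnear z hz] with y hy
    rw [hy.1, hA y hy.2]
  have hslice : ∀ {F : ℝ → ℝ → ℝ} {t : ℝ}, 0 ≤ t →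
      ContinuousOn (fun p : ℝ × ℝ => F p.1 p.2) (Ici 0 ×ˢ Ioi 0) → ContinuousOn (F t) (Ioi 0) :=
    fun {F t} ht hF => hF.comp (f := fun z => (t, z)) (by fun_prop) fun z hz => ⟨ht, hz⟩
  obtain ⟨Q, hQ, hPQ⟩ := exists_hasDerivAt_axisProfile (f 0) hk hg' hkd
    (hslice le_rfl hj.continuousOn_N) hgd (hslice le_rfl hj.continuousOn_M)
  obtain ⟨P₁, hP₁⟩ := exists_primitive hP
  have hsys := hj.isRadialSystem (P₁ := P₁) (γ := fun z => (∫ ζ in 0..z, ζ * g |ζ|) / z) hP hP₁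
    (fun z hz => by rw [axialMean_zero_waveProfile hf hg hz, h.initial_value z hz])
    (fun z hz => axialMean_one_axisProfile (f 0) hk hg' hz)
    (fun z hz => by
      have h1 : HasDerivAt (fun z => ∫ ζ in 0..z, ζ * g |ζ|) (z * g |z|) z :=
        ((continuous_id.mul hg').integral_hasStrictDerivAt 0 z).hasDerivAt
      refine (h1.fun_div (hasDerivAt_id z) hz.ne').congr_deriv ?_
      rw [hA z hz, abs_of_pos hz]
      simp only [id]
      field_simp)
  have := hsys.eq_zero (fun t ht => ?_) t hz
  · rw [max_eq_left ht] at this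
    linarith
  -- Up to `r = t / 2` the mean only sees positive arguments, so its `z`-derivative is continuous
  -- down to the axis; `φ_z` has finite energy by hypothesis, and `(a - b)² ≤ 2 a² + 2 b²` combines
  -- the two.
  · have hmean := hasDerivAt_axialMean_of_pos hP hQ hPQ t
    have hsub : Icc 0 (t / 2) ⊆ Ioo (-t) t := fun r hr => ⟨by linarith [hr.1], by linarith [hr.2]⟩
    have hBc : ContinuousOn (B t) (Ioc 0 (t / 2)) :=
      (hslice ht.le hj.continuousOn_B).mono fun r hr => hr.1
    have hdc : ContinuousOn (fun r => B t r - axialMean 1 Q t r) (Ioc 0 (t / 2)) :=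
      hBc.sub (hmean.1.mono (Ioc_subset_Icc_self.trans hsub))
    refine ⟨t / 2, by positivity, fun r => B t r - axialMean 1 Q t r, fun r hr => ?_, hdc, ?_⟩
    · simp only [max_eq_left ht.le]
      exact (hj.space t ht.le r hr.1).sub (hmean.2 r (hsub ⟨hr.1.le, hr.2⟩))
    · have hi := MemLp.intervalIntegrable_mul_sq (h.memLp_space_deriv t ht.le)
        (show 0 ≤ t / 2 by positivity)
      have hi' : IntervalIntegrable (fun r => r * axialMean 1 Q t r ^ 2) volume 0 (t / 2) :=
        ContinuousOn.intervalIntegrable (by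
          rw [uIcc_of_le (by positivity)]
          exact continuousOn_id.mul ((hmean.1.mono hsub).pow 2))
      rw [intervalIntegrable_iff_integrableOn_Ioc_of_le (by positivity)] at hi hi' ⊢
      refine Integrable.mono' ((hi.const_mul 2).add (hi'.const_mul 2))
        ((continuousOn_id.mul (hdc.pow 2)).aestronglyMeasurable measurableSet_Ioc) ?_
      refine (ae_restrict_iff' measurableSet_Ioc).2 (.of_forall fun r hr => ?_)
      simp only [Pi.add_apply, (hj.space t ht.le r hr.1).deriv]
      rw [norm_eq_abs, abs_of_nonneg (mul_nonneg hr.1.le (sq_nonneg _))]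
      nlinarith [mul_nonneg hr.1.le (sq_nonneg (B t r + axialMean 1 Q t r))]

/-! ### Change of variables and the boundary trace -/

/-- Nothing is assumed of `G`, as the integrands below are singular at end points; a monotone
substitution transports integrability as well as the value. -/
theorem integral_Ioo_comp {x x' : ℝ → ℝ} {a b : ℝ} (hab : a < b) (hc : ContinuousOn x (Icc a b))
    (hd : ∀ u ∈ Ioo a b, HasDerivAt x (x' u) u) (hpos : ∀ u ∈ Ioo a b, 0 < x' u) (G : ℝ → ℝ) :
    (IntegrableOn G (Ioo (x a) (x b)) ↔ IntegrableOn (fun u => x' u * G (x u)) (Ioo a b)) ∧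
      ∫ y in Ioo (x a) (x b), G y = ∫ u in Ioo a b, x' u * G (x u) := by
  have hmono : StrictMonoOn x (Icc a b) := strictMonoOn_of_deriv_pos (convex_Icc a b) hc
    fun u hu => by rw [interior_Icc] at hu; rw [(hd u hu).deriv]; exact hpos u hu
  have himage : x '' Ioo a b = Ioo (x a) (x b) := by
    refine Subset.antisymm ?_ (intermediate_value_Ioo hab.le hc)
    rintro _ ⟨u, hu, rfl⟩
    exact ⟨hmono ⟨le_rfl, hab.le⟩ ⟨hu.1.le, hu.2.le⟩ hu.1,
      hmono ⟨hu.1.le, hu.2.le⟩ ⟨hab.le, le_rfl⟩ hu.2⟩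
  have hinj : InjOn x (Ioo a b) := (hmono.mono Ioo_subset_Icc_self).injOn
  have hd' : ∀ u ∈ Ioo a b, HasDerivWithinAt x (x' u) (Ioo a b) u :=
    fun u hu => (hd u hu).hasDerivWithinAt
  have hcongr : EqOn (fun u => |x' u| • G (x u)) (fun u => x' u * G (x u)) (Ioo a b) :=
    fun u hu => by simp only [abs_of_pos (hpos u hu), smul_eq_mul]
  rw [← himage]
  exact ⟨(integrableOn_image_iff_integrableOn_abs_deriv_smul measurableSet_Ioo hd' hinj G).trans
    (integrableOn_congr_fun hcongr measurableSet_Ioo),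
    (integral_image_eq_integral_abs_deriv_smul measurableSet_Ioo hd' hinj G).trans
      (setIntegral_congr_fun measurableSet_Ioo hcongr)⟩

theorem integral_mul_inv_sqrt_sq_sub_sq {s : ℝ} (hs : 0 < s) (H : ℝ → ℝ) :
    (IntegrableOn (fun ζ => H ζ * (√(s ^ 2 - ζ ^ 2))⁻¹) (Ioo 0 s) ↔
        IntegrableOn (fun α => H (s * sin α)) (Ioo 0 (π / 2))) ∧
      ∫ ζ in Ioo 0 s, H ζ * (√(s ^ 2 - ζ ^ 2))⁻¹ = ∫ α in Ioo 0 (π / 2), H (s * sin α) := by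
  have hcos : ∀ α ∈ Ioo 0 (π / 2), 0 < cos α := fun α hα =>
    cos_pos_of_mem_Ioo ⟨by linarith [hα.1, pi_pos], hα.2⟩
  have h := integral_Ioo_comp (x := fun α => s * sin α) (x' := fun α => s * cos α)
    (show 0 < π / 2 by positivity) (by fun_prop)
    (fun α _ => (hasDerivAt_sin α).const_mul s) (fun α hα => mul_pos hs (hcos α hα))
    (fun ζ => H ζ * (√(s ^ 2 - ζ ^ 2))⁻¹)
  have hcongr : EqOn (fun α => s * cos α * (H (s * sin α) * (√(s ^ 2 - (s * sin α) ^ 2))⁻¹))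
      (fun α => H (s * sin α)) (Ioo 0 (π / 2)) := fun α hα => by
    have hp := mul_pos hs (hcos α hα)
    have : √(s ^ 2 - (s * sin α) ^ 2) = s * cos α := by
      rw [show s ^ 2 - (s * sin α) ^ 2 = (s * cos α) ^ 2 by
        linear_combination -s ^ 2 * sin_sq_add_cos_sq α, sqrt_sq hp.le]
    have := (hcos α hα).ne'
    simp only [*]
    field_simp
  simp only [sin_zero, mul_zero, sin_pi_div_two, mul_one] at h
  exact ⟨h.1.trans (integrableOn_congr_fun hcongr measurableSet_Ioo),
    h.2.trans (setIntegral_congr_fun measurableSet_Ioo hcongr)⟩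

/-- Since `√` is `0` on negative numbers and `0⁻¹ = 0`, the kernel cuts itself off at `ζ = |s|`. The
range of `ζ` can then be a fixed interval, as Fubini requires. -/
theorem integrableOn_mul_inv_sqrt_sq_sub_sq {s R : ℝ} (hs : s ≠ 0) (hR : |s| ≤ R) {H : ℝ → ℝ}
    (hH : ContinuousOn H (Ici 0)) :
    IntegrableOn (fun ζ => H ζ * (√(s ^ 2 - ζ ^ 2))⁻¹) (Ioo 0 R) ∧
      ∫ ζ in Ioo 0 R, H ζ * (√(s ^ 2 - ζ ^ 2))⁻¹ = ∫ α in 0..π / 2, H (|s| * sin α) := by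
  have hs' := abs_pos.2 hs
  have hzero : ∀ ζ ∈ Ioo 0 R \ Ioo 0 |s|, H ζ * (√(s ^ 2 - ζ ^ 2))⁻¹ = 0 := fun ζ hζ => by
    have : |s| ≤ ζ := by
      by_contra! hlt
      exact hζ.2 ⟨hζ.1.1, hlt⟩
    have h2 := pow_le_pow_left₀ hs'.le this 2
    rw [sq_abs] at h2
    rw [sqrt_eq_zero_of_nonpos (by linarith), inv_zero, mul_zero]
  have hsub : Ioo 0 |s| ⊆ Ioo 0 R := Ioo_subset_Ioo_right hR
  obtain ⟨h1, h2⟩ := integral_mul_inv_sqrt_sq_sub_sq hs' H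
  rw [sq_abs] at h1 h2
  have hHc : ContinuousOn (fun α => H (|s| * sin α)) (Icc 0 (π / 2)) :=
    hH.comp (by fun_prop) fun α hα => mul_nonneg hs'.le
      (sin_nonneg_of_nonneg_of_le_pi hα.1 (by linarith [hα.2, pi_pos]))
  have hi := h1.2 (hHc.integrableOn_Icc.mono_set Ioo_subset_Icc_self)
  refine ⟨hi.of_forall_sdiff_eq_zero measurableSet_Ioo hzero, ?_⟩
  rw [intervalIntegral.integral_of_le (by positivity), integral_Ioc_eq_integral_Ioo, ← h2]
  exact setIntegral_eq_of_subset_of_forall_sdiff_eq_zero measurableSet_Ioo hsub hzero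

theorem intervalIntegrable_traceIntegrand {f g : ℝ → ℝ} (hf : ContDiffOn ℝ 1 f (Ici 0))
    (hg : ContinuousOn g (Ici 0)) {t : ℝ} (ht : 0 ≤ t) :
    IntervalIntegrable (traceIntegrand f g t) volume 0 t ∧
      f 0 + ∫ ζ in 0..t, traceIntegrand f g t ζ = waveProfile f g t := by
  have hk := (exists_primitive_of_contDiffOn hf).1
  have hg' : Continuous fun x => g |x| := hg.comp_continuous continuous_abs fun x => abs_nonneg x
  rcases ht.eq_or_lt with rfl | ht
  · simp [waveProfile, axisProfile, abelEven, abelOdd]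
  have hk' : ContinuousOn (derivWithin f (Ici 0)) (Ici 0) :=
    hf.continuousOn_derivWithin (uniqueDiffOn_Ici 0) le_rfl
  have h := integrableOn_mul_inv_sqrt_sq_sub_sq (R := t)
    (H := fun ζ => t * derivWithin f (Ici 0) ζ + ζ * g ζ) ht.ne' (abs_of_pos ht).le
    ((continuousOn_const.mul hk').add (continuousOn_id.mul hg))
  have he : ∀ ζ, (t * derivWithin f (Ici 0) ζ + ζ * g ζ) * (√(t ^ 2 - ζ ^ 2))⁻¹
      = traceIntegrand f g t ζ := fun ζ => by rw [traceIntegrand, div_eq_mul_inv]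
  simp only [he] at h
  refine ⟨(intervalIntegrable_iff_integrableOn_Ioo_of_le ht.le).2 h.1, ?_⟩
  have hsin : Continuous fun α => t * sin α := by fun_prop
  have hi1 : IntervalIntegrable (fun α => t * derivWithin f (Ici 0) |t * sin α|) volume 0 (π / 2) :=
    (continuous_const.mul (hk.comp hsin)).intervalIntegrable _ _
  have hi2 : IntervalIntegrable (fun α => t * (sin α * g |t * sin α|)) volume 0 (π / 2) :=
    (continuous_const.mul (continuous_sin.mul (hg'.comp hsin))).intervalIntegrable _ _
  rw [intervalIntegral.integral_of_le ht.le, integral_Ioc_eq_integral_Ioo, h.2, waveProfile,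
    axisProfile, abelEven, abelOdd, abs_of_pos ht, add_assoc,
    ← intervalIntegral.integral_const_mul, ← intervalIntegral.integral_const_mul,
    ← intervalIntegral.integral_add
      hi1 hi2]
  congr 1
  refine intervalIntegral.integral_congr fun α hα => ?_
  rw [uIcc_of_le (by positivity)] at hα
  have hα0 : 0 ≤ t * sin α :=
    mul_nonneg ht.le (sin_nonneg_of_nonneg_of_le_pi hα.1 (by linarith [hα.2, pi_pos]))
  simp only [abs_of_nonneg hα0]
  ring

theorem IsVerticalWave.tendsto_trace {f g : ℝ → ℝ} {φ : ℝ → ℝ → ℝ} (hf : ContDiffOn ℝ 1 f (Ici 0))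
    (hg : ContinuousOn g (Ici 0)) (h : IsVerticalWave f g φ) {t : ℝ} (ht : 0 ≤ t) :
    Tendsto (fun z => φ t z) (𝓝[>] 0) (𝓝 (waveProfile f g t)) := by
  have h1 : Tendsto (fun z => axialMean 0 (waveProfile f g) t z) (𝓝[>] 0)
      (𝓝 (axialMean 0 (waveProfile f g) t 0)) :=
    ((continuous_axialMean_right (continuous_waveProfile hf hg) 0 t).tendsto 0).mono_left inf_le_left
  rw [axialMean_right_zero] at h1
  refine h1.congr' ?_
  filter_upwards [self_mem_nhdsWithin] with z hz using (h.eq_axialMean hf hg ht hz).symm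

/-! ### A complete elliptic integral -/

/-- The complete elliptic integral of the first kind attached to a quartic with four real roots. -/
theorem integral_inv_sqrt_quartic {a b c d : ℝ} (hab : a < b) (hbc : b < c) (hcd : c < d) :
    IntegrableOn (fun s => (√((s - a) * (s - b) * (s - c) * (d - s)))⁻¹) (Ioo c d) ∧
      ∫ s in Ioo c d, (√((s - a) * (s - b) * (s - c) * (d - s)))⁻¹
        = π / √((d - b) * (c - a))
          * hypHalf ((d - c) * (b - a) / ((d - b) * (c - a))) := by
  have hdb : 0 < d - b := by linarith
  have hca : 0 < c - a := by linarith
  have hdc : 0 < d - c := by linarith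
  have hba : 0 < b - a := by linarith
  have hcb : 0 < c - b := by linarith
  set k := (d - c) * (b - a) / ((d - b) * (c - a)) with hk
  have hk0 : 0 ≤ k := by positivity
  have hk1 : k < 1 := by
    rw [hk, div_lt_one (by positivity)]
    nlinarith
  -- A Möbius map of `sin² α` that sends `0`, `1`, `∞` to `c`, `d`, `b`. The root `a` then
  -- corresponds to `1 / k`, which is Legendre's normal form.
  set x : ℝ → ℝ := fun α =>
    (c * (d - b) - b * (d - c) * sin α ^ 2) / (d - b - (d - c) * sin α ^ 2) with hx
  have hden : ∀ α, 0 < d - b - (d - c) * sin α ^ 2 := fun α => by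
    nlinarith [sin_sq_le_one α, sq_nonneg (sin α)]
  set x' : ℝ → ℝ := fun α => 2 * sin α * cos α * ((d - c) * (c - b) * (d - b))
    / (d - b - (d - c) * sin α ^ 2) ^ 2 with hx'
  have hd : ∀ α, HasDerivAt x (x' α) α := fun α => by
    have h1 : HasDerivAt (fun α => sin α ^ 2) (2 * sin α * cos α) α := by
      simpa using (hasDerivAt_sin α).fun_pow 2
    refine (((h1.const_mul (b * (d - c))).const_sub (c * (d - b))).fun_div
      ((h1.const_mul (d - c)).const_sub (d - b)) (hden α).ne').congr_deriv ?_
    simp only [hx']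
    congr 1
    ring
  have hsin : ∀ α ∈ Ioo 0 (π / 2), 0 < sin α := fun α hα =>
    sin_pos_of_pos_of_lt_pi hα.1 (by linarith [hα.2, pi_pos])
  have hcos : ∀ α ∈ Ioo 0 (π / 2), 0 < cos α := fun α hα =>
    cos_pos_of_mem_Ioo ⟨by linarith [hα.1, pi_pos], hα.2⟩
  have h := integral_Ioo_comp (x := x) (x' := x') (show 0 < π / 2 by positivity)
    (fun α _ => (hd α).continuousAt.continuousWithinAt) (fun α _ => hd α)
    (fun α hα => by
      have := hsin α hα
      have := hcos α hα
      have := hden α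
      positivity) (fun s => (√((s - a) * (s - b) * (s - c) * (d - s)))⁻¹)
  have hx0 : x 0 = c := by
    have := hden 0
    simp only [hx]
    rw [div_eq_iff this.ne', sin_zero]
    ring
  have hx1 : x (π / 2) = d := by
    have := hden (π / 2)
    simp only [hx]
    rw [div_eq_iff this.ne', sin_pi_div_two]
    ring
  rw [hx0, hx1] at h
  have hroot : ∀ α, 0 < 1 - k * sin α ^ 2 := fun α => by
    nlinarith [sin_sq_le_one α, sq_nonneg (sin α)]
  have hcongr : EqOn (fun α => x' α * (√((x α - a) * (x α - b) * (x α - c) * (d - x α)))⁻¹)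
      (fun α => 2 / √((d - b) * (c - a)) * (1 / √(1 - k * sin α ^ 2))) (Ioo 0 (π / 2)) := by
    intro α hα
    have hs := hsin α hα
    have hc := hcos α hα
    have hD := hden α
    have hr := sqrt_pos.2 (hroot α)
    have hm : 0 < √((d - b) * (c - a)) := by positivity
    have hcs : cos α ^ 2 = 1 - sin α ^ 2 := by linear_combination sin_sq_add_cos_sq α
    have hq : √((x α - a) * (x α - b) * (x α - c) * (d - x α))
        = sin α * cos α * ((d - c) * (c - b) * (d - b)) / (d - b - (d - c) * sin α ^ 2) ^ 2
          * (√((d - b) * (c - a)) * √(1 - k * sin α ^ 2)) := by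
      rw [← sqrt_mul (by positivity), ← sqrt_sq (show 0 ≤ sin α * cos α *
        ((d - c) * (c - b) * (d - b)) / (d - b - (d - c) * sin α ^ 2) ^ 2 by positivity),
        ← sqrt_mul (by positivity)]
      congr 1
      have e1 : x α - a = ((d - b) * (c - a)) * (1 - k * sin α ^ 2)
          / (d - b - (d - c) * sin α ^ 2) := by
        simp only [hx, hk]
        field_simp
        ring
      have e2 : x α - b = (c - b) * (d - b) / (d - b - (d - c) * sin α ^ 2) := by
        simp only [hx]
        field_simp
        ring
      have e3 : x α - c = (c - b) * (d - c) * sin α ^ 2 / (d - b - (d - c) * sin α ^ 2) := by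
        simp only [hx]
        field_simp
        ring
      have e4 : d - x α = (d - b) * (d - c) * cos α ^ 2 / (d - b - (d - c) * sin α ^ 2) := by
        simp only [hx]
        rw [hcs]
        field_simp
        ring
      rw [e1, e2, e3, e4]
      field_simp
    simp only [hx'] at hq ⊢
    rw [hq]
    generalize d - b - (d - c) * sin α ^ 2 = D at hD ⊢
    generalize √(1 - k * sin α ^ 2) = r at hr ⊢
    field_simp
  have hcont : Continuous fun α => 2 / √((d - b) * (c - a)) * (1 / √(1 - k * sin α ^ 2)) :=
    continuous_const.mul (Continuous.div continuous_const (by fun_prop)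
      fun α => (sqrt_pos.2 (hroot α)).ne')
  refine ⟨h.1.2 ((integrableOn_congr_fun hcongr measurableSet_Ioo).2
    (hcont.integrableOn_Icc.mono_set Ioo_subset_Icc_self)), ?_⟩
  rw [h.2, setIntegral_congr_fun measurableSet_Ioo hcongr, ← integral_Ioc_eq_integral_Ioo,
    ← intervalIntegral.integral_of_le (by positivity), intervalIntegral.integral_const_mul,
    integral_inv_sqrt_one_sub_mul_sin_sq hk0 hk1]
  ring

/-- The substitution `s = t + z cos θ` produces the arcsine density. It is carried out with `t - z
cos θ`, which increases, and transferred by `θ ↦ π - θ`. -/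
theorem integral_comp_add_mul_cos (t : ℝ) {z : ℝ} (hz : 0 < z) (Φ : ℝ → ℝ) :
    (IntegrableOn (fun θ => Φ (t + z * cos θ)) (Ioo 0 π) ↔
        IntegrableOn (fun s => (√((s - (t - z)) * (t + z - s)))⁻¹ * Φ s) (Ioo (t - z) (t + z))) ∧
      ∫ θ in Ioo 0 π, Φ (t + z * cos θ)
        = ∫ s in Ioo (t - z) (t + z), (√((s - (t - z)) * (t + z - s)))⁻¹ * Φ s := by
  have hπ := pi_pos
  have h := integral_Ioo_comp (x := fun θ => t - z * cos θ) (x' := fun θ => z * sin θ) pi_pos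
    (by fun_prop) (fun θ _ => by simpa using ((hasDerivAt_cos θ).const_mul z).const_sub t)
    (fun θ hθ => mul_pos hz (sin_pos_of_pos_of_lt_pi hθ.1 hθ.2))
    (fun s => (√((s - (t - z)) * (t + z - s)))⁻¹ * Φ s)
  have hcongr : EqOn (fun θ => z * sin θ * ((√((t - z * cos θ - (t - z))
      * (t + z - (t - z * cos θ))))⁻¹ * Φ (t - z * cos θ)))
      (fun θ => Φ (t - z * cos θ)) (Ioo 0 π) := fun θ hθ => by
    have hs := mul_pos hz (sin_pos_of_pos_of_lt_pi hθ.1 hθ.2)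
    have : √((t - z * cos θ - (t - z)) * (t + z - (t - z * cos θ))) = z * sin θ := by
      rw [← sqrt_sq hs.le]
      congr 1
      linear_combination -z ^ 2 * sin_sq_add_cos_sq θ
    simp only [this]
    rw [← mul_assoc, mul_inv_cancel₀ hs.ne', one_mul]
  simp only [cos_zero, cos_pi, mul_one, mul_neg, sub_neg_eq_add] at h
  rw [integrableOn_congr_fun hcongr measurableSet_Ioo,
    setIntegral_congr_fun measurableSet_Ioo hcongr] at h
  have hrefl : ∀ u : ℝ → ℝ, IntegrableOn u (Ioo 0 π) → IntegrableOn (fun θ => u (π - θ)) (Ioo 0 π) :=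
    fun u hu => by
      rw [← intervalIntegrable_iff_integrableOn_Ioo_of_le pi_pos.le] at hu ⊢
      simpa using (hu.comp_sub_left π).symm
  have hcos : ∀ θ, Φ (t + z * cos (π - θ)) = Φ (t - z * cos θ) := fun θ => by
    rw [cos_pi_sub, mul_neg, sub_eq_add_neg]
  rw [h.1, h.2]
  refine ⟨⟨fun hi => ?_, fun hi => ?_⟩, ?_⟩
  · simpa only [hcos] using hrefl _ hi
  · have := hrefl _ hi
    simpa only [cos_pi_sub, mul_neg, sub_neg_eq_add] using this
  · have := intervalIntegral.integral_comp_sub_left (a := 0) (b := π)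
      (fun θ => Φ (t + z * cos θ)) π
    simp only [hcos, sub_self, sub_zero] at this
    rw [intervalIntegral.integral_of_le pi_pos.le, intervalIntegral.integral_of_le pi_pos.le,
      integral_Ioc_eq_integral_Ioo, integral_Ioc_eq_integral_Ioo] at this
    exact this.symm

/-! ### The kernel of the axial mean of an Abel transform -/

theorem inv_sqrt_sq_sub_sq_eq_zero {s ζ : ℝ} (h : |s| ≤ ζ) : (√(s ^ 2 - ζ ^ 2))⁻¹ = 0 := by
  have := pow_le_pow_left₀ (abs_nonneg s) h 2
  rw [sq_abs] at this
  rw [sqrt_eq_zero_of_nonpos (by linarith), inv_zero]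

/-- The roots of the quartic are ordered `-ζ < ζ < t - z < t + z`, and the elliptic modulus is `1 /
w`. -/
theorem integral_kernel_of_lt_sub {t z ζ : ℝ} (hz : 0 < z) (hζ : 0 < ζ) (h : ζ < t - z) :
    IntegrableOn (fun θ => (√((t + z * cos θ) ^ 2 - ζ ^ 2))⁻¹) (Ioo 0 π) ∧
      ∫ θ in Ioo 0 π, (√((t + z * cos θ) ^ 2 - ζ ^ 2))⁻¹
        = π * (hypHalf (4 * ζ * z / (t ^ 2 - (ζ - z) ^ 2)) / √(t ^ 2 - (ζ - z) ^ 2)) := by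
  obtain ⟨h1, h2⟩ := integral_comp_add_mul_cos t hz fun s => (√(s ^ 2 - ζ ^ 2))⁻¹
  obtain ⟨h3, h4⟩ := integral_inv_sqrt_quartic (a := -ζ) (b := ζ) (c := t - z) (d := t + z)
    (by linarith) h (by linarith)
  have hcongr : EqOn (fun s => (√((s - -ζ) * (s - ζ) * (s - (t - z)) * (t + z - s)))⁻¹)
      (fun s => (√((s - (t - z)) * (t + z - s)))⁻¹ * (√(s ^ 2 - ζ ^ 2))⁻¹)
      (Ioo (t - z) (t + z)) := fun s hs => by
    have := hs.1
    have := hs.2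
    simp only
    rw [← mul_inv, ← sqrt_mul (mul_nonneg (by linarith) (by linarith))]
    congr 2
    ring
  rw [integrableOn_congr_fun hcongr measurableSet_Ioo] at h3
  rw [setIntegral_congr_fun measurableSet_Ioo hcongr] at h4
  refine ⟨h1.2 h3, ?_⟩
  rw [h2, h4, show (t + z - ζ) * (t - z - -ζ) = t ^ 2 - (ζ - z) ^ 2 by ring,
    show (t + z - (t - z)) * (ζ - -ζ) = 4 * ζ * z by ring]
  ring

/-- Here `t - z` and `ζ` have changed places among the roots, which inverts the modulus to `w`. The
part of the range below `ζ` contributes nothing, the kernel being cut off there. -/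
theorem integral_kernel_of_abs_lt {t z ζ : ℝ} (hz : 0 < z) (h : |t - z| < ζ) (h' : ζ < t + z) :
    IntegrableOn (fun θ => (√((t + z * cos θ) ^ 2 - ζ ^ 2))⁻¹) (Ioo 0 π) ∧
      ∫ θ in Ioo 0 π, (√((t + z * cos θ) ^ 2 - ζ ^ 2))⁻¹
        = π * (hypHalf ((t ^ 2 - (ζ - z) ^ 2) / (4 * ζ * z)) / (2 * (√z * √ζ))) := by
  obtain ⟨ha, hb⟩ := abs_lt.1 h
  have hζ : 0 < ζ := (abs_nonneg _).trans_lt h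
  obtain ⟨h1, h2⟩ := integral_comp_add_mul_cos t hz fun s => (√(s ^ 2 - ζ ^ 2))⁻¹
  obtain ⟨h3, h4⟩ := integral_inv_sqrt_quartic (a := -ζ) (b := t - z) (c := ζ) (d := t + z)
    ha hb h'
  have hcongr : EqOn (fun s => (√((s - -ζ) * (s - (t - z)) * (s - ζ) * (t + z - s)))⁻¹)
      (fun s => (√((s - (t - z)) * (t + z - s)))⁻¹ * (√(s ^ 2 - ζ ^ 2))⁻¹)
      (Ioo ζ (t + z)) := fun s hs => by
    have := hs.1
    have := hs.2
    simp only
    rw [← mul_inv, ← sqrt_mul (mul_nonneg (by linarith) (by linarith))]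
    congr 2
    ring
  have hzero : ∀ s ∈ Ioo (t - z) (t + z) \ Ioo ζ (t + z),
      (√((s - (t - z)) * (t + z - s)))⁻¹ * (√(s ^ 2 - ζ ^ 2))⁻¹ = 0 := fun s hs => by
    rw [inv_sqrt_sq_sub_sq_eq_zero, mul_zero]
    refine abs_le.2 ⟨by linarith [hs.1.1], ?_⟩
    by_contra! hlt
    exact hs.2 ⟨hlt, hs.1.2⟩
  rw [integrableOn_congr_fun hcongr measurableSet_Ioo] at h3
  rw [setIntegral_congr_fun measurableSet_Ioo hcongr] at h4
  refine ⟨h1.2 (h3.of_forall_sdiff_eq_zero measurableSet_Ioo hzero), ?_⟩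
  rw [h2, setIntegral_eq_of_subset_of_forall_sdiff_eq_zero measurableSet_Ioo
    (Ioo_subset_Ioo_left hb.le) hzero, h4,
    show (t + z - (t - z)) * (ζ - -ζ) = 2 ^ 2 * (z * ζ) by ring,
    show (t + z - ζ) * (t - z - -ζ) = t ^ 2 - (ζ - z) ^ 2 by ring, sqrt_mul (by positivity),
    sqrt_sq (by norm_num), sqrt_mul hz.le, show 2 ^ 2 * (z * ζ) = 4 * ζ * z by ring]
  ring

/-- The kernel lives on the two outer intervals `s < -ζ` and `s > ζ`. After the reflection `s ↦ -s`
both pieces are quartic integrals with the same modulus and prefactor, and the sign makes them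
cancel. This is why data at distance less than `z - t` do not contribute. -/
theorem integral_sign_mul_kernel_of_lt {t z ζ : ℝ} (ht : 0 ≤ t) (hζ : 0 < ζ) (h : ζ < z - t) :
    ∫ θ in Ioo 0 π, (t + z * cos θ) / |t + z * cos θ| * (√((t + z * cos θ) ^ 2 - ζ ^ 2))⁻¹ = 0 := by
  have hz : 0 < z := by linarith
  rw [(integral_comp_add_mul_cos t hz fun s => s / |s| * (√(s ^ 2 - ζ ^ 2))⁻¹).2]
  set w : ℝ → ℝ := fun s =>
    (√((s - (t - z)) * (t + z - s)))⁻¹ * (s / |s| * (√(s ^ 2 - ζ ^ 2))⁻¹) with hw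
  obtain ⟨h1, h2⟩ := integral_inv_sqrt_quartic (a := t - z) (b := -ζ) (c := ζ) (d := t + z)
    (by linarith) (by linarith) (by linarith)
  obtain ⟨h3, h4⟩ := integral_inv_sqrt_quartic (a := -(t + z)) (b := -ζ) (c := ζ) (d := z - t)
    (by linarith) (by linarith) (by linarith)
  have hc1 : EqOn (fun s => (√((s - (t - z)) * (s - -ζ) * (s - ζ) * (t + z - s)))⁻¹) w
      (Ioo ζ (t + z)) := fun s hs => by
    have := hs.1
    have := hs.2
    have hs0 : 0 < s := by linarith
    simp only [hw, abs_of_pos hs0, div_self hs0.ne', one_mul]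
    rw [← mul_inv, ← sqrt_mul (mul_nonneg (by linarith) (by linarith))]
    congr 2
    ring
  have hc2 : EqOn (fun s => (√((s - -(t + z)) * (s - -ζ) * (s - ζ) * (z - t - s)))⁻¹)
      (fun s => -w (-s)) (Ioo ζ (z - t)) := fun s hs => by
    have := hs.1
    have := hs.2
    have hs0 : 0 < s := by linarith
    simp only [hw, abs_neg, abs_of_pos hs0, neg_div, div_self hs0.ne', neg_mul, one_mul, mul_neg,
      neg_neg]
    rw [← mul_inv, ← sqrt_mul (mul_nonneg (by linarith) (by linarith))]
    congr 2
    ring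
  rw [integrableOn_congr_fun hc1 measurableSet_Ioo] at h1
  rw [setIntegral_congr_fun measurableSet_Ioo hc1] at h2
  rw [integrableOn_congr_fun hc2 measurableSet_Ioo,
    ← intervalIntegrable_iff_integrableOn_Ioo_of_le (by linarith)] at h3
  rw [setIntegral_congr_fun measurableSet_Ioo hc2, ← integral_Ioc_eq_integral_Ioo,
    ← intervalIntegral.integral_of_le (by linarith), intervalIntegral.integral_neg,
    intervalIntegral.integral_comp_neg, neg_sub,
    intervalIntegral.integral_of_le (by linarith), integral_Ioc_eq_integral_Ioo] at h4
  have h3' : IntegrableOn w (Ioo (t - z) (-ζ)) := by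
    rw [← intervalIntegrable_iff_integrableOn_Ioo_of_le (by linarith)]
    have := (h3.neg.comp_sub_left 0).symm
    simpa using! this
  have hzero : ∀ s ∈ Ioo (t - z) (t + z) \ (Ioo (t - z) (-ζ) ∪ Ioo ζ (t + z)), w s = 0 :=
    fun s hs => by
    simp only [hw]
    rw [inv_sqrt_sq_sub_sq_eq_zero, mul_zero, mul_zero]
    refine abs_le.2 ⟨?_, ?_⟩
    · by_contra! hlt
      exact hs.2 (.inl ⟨hs.1.1, hlt⟩)
    · by_contra! hlt
      exact hs.2 (.inr ⟨hlt, hs.1.2⟩)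
  rw [setIntegral_eq_of_subset_of_forall_sdiff_eq_zero measurableSet_Ioo
    (union_subset (Ioo_subset_Ioo_right (by linarith)) (Ioo_subset_Ioo_left (by linarith))) hzero,
    setIntegral_union (Set.disjoint_left.2 fun s hs hs' => by linarith [hs.2, hs'.1])
      measurableSet_Ioo h3' h1, h2, neg_eq_iff_eq_neg.1 h4, neg_add_eq_zero,
    show (z - t - -ζ) * (ζ - -(t + z)) = (t + z - -ζ) * (ζ - (t - z)) by ring,
    show (z - t - ζ) * (-ζ - -(t + z)) = (t + z - ζ) * (-ζ - (t - z)) by ring]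

/-! ### Fubini -/

/-- Integrating in `ζ` first gives `π / 2` for every angle with `t + z cos θ ≠ 0`, so Tonelli
applies without any analysis of the singular curve. -/
theorem integrable_kernel (t : ℝ) {z R : ℝ} (hz : 0 < z) (hR : |t| + z ≤ R) :
    Integrable (fun p : ℝ × ℝ => (√((t + z * cos p.1) ^ 2 - p.2 ^ 2))⁻¹)
      ((volume.restrict (Ioo 0 π)).prod (volume.restrict (Ioo 0 R))) := by
  have hne : ∀ᵐ θ ∂volume.restrict (Ioo 0 π), t + z * cos θ ≠ 0 := by
    refine (ae_restrict_iff' measurableSet_Ioo).2 ?_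
    filter_upwards [ae_add_mul_cos_ne (t := t) 0 hz] with θ hθ hθ'
    exact hθ (by rw [uIoc_of_le pi_pos.le]; exact Ioo_subset_Ioc_self hθ')
  have hle : ∀ θ, |t + z * cos θ| ≤ R := fun θ =>
    abs_add_mul_cos_le (by rwa [abs_of_pos hz]) θ
  have hone := fun θ (hθ : t + z * cos θ ≠ 0) => integrableOn_mul_inv_sqrt_sq_sub_sq hθ (hle θ)
    (H := fun _ => 1) continuousOn_const
  simp only [one_mul] at hone
  refine (integrable_prod_iff (Measurable.aestronglyMeasurable (by fun_prop))).2 ⟨?_, ?_⟩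
  · filter_upwards [hne] with θ hθ using (hone θ hθ).1
  · refine (integrable_const (π / 2)).congr ?_
    filter_upwards [hne] with θ hθ
    simp only [norm_eq_abs, abs_of_nonneg (inv_nonneg.2 (sqrt_nonneg _))]
    rw [(hone θ hθ).2]
    simp

theorem integrable_mul_kernel {t z R C : ℝ} (hz : 0 < z) (hR : |t| + z ≤ R) {L : ℝ × ℝ → ℝ}
    (hL : Measurable L) (hC : ∀ s ∈ Icc (t - z) (t + z), ∀ ζ ∈ Ioo 0 R, |L (s, ζ)| ≤ C) :
    Integrable (fun p : ℝ × ℝ => L (t + z * cos p.1, p.2)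
        * (√((t + z * cos p.1) ^ 2 - p.2 ^ 2))⁻¹)
      ((volume.restrict (Ioo 0 π)).prod (volume.restrict (Ioo 0 R))) := by
  refine Integrable.bdd_mul (c := C) (integrable_kernel t hz hR)
    (Measurable.aestronglyMeasurable (by fun_prop)) ?_
  rw [Measure.prod_restrict]
  refine (ae_restrict_iff' (measurableSet_Ioo.prod measurableSet_Ioo)).2 (.of_forall fun p hp => ?_)
  refine hC _ ⟨?_, ?_⟩ _ hp.2
  · nlinarith [neg_one_le_cos p.1]
  · nlinarith [cos_le_one p.1]

theorem integral_mul_kernel_swap {t z R C : ℝ} (hz : 0 < z) (hR : |t| + z ≤ R) {L : ℝ × ℝ → ℝ}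
    (hL : Measurable L) (hC : ∀ s ∈ Icc (t - z) (t + z), ∀ ζ ∈ Ioo 0 R, |L (s, ζ)| ≤ C) :
    IntegrableOn (fun ζ => ∫ θ in Ioo 0 π, L (t + z * cos θ, ζ)
        * (√((t + z * cos θ) ^ 2 - ζ ^ 2))⁻¹) (Ioo 0 R) ∧
      ∫ θ in Ioo 0 π, ∫ ζ in Ioo 0 R, L (t + z * cos θ, ζ) * (√((t + z * cos θ) ^ 2 - ζ ^ 2))⁻¹
        = ∫ ζ in Ioo 0 R, ∫ θ in Ioo 0 π, L (t + z * cos θ, ζ)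
          * (√((t + z * cos θ) ^ 2 - ζ ^ 2))⁻¹ :=
  ⟨(integrable_mul_kernel hz hR hL hC).integral_prod_right,
    integral_integral_swap (integrable_mul_kernel hz hR hL hC)⟩

/-- The axial mean of an odd Abel transform as a single integral against a kernel. -/
theorem axialMean_zero_abelOdd_eq {h : ℝ → ℝ} (hh : Continuous h) {t z : ℝ} (ht : 0 ≤ t)
    (hz : 0 < z) :
    IntegrableOn (fun ζ => h ζ * ζ * ∫ θ in Ioo 0 π, (t + z * cos θ) / |t + z * cos θ|
        * (√((t + z * cos θ) ^ 2 - ζ ^ 2))⁻¹) (Ioo 0 (t + z)) ∧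
      axialMean 0 (abelOdd h) t z = 1 / π * ∫ ζ in Ioo 0 (t + z), h ζ * ζ *
        ∫ θ in Ioo 0 π, (t + z * cos θ) / |t + z * cos θ|
          * (√((t + z * cos θ) ^ 2 - ζ ^ 2))⁻¹ := by
  have hR : |t| + z ≤ t + z := by rw [abs_of_nonneg ht]
  obtain ⟨C, hC⟩ := (isCompact_Icc (a := (0 : ℝ)) (b := t + z)).exists_bound_of_continuousOn
    (hh.mul continuous_id).continuousOn
  -- The factor `s / |s|` carries the oddness of the transform, since the kernel only sees `s²`.
  have hsign : ∀ s : ℝ, ‖s / |s|‖ ≤ 1 := fun s => by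
    rw [norm_div, norm_eq_abs, norm_eq_abs, abs_abs]; exact div_self_le_one _
  have hL : ∀ s ∈ Icc (t - z) (t + z), ∀ ζ ∈ Ioo 0 (t + z),
      |(fun p : ℝ × ℝ => h p.2 * p.2 * (p.1 / |p.1|)) (s, ζ)| ≤ C := fun s _ ζ hζ => by
    have h1 := hC ζ ⟨hζ.1.le, hζ.2.le⟩
    rw [norm_eq_abs] at h1
    simp only [abs_mul (h ζ * ζ)]
    exact (mul_le_of_le_one_right (abs_nonneg _) (hsign s)).trans h1
  obtain ⟨h1, h2⟩ := integral_mul_kernel_swap hz hR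
    (L := fun p : ℝ × ℝ => h p.2 * p.2 * (p.1 / |p.1|)) (by
      have := hh.measurable
      fun_prop) hL
  have hpull : ∀ ζ, ∫ θ in Ioo 0 π, h ζ * ζ * ((t + z * cos θ) / |t + z * cos θ|)
      * (√((t + z * cos θ) ^ 2 - ζ ^ 2))⁻¹ = h ζ * ζ * ∫ θ in Ioo 0 π,
        (t + z * cos θ) / |t + z * cos θ| * (√((t + z * cos θ) ^ 2 - ζ ^ 2))⁻¹ := fun ζ => by
    rw [← integral_const_mul]
    simp only [mul_assoc]
  simp only [hpull] at h1 h2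
  refine ⟨h1, ?_⟩
  rw [← h2, axialMean, intervalIntegral.integral_of_le pi_pos.le, integral_Ioc_eq_integral_Ioo]
  congr 1
  refine setIntegral_congr_ae measurableSet_Ioo ?_
  filter_upwards [ae_add_mul_cos_ne (t := t) 0 hz] with θ hθ hθ'
  have hs := hθ (by rw [uIoc_of_le pi_pos.le]; exact Ioo_subset_Ioc_self hθ')
  set s := t + z * cos θ with hs'
  have h3 := (integrableOn_mul_inv_sqrt_sq_sub_sq (R := t + z) hs
    (abs_add_mul_cos_le (by rwa [abs_of_pos hz]) θ) (H := fun ζ => h ζ * ζ) (by fun_prop)).2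
  have h4 : ∀ ζ, h ζ * ζ * (s / |s|) * (√(s ^ 2 - ζ ^ 2))⁻¹
      = s / |s| * (h ζ * ζ * (√(s ^ 2 - ζ ^ 2))⁻¹) := fun ζ => by ring
  simp only [h4]
  rw [integral_const_mul, h3, pow_zero, one_mul, abelOdd, ← intervalIntegral.integral_const_mul,
    ← intervalIntegral.integral_const_mul]
  refine intervalIntegral.integral_congr fun α _ => ?_
  have := abs_ne_zero.2 hs
  field_simp

/-! ### The kernel of the axial mean of an even Abel transform -/

/-- The function `cos / (1 + sin)` has derivative `-1 / (1 + sin)`, and `cos² / (1 + sin) = 1 -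
sin`. The integration by parts splits off an odd transform of `k`, to be merged with that of the
velocity, and leaves a term in `F` alone. -/
theorem abelEven_eq_add {F k : ℝ → ℝ} (hF : ∀ x, HasDerivAt F (k x) x) (hk : Continuous k) {s : ℝ}
    (hs : 0 ≤ s) :
    abelEven (F 0) k s = abelOdd k s + ∫ α in 0..π / 2, F (s * sin α) / (1 + sin α) := by
  have hFc : Continuous F := continuous_iff_continuousAt.2 fun x => (hF x).continuousAt
  have hsin : ∀ α ∈ uIcc 0 (π / 2), 0 < 1 + sin α := fun α hα => by
    rw [uIcc_of_le (by positivity)] at hα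
    linarith [sin_nonneg_of_nonneg_of_le_pi hα.1 (by linarith [hα.2, pi_pos])]
  have hu : ∀ α ∈ uIcc 0 (π / 2), HasDerivAt (fun α => cos α / (1 + sin α)) (-1 / (1 + sin α)) α :=
    fun α hα => by
    refine ((hasDerivAt_cos α).fun_div ((hasDerivAt_sin α).const_add 1)
      (hsin α hα).ne').congr_deriv ?_
    have := (hsin α hα).ne'
    field_simp
    linear_combination -sin_sq_add_cos_sq α
  have hv : ∀ α ∈ uIcc 0 (π / 2), HasDerivAt (fun α => F (s * sin α)) (k (s * sin α) * (s * cos α)) α :=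
    fun α _ => (hF _).comp α ((hasDerivAt_sin α).const_mul s)
  have hinv : ContinuousOn (fun α => -1 / (1 + sin α)) (uIcc 0 (π / 2)) :=
    ContinuousOn.div continuousOn_const (by fun_prop) fun α hα => (hsin α hα).ne'
  have hparts := intervalIntegral.integral_mul_deriv_eq_deriv_mul hu hv
    hinv.intervalIntegrable (Continuous.intervalIntegrable (by fun_prop) _ _)
  simp only [cos_pi_div_two, sin_pi_div_two, cos_zero, sin_zero, mul_zero, zero_div, zero_mul,
    add_zero, div_one, one_mul, zero_sub] at hparts
  have h1 : ∫ α in 0..π / 2, cos α / (1 + sin α) * (k (s * sin α) * (s * cos α))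
      = s * (∫ α in 0..π / 2, k (s * sin α)) - s * ∫ α in 0..π / 2, sin α * k (s * sin α) := by
    rw [← mul_sub, ← intervalIntegral.integral_sub (Continuous.intervalIntegrable (by fun_prop) _ _)
      (Continuous.intervalIntegrable (by fun_prop) _ _), ← intervalIntegral.integral_const_mul]
    refine intervalIntegral.integral_congr fun α hα => ?_
    have := (hsin α hα).ne'
    generalize k (s * sin α) = K
    field_simp
    linear_combination K * s * sin_sq_add_cos_sq α
  have h2 : ∫ α in 0..π / 2, -1 / (1 + sin α) * F (s * sin α)
      = -∫ α in 0..π / 2, F (s * sin α) / (1 + sin α) := by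
    rw [← intervalIntegral.integral_neg]
    exact intervalIntegral.integral_congr fun α _ => by ring
  rw [h1, h2] at hparts
  rw [abelEven, abelOdd, abs_of_nonneg hs]
  linarith

theorem abs_add_abs_le_of_le {s ζ : ℝ} (hs : 0 ≤ s) (hζ : 0 < ζ) : |s / (s + ζ)| ≤ 1 := by
  rw [abs_of_nonneg (by positivity)]
  exact (div_le_one (by positivity)).2 (by linarith)

theorem axialMean_zero_abelEven_eq {F k : ℝ → ℝ} (hF : ∀ x, HasDerivAt F (k x) x)
    (hk : Continuous k) {t z : ℝ} (hz : 0 < z) (htz : z ≤ t) :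
    IntegrableOn (fun ζ => F ζ * ∫ θ in Ioo 0 π, (t + z * cos θ) / (t + z * cos θ + ζ)
        * (√((t + z * cos θ) ^ 2 - ζ ^ 2))⁻¹) (Ioo 0 (t + z)) ∧
      axialMean 0 (abelEven (F 0) k) t z = axialMean 0 (abelOdd k) t z
        + 1 / π * ∫ ζ in Ioo 0 (t + z), F ζ * ∫ θ in Ioo 0 π,
          (t + z * cos θ) / (t + z * cos θ + ζ) * (√((t + z * cos θ) ^ 2 - ζ ^ 2))⁻¹ := by
  have hFc : Continuous F := continuous_iff_continuousAt.2 fun x => (hF x).continuousAt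
  have hR : |t| + z ≤ t + z := by rw [abs_of_nonneg (by linarith)]
  obtain ⟨C, hC⟩ := (isCompact_Icc (a := (0 : ℝ)) (b := t + z)).exists_bound_of_continuousOn
    hFc.continuousOn
  obtain ⟨h1, h2⟩ := integral_mul_kernel_swap (C := C) hz hR
    (L := fun p : ℝ × ℝ => F p.2 * (p.1 / (p.1 + p.2))) (by
      have := hFc.measurable
      fun_prop) (fun s hs ζ hζ => by
    have h1 := hC ζ ⟨hζ.1.le, hζ.2.le⟩
    rw [norm_eq_abs] at h1
    simp only [abs_mul]
    exact (mul_le_of_le_one_right (abs_nonneg _)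
      (abs_add_abs_le_of_le (by linarith [hs.1]) hζ.1)).trans h1)
  have hpull : ∀ ζ, ∫ θ in Ioo 0 π, F ζ * ((t + z * cos θ) / (t + z * cos θ + ζ))
      * (√((t + z * cos θ) ^ 2 - ζ ^ 2))⁻¹ = F ζ * ∫ θ in Ioo 0 π,
        (t + z * cos θ) / (t + z * cos θ + ζ) * (√((t + z * cos θ) ^ 2 - ζ ^ 2))⁻¹ := fun ζ => by
    rw [← integral_const_mul]
    simp only [mul_assoc]
  simp only [hpull] at h1 h2
  refine ⟨h1, ?_⟩
  have hoc := continuous_abelOdd hk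
  have hec := continuous_abelEven (F 0) hk
  rw [← h2, ← sub_eq_iff_eq_add', axialMean, axialMean, ← mul_sub,
    ← intervalIntegral.integral_sub (Continuous.intervalIntegrable (by fun_prop) _ _)
      (Continuous.intervalIntegrable (by fun_prop) _ _),
    intervalIntegral.integral_of_le pi_pos.le, integral_Ioc_eq_integral_Ioo]
  congr 1
  refine setIntegral_congr_ae measurableSet_Ioo ?_
  filter_upwards [ae_add_mul_cos_ne (t := t) 0 hz] with θ hθ hθ'
  have hs := hθ (by rw [uIoc_of_le pi_pos.le]; exact Ioo_subset_Ioc_self hθ')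
  have hs0 : 0 ≤ t + z * cos θ := by nlinarith [neg_one_le_cos θ]
  have hle := abs_add_mul_cos_le (show |t| + |z| ≤ t + z by rwa [abs_of_pos hz]) θ
  set s := t + z * cos θ
  have hspos : 0 < s := lt_of_le_of_ne hs0 hs.symm
  have h3 := (integrableOn_mul_inv_sqrt_sq_sub_sq (R := t + z) hs hle
    (H := fun ζ => F ζ * (s / (s + ζ))) (hFc.continuousOn.mul (ContinuousOn.div (by fun_prop)
      (by fun_prop) fun ζ hζ => by
        have : 0 ≤ ζ := hζ
        positivity))).2
  rw [h3, pow_zero, one_mul, one_mul, abelEven_eq_add hF hk hs0, add_sub_cancel_left,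
    abs_of_pos hspos]
  refine intervalIntegral.integral_congr fun α hα => ?_
  rw [uIcc_of_le (by positivity)] at hα
  have h4 := sin_nonneg_of_nonneg_of_le_pi hα.1 (by linarith [hα.2, pi_pos])
  have h5 : s + s * sin α ≠ 0 := by positivity
  have h6 : 1 + sin α ≠ 0 := by positivity
  field_simp

/-- Shifting `s = t + z cos θ` and `ζ` by the same amount fixes `s - ζ`, so the singularity at `s =
ζ` does not move and differentiation under the integral is allowed. The derivative of `(ζ + h) /
√((s + h)² - (ζ + h)²)` at `0` is the kernel of the even part, which is thus found by
differentiating known closed forms. -/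
theorem hasDerivAt_integral_kernel_shift {t z ζ : ℝ} (hz : 0 < z) (htz : z ≤ t) (hζ : 0 < ζ)
    (hi : IntegrableOn (fun θ => (√((t + z * cos θ) ^ 2 - ζ ^ 2))⁻¹) (Ioo 0 π)) :
    HasDerivAt (fun h => ∫ θ in Ioo 0 π,
        (ζ + h) * (√((t + h + z * cos θ) ^ 2 - (ζ + h) ^ 2))⁻¹)
      (∫ θ in Ioo 0 π, (t + z * cos θ) / (t + z * cos θ + ζ)
        * (√((t + z * cos θ) ^ 2 - ζ ^ 2))⁻¹) 0 := by
  -- For `|h| < ζ / 4` one has `s + ζ + 2 h ≥ (s + ζ) / 2`, so the shifted kernel is at most twice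
  -- the original one.
  have hball : Metric.ball (0 : ℝ) (ζ / 4) ∈ 𝓝 (0 : ℝ) := Metric.ball_mem_nhds _ (by positivity)
  have hmem : ∀ h ∈ Metric.ball (0 : ℝ) (ζ / 4), -(ζ / 4) < h ∧ h < ζ / 4 := fun h hh => by
    rw [mem_ball_zero_iff, norm_eq_abs] at hh
    exact abs_lt.1 hh
  have key := hasDerivAt_integral_of_dominated_loc_of_deriv_le (μ := volume.restrict (Ioo 0 π))
    (F := fun h θ => (ζ + h) * (√((t + h + z * cos θ) ^ 2 - (ζ + h) ^ 2))⁻¹)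
    (F' := fun h θ => (t + z * cos θ + h) / (t + z * cos θ + ζ + 2 * h)
      * (√((t + h + z * cos θ) ^ 2 - (ζ + h) ^ 2))⁻¹)
    (bound := fun θ => 2 * (√((t + z * cos θ) ^ 2 - ζ ^ 2))⁻¹) hball
    (.of_forall fun h => Measurable.aestronglyMeasurable (by fun_prop))
    (by simpa using hi.const_mul ζ) (Measurable.aestronglyMeasurable (by fun_prop))
    (.of_forall fun θ h hh => ?_) (hi.const_mul 2) (.of_forall fun θ h hh => ?_)
  · simpa using key.2
  · obtain ⟨h1, h2⟩ := hmem h hh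
    have hs : 0 ≤ t + z * cos θ := by nlinarith [neg_one_le_cos θ]
    rw [show t + h + z * cos θ = t + z * cos θ + h by ring]
    set s := t + z * cos θ
    have hd : 0 < s + ζ + 2 * h := by linarith
    rw [norm_mul, norm_eq_abs, norm_eq_abs, abs_of_nonneg (inv_nonneg.2 (sqrt_nonneg _))]
    rcases le_or_gt s ζ with hsζ | hsζ
    · rw [sqrt_eq_zero_of_nonpos (by nlinarith), inv_zero, mul_zero]
      positivity
    · have hq : 0 < s ^ 2 - ζ ^ 2 := by nlinarith
      have hle : √(s ^ 2 - ζ ^ 2) ≤ 2 * √((s + h) ^ 2 - (ζ + h) ^ 2) := by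
        rw [show (2 : ℝ) = √(2 ^ 2) by rw [sqrt_sq]; norm_num, ← sqrt_mul (by norm_num)]
        exact sqrt_le_sqrt (by nlinarith)
      have hq' := sqrt_pos.2 hq
      have h3 : |(s + h) / (s + ζ + 2 * h)| ≤ 1 := by
        rw [abs_of_nonneg (div_nonneg (by linarith) hd.le)]
        exact (div_le_one hd).2 (by linarith)
      have h4 : (√((s + h) ^ 2 - (ζ + h) ^ 2))⁻¹ ≤ 2 * (√(s ^ 2 - ζ ^ 2))⁻¹ := by
        rw [← div_eq_mul_inv, inv_le_comm₀ (by linarith) (by positivity), inv_div]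
        linarith
      calc _ ≤ 1 * (√((s + h) ^ 2 - (ζ + h) ^ 2))⁻¹ := by gcongr
        _ ≤ _ := by rw [one_mul]; exact h4
  · obtain ⟨h1, h2⟩ := hmem h hh
    have hs : 0 ≤ t + z * cos θ := by nlinarith [neg_one_le_cos θ]
    have hre : ∀ h, t + h + z * cos θ = t + z * cos θ + h := fun h => by ring
    simp only [hre]
    set s := t + z * cos θ
    have hd : 0 < s + ζ + 2 * h := by linarith
    rcases le_or_gt s ζ with hsζ | hsζ
    · rw [sqrt_eq_zero_of_nonpos (by nlinarith), inv_zero, mul_zero]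
      refine (hasDerivAt_const h (0 : ℝ)).congr_of_eventuallyEq ?_
      filter_upwards [Metric.isOpen_ball.mem_nhds hh] with h' hh'
      obtain ⟨h3, h4⟩ := hmem h' hh'
      rw [sqrt_eq_zero_of_nonpos (by nlinarith), inv_zero, mul_zero]
    · have hq : 0 < (s + h) ^ 2 - (ζ + h) ^ 2 := by nlinarith
      have e1 : HasDerivAt (fun h => (s + h) ^ 2 - (ζ + h) ^ 2) (2 * (s - ζ)) h := by
        have a1 := ((hasDerivAt_id h).const_add s).fun_pow 2
        have a2 := ((hasDerivAt_id h).const_add ζ).fun_pow 2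
        refine (a1.sub a2).congr_deriv ?_
        simp only [id]
        push_cast
        ring
      have e2 := ((hasDerivAt_id h).const_add ζ).mul ((e1.sqrt hq.ne').inv (sqrt_pos.2 hq).ne')
      refine e2.congr_deriv ?_
      have hr := sqrt_pos.2 hq
      have hr2 := sq_sqrt hq.le
      simp only [id, Pi.inv_apply]
      set r := √((s + h) ^ 2 - (ζ + h) ^ 2)
      have hr2' : r ^ 2 = (s - ζ) * (s + ζ + 2 * h) := by rw [hr2]; ring
      have hsζ' := (sub_pos.2 hsζ).ne'
      rw [show 1 * r⁻¹ + (ζ + h) * (-(2 * (s - ζ) / (2 * r)) / r ^ 2)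
        = (r ^ 2 - (ζ + h) * (s - ζ)) / r ^ 2 * r⁻¹ by field_simp; ring]
      congr 1
      rw [hr2', div_eq_div_iff (mul_ne_zero hsζ' hd.ne') hd.ne']
      ring

/-! ### The explicit formulas for `z ≤ t` -/

/-- The closed form of `integral_kernel_of_lt_sub` at `(t + h, ζ + h)`, multiplied by `ζ + h`, is
differentiated at `h = 0`. -/
theorem integral_even_kernel_of_lt_sub {t z ζ : ℝ} (hz : 0 < z) (hζ : 0 < ζ) (h : ζ < t - z) :
    ∫ θ in Ioo 0 π, (t + z * cos θ) / (t + z * cos θ + ζ) * (√((t + z * cos θ) ^ 2 - ζ ^ 2))⁻¹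
      = π * ((t - z) * (1 / ((t - z + ζ) * √(t ^ 2 - (ζ - z) ^ 2))
            * hypHalf (4 * ζ * z / (t ^ 2 - (ζ - z) ^ 2)))
          + z * (ζ * (t - z - ζ) / ((t - z + ζ) * (t ^ 2 - (ζ - z) ^ 2) ^ (3 / 2 : ℝ))
            * hypThreeHalves (4 * ζ * z / (t ^ 2 - (ζ - z) ^ 2)))) := by
  have hk := (integral_kernel_of_lt_sub hz hζ h).1
  have hd := hasDerivAt_integral_kernel_shift hz (by linarith) hζ hk
  have hE : 0 < t ^ 2 - (ζ - z) ^ 2 := by nlinarith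
  have he : 0 < t - z + ζ := by linarith
  have hX : |4 * ζ * z / (t ^ 2 - (ζ - z) ^ 2)| < 1 := by
    rw [abs_of_nonneg (by positivity), div_lt_one hE]
    nlinarith
  have hnear : (fun h => ∫ θ in Ioo 0 π, (ζ + h) * (√((t + h + z * cos θ) ^ 2 - (ζ + h) ^ 2))⁻¹)
      =ᶠ[𝓝 0] fun h => π * ((ζ + h) * (hypHalf (4 * (ζ + h) * z / ((t + h) ^ 2 - (ζ + h - z) ^ 2))
        / √((t + h) ^ 2 - (ζ + h - z) ^ 2))) := by
    filter_upwards [lt_mem_nhds (show -ζ < 0 by linarith)] with h' hh'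
    rw [integral_const_mul, (integral_kernel_of_lt_sub hz (by linarith) (by linarith)).2]
    ring
  have e0 : HasDerivAt (fun h => (t + h) ^ 2 - (ζ + h - z) ^ 2) (2 * (t - ζ + z)) 0 := by
    have a1 := ((hasDerivAt_id (0 : ℝ)).const_add t).fun_pow 2
    have a2 := (((hasDerivAt_id (0 : ℝ)).const_add ζ).sub_const z).fun_pow 2
    refine (a1.sub a2).congr_deriv ?_
    simp only [id]
    push_cast
    ring
  have e1 : HasDerivAt (fun h => 4 * (ζ + h) * z) (4 * z) 0 := by
    have := (((hasDerivAt_id (0 : ℝ)).const_add ζ).const_mul 4).mul_const z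
    exact this.congr_deriv (by ring)
  have hE0 : 0 < (t + 0) ^ 2 - (ζ + 0 - z) ^ 2 := by simpa using hE
  have e2 := e1.fun_div e0 hE0.ne'
  have e3 := (hasDerivAt_hypHalf (x := 4 * (ζ + 0) * z / ((t + 0) ^ 2 - (ζ + 0 - z) ^ 2))
    (by simpa using hX)).comp 0 e2
  have e4 := ((((hasDerivAt_id (0 : ℝ)).const_add ζ).fun_mul
    (e3.fun_div (e0.sqrt hE0.ne') (sqrt_pos.2 hE0).ne')).const_mul π).congr_of_eventuallyEq hnear
  rw [hd.unique e4]
  simp only [id, add_zero, Function.comp_apply]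
  have hrpow : (t ^ 2 - (ζ - z) ^ 2) ^ (3 / 2 : ℝ)
      = (t ^ 2 - (ζ - z) ^ 2) * √(t ^ 2 - (ζ - z) ^ 2) := by
    rw [sqrt_eq_rpow, show (3 / 2 : ℝ) = 1 + 1 / 2 by norm_num, rpow_add hE, rpow_one]
  rw [hrpow]
  have hr := sqrt_pos.2 hE
  have hr2 := sq_sqrt hE.le
  -- The first factor is invariant under the shift and only the second varies; in these two
  -- coordinates the identity becomes rational.
  have hfac : t ^ 2 - (ζ - z) ^ 2 = (t - ζ + z) * (t - z + ζ) := by ring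
  have hc : 0 < t - ζ + z := by linarith
  generalize hypHalf (4 * ζ * z / (t ^ 2 - (ζ - z) ^ 2)) = A
  generalize hypThreeHalves (4 * ζ * z / (t ^ 2 - (ζ - z) ^ 2)) = B
  generalize √(t ^ 2 - (ζ - z) ^ 2) = r at *
  rw [hfac] at *
  generalize hcc : t - ζ + z = c at *
  generalize hee : t - z + ζ = e at *
  have ht : t = (c + e) / 2 := by linarith
  have hζ' : ζ - z = (e - c) / 2 := by linarith
  obtain rfl : z = ζ - (e - c) / 2 := by linarith
  subst ht
  field_simp
  rw [hr2]
  field_simp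
  ring

theorem integral_even_kernel_of_abs_lt {t z ζ : ℝ} (hz : 0 < z) (htz : z ≤ t) (h : t - z < ζ)
    (h' : ζ < t + z) :
    ∫ θ in Ioo 0 π, (t + z * cos θ) / (t + z * cos θ + ζ) * (√((t + z * cos θ) ^ 2 - ζ ^ 2))⁻¹
      = π * (hypHalf ((t ^ 2 - (ζ - z) ^ 2) / (4 * ζ * z)) / (4 * (√z * √ζ))
          + 1 / (32 * z * √z) * ((z ^ 2 - (t - ζ) ^ 2) / (ζ * √ζ)
            * hypThreeHalves ((t ^ 2 - (ζ - z) ^ 2) / (4 * ζ * z)))) := by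
  have hζ : 0 < ζ := by linarith
  have hk := (integral_kernel_of_abs_lt hz (abs_lt.2 ⟨by linarith, h⟩) h').1
  have hd := hasDerivAt_integral_kernel_shift hz htz hζ hk
  have hX : |(t ^ 2 - (ζ - z) ^ 2) / (4 * ζ * z)| < 1 := by
    rw [abs_of_nonneg (div_nonneg (by nlinarith) (by positivity)), div_lt_one (by positivity)]
    nlinarith
  have hnear : (fun h => ∫ θ in Ioo 0 π, (ζ + h) * (√((t + h + z * cos θ) ^ 2 - (ζ + h) ^ 2))⁻¹)
      =ᶠ[𝓝 0] fun h => π * ((ζ + h) * (hypHalf (((t + h) ^ 2 - (ζ + h - z) ^ 2)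
        / (4 * (ζ + h) * z)) / (2 * (√z * √(ζ + h))))) := by
    filter_upwards [lt_mem_nhds (show t - z - ζ < 0 by linarith), lt_mem_nhds
      (show -ζ < 0 by linarith), lt_mem_nhds (show (z - t - ζ) / 2 < 0 by linarith)] with h1 h2 h3 h4
    rw [integral_const_mul, (integral_kernel_of_abs_lt hz (abs_lt.2 ⟨by linarith, by linarith⟩)
      (by linarith)).2]
    ring
  have e0 : HasDerivAt (fun h => (t + h) ^ 2 - (ζ + h - z) ^ 2) (2 * (t - ζ + z)) 0 := by
    have a1 := ((hasDerivAt_id (0 : ℝ)).const_add t).fun_pow 2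
    have a2 := (((hasDerivAt_id (0 : ℝ)).const_add ζ).sub_const z).fun_pow 2
    refine (a1.sub a2).congr_deriv ?_
    simp only [id]
    push_cast
    ring
  have e1 : HasDerivAt (fun h => 4 * (ζ + h) * z) (4 * z) 0 := by
    have := (((hasDerivAt_id (0 : ℝ)).const_add ζ).const_mul 4).mul_const z
    exact this.congr_deriv (by ring)
  have hζ0 : ζ + 0 ≠ 0 := by simpa using hζ.ne'
  have hE0 : 4 * (ζ + 0) * z ≠ 0 := by rw [add_zero]; positivity
  have e2 := e0.fun_div e1 hE0
  have e3 := (hasDerivAt_hypHalf (x := ((t + 0) ^ 2 - (ζ + 0 - z) ^ 2) / (4 * (ζ + 0) * z))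
    (by simpa using hX)).comp 0 e2
  have e5 := ((((hasDerivAt_id (0 : ℝ)).const_add ζ).sqrt hζ0).const_mul √z).const_mul 2
  have hs : 0 < √z := sqrt_pos.2 hz
  have hq : 0 < √ζ := sqrt_pos.2 hζ
  have e4 := ((((hasDerivAt_id (0 : ℝ)).const_add ζ).fun_mul
    (e3.fun_div e5 (by simp only [id, add_zero]; positivity))).const_mul π).congr_of_eventuallyEq hnear
  rw [hd.unique e4]
  simp only [id, add_zero, Function.comp_apply]
  have hs2 := sq_sqrt hz.le
  have hq2 := sq_sqrt hζ.le
  generalize hypHalf ((t ^ 2 - (ζ - z) ^ 2) / (4 * ζ * z)) = A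
  generalize hypThreeHalves ((t ^ 2 - (ζ - z) ^ 2) / (4 * ζ * z)) = B
  generalize √z = s at *
  generalize √ζ = q at *
  subst hs2 hq2
  field_simp
  ring

theorem intervalIntegral_eq_setIntegral_Ioo {a b : ℝ} (hab : a ≤ b) (u : ℝ → ℝ) :
    ∫ x in a..b, u x = ∫ x in Ioo a b, u x := by
  rw [intervalIntegral.integral_of_le hab, integral_Ioc_eq_integral_Ioo]

theorem setIntegral_Ioo_split {u : ℝ → ℝ} {a b c : ℝ} (hab : a ≤ b) (hbc : b ≤ c)
    (hu : IntegrableOn u (Ioo a c)) :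
    ∫ x in Ioo a c, u x = (∫ x in Ioo a b, u x) + ∫ x in Ioo b c, u x := by
  rw [← intervalIntegral_eq_setIntegral_Ioo hab, ← intervalIntegral_eq_setIntegral_Ioo hbc,
    ← intervalIntegral_eq_setIntegral_Ioo (hab.trans hbc),
    intervalIntegral.integral_add_adjacent_intervals]
  · exact (intervalIntegrable_iff_integrableOn_Ioo_of_le hab).2
      (hu.mono_set (Ioo_subset_Ioo_right hbc))
  · exact (intervalIntegrable_iff_integrableOn_Ioo_of_le hbc).2
      (hu.mono_set (Ioo_subset_Ioo_left hab))

theorem integrableOn_mul_integral_kernel {H : ℝ → ℝ} (hH : Continuous H) {t z : ℝ} (ht : 0 ≤ t)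
    (hz : 0 < z) :
    IntegrableOn (fun ζ => H ζ * ∫ θ in Ioo 0 π, (√((t + z * cos θ) ^ 2 - ζ ^ 2))⁻¹)
      (Ioo 0 (t + z)) := by
  obtain ⟨C, hC⟩ := (isCompact_Icc (a := (0 : ℝ)) (b := t + z)).exists_bound_of_continuousOn
    hH.continuousOn
  have h1 := (integral_mul_kernel_swap (t := t) (R := t + z) (C := C) hz
    (by rw [abs_of_nonneg ht]) (L := fun p : ℝ × ℝ => H p.2) (by
      have := hH.measurable
      fun_prop) fun s _ ζ hζ => hC ζ ⟨hζ.1.le, hζ.2.le⟩).1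
  simpa only [integral_const_mul] using h1

theorem abelOdd_add {h k : ℝ → ℝ} (hh : Continuous h) (hk : Continuous k) (s : ℝ) :
    abelOdd (fun x => h x + k x) s = abelOdd h s + abelOdd k s := by
  simp only [abelOdd, mul_add]
  rw [intervalIntegral.integral_add (Continuous.intervalIntegrable (by fun_prop) _ _)
    (Continuous.intervalIntegrable (by fun_prop) _ _), mul_add]

theorem sign_mul_inv_sqrt {s ζ : ℝ} (hs : 0 ≤ s) :
    s / |s| * (√(s ^ 2 - ζ ^ 2))⁻¹ = (√(s ^ 2 - ζ ^ 2))⁻¹ := by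
  rcases hs.eq_or_lt with rfl | hs
  · rw [sqrt_eq_zero_of_nonpos (by nlinarith), inv_zero, mul_zero]
  · rw [abs_of_pos hs, div_self hs.ne', one_mul]

theorem axialMean_waveProfile_eq_add {f g : ℝ → ℝ} (hf : ContDiffOn ℝ 1 f (Ici 0))
    (hg : ContinuousOn g (Ici 0)) (t z : ℝ) :
    axialMean 0 (waveProfile f g) t z
      = axialMean 0 (abelEven (f 0) fun x => derivWithin f (Ici 0) |x|) t z
        + axialMean 0 (abelOdd fun x => g |x|) t z :=
  axialMean_add (continuous_abelEven _ (exists_primitive_of_contDiffOn hf).1)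
    (continuous_abelOdd (hg.comp_continuous continuous_abs fun x => abs_nonneg x)) 0 t z

/-- By `abelEven_eq_add` the wave is the odd transform of `f' + g` plus a term in `f` alone. Both
are integrals over `0 < ζ < t + z` against explicit kernels, split at `ζ = t - z`, where the order
of the roots changes. -/
theorem axialMean_waveProfile_late {f g : ℝ → ℝ} (hf : ContDiffOn ℝ 1 f (Ici 0))
    (hg : ContinuousOn g (Ici 0)) {t z : ℝ} (hz : 0 < z) (htz : z ≤ t) :
    IntervalIntegrable (lateIntegrand₁ f g t z) volume 0 (t - z) ∧
    IntervalIntegrable (lateIntegrand₂ f t z) volume 0 (t - z) ∧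
    IntervalIntegrable (lateIntegrand₃ f t z) volume 0 (t - z) ∧
    IntervalIntegrable (lateIntegrand₄ f g t z) volume (t - z) (t + z) ∧
    IntervalIntegrable (lateIntegrand₅ f t z) volume (t - z) (t + z) ∧
    axialMean 0 (waveProfile f g) t z =
      (∫ ζ in 0..(t - z), lateIntegrand₁ f g t z ζ)
      + (t - z) * (∫ ζ in 0..(t - z), lateIntegrand₂ f t z ζ)
      + z * (∫ ζ in 0..(t - z), lateIntegrand₃ f t z ζ)
      + 1 / (2 * √z) * (∫ ζ in (t - z)..(t + z), lateIntegrand₄ f g t z ζ)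
      + 1 / (32 * z * √z) * (∫ ζ in (t - z)..(t + z), lateIntegrand₅ f t z ζ) := by
  have hπ := pi_pos
  have ht : 0 ≤ t := by linarith
  have h0 : 0 ≤ t - z := by linarith
  have h1 : t - z ≤ t + z := by linarith
  have hs : 0 < √z := sqrt_pos.2 hz
  have hs2 := sq_sqrt hz.le
  obtain ⟨hk, F, hF, hFf⟩ := exists_primitive_of_contDiffOn hf
  have hFc : Continuous F := continuous_iff_continuousAt.2 fun x => (hF x).continuousAt
  have hg' : Continuous fun x => g |x| := hg.comp_continuous continuous_abs fun x => abs_nonneg x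
  have hkg := hk.add hg'
  set κ : ℝ → ℝ := fun ζ => ∫ θ in Ioo 0 π, (√((t + z * cos θ) ^ 2 - ζ ^ 2))⁻¹ with hκ
  set μ : ℝ → ℝ := fun ζ => ∫ θ in Ioo 0 π, (t + z * cos θ) / (t + z * cos θ + ζ)
    * (√((t + z * cos θ) ^ 2 - ζ ^ 2))⁻¹ with hμ
  obtain ⟨hi1, he1⟩ := axialMean_zero_abelOdd_eq (h := fun x => derivWithin f (Ici 0) |x| + g |x|)
    hkg ht hz
  obtain ⟨hi2, he2⟩ := axialMean_zero_abelEven_eq hF hk hz htz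
  have hsign : ∀ θ ζ, (t + z * cos θ) / |t + z * cos θ| * (√((t + z * cos θ) ^ 2 - ζ ^ 2))⁻¹
      = (√((t + z * cos θ) ^ 2 - ζ ^ 2))⁻¹ := fun θ ζ =>
    sign_mul_inv_sqrt (by nlinarith [neg_one_le_cos θ])
  simp only [hsign] at hi1 he1
  have hΨ : axialMean 0 (waveProfile f g) t z
      = 1 / π * (∫ ζ in Ioo 0 (t + z), (derivWithin f (Ici 0) |ζ| + g |ζ|) * ζ * κ ζ)
        + 1 / π * ∫ ζ in Ioo 0 (t + z), F ζ * μ ζ := by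
    rw [axialMean_waveProfile_eq_add hf hg, ← hFf 0 le_rfl, he2, ← he1]
    have : axialMean 0 (abelOdd fun x => derivWithin f (Ici 0) |x| + g |x|) t z
        = axialMean 0 (abelOdd fun x => derivWithin f (Ici 0) |x|) t z
          + axialMean 0 (abelOdd fun x => g |x|) t z := by
      rw [← axialMean_add (continuous_abelOdd hk) (continuous_abelOdd hg')]
      congr 1
      exact funext fun s => abelOdd_add hk hg' s
    rw [this]
    ring
  have hκ1 : ∀ ζ ∈ Ioo 0 (t - z), κ ζ = π * (hypHalf (4 * ζ * z / (t ^ 2 - (ζ - z) ^ 2))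
      / √(t ^ 2 - (ζ - z) ^ 2)) := fun ζ hζ => (integral_kernel_of_lt_sub hz hζ.1 hζ.2).2
  have hκ2 : ∀ ζ ∈ Ioo (t - z) (t + z), κ ζ = π * (hypHalf ((t ^ 2 - (ζ - z) ^ 2) / (4 * ζ * z))
      / (2 * (√z * √ζ))) := fun ζ hζ =>
    (integral_kernel_of_abs_lt hz (abs_lt.2 ⟨by linarith [hζ.1], hζ.1⟩) hζ.2).2
  have hμ1 : ∀ ζ ∈ Ioo 0 (t - z), F ζ * μ ζ
      = π * ((t - z) * lateIntegrand₂ f t z ζ + z * lateIntegrand₃ f t z ζ) := fun ζ hζ => by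
    simp only [hμ]
    rw [integral_even_kernel_of_lt_sub hz hζ.1 hζ.2, hFf ζ hζ.1.le, lateIntegrand₂, lateIntegrand₃]
    ring
  -- The first summand is `F κ / 2` up to the factor `π`; it joins the kernel of `f' + g` and
  -- becomes the term `f / (2 ζ)` of the fourth integrand.
  have hμ2 : ∀ ζ ∈ Ioo (t - z) (t + z), F ζ * μ ζ = π * (F ζ *
      (hypHalf ((t ^ 2 - (ζ - z) ^ 2) / (4 * ζ * z)) / (4 * (√z * √ζ)))
        + 1 / (32 * z * √z) * lateIntegrand₅ f t z ζ) := fun ζ hζ => by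
    simp only [hμ]
    rw [integral_even_kernel_of_abs_lt hz htz hζ.1 hζ.2, hFf ζ (h0.trans hζ.1.le), lateIntegrand₅]
    ring
  have hi1' : IntegrableOn (fun ζ => (derivWithin f (Ici 0) |ζ| + g |ζ|) * ζ * κ ζ)
    (Ioo 0 (t + z)) := hi1
  have hi2' : IntegrableOn (fun ζ => F ζ * μ ζ) (Ioo 0 (t + z)) := hi2
  have hκi : ∀ H : ℝ → ℝ, Continuous H → IntegrableOn (fun ζ => H ζ * κ ζ) (Ioo 0 (t + z)) :=
    fun H hH => integrableOn_mul_integral_kernel hH ht hz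
  clear_value κ μ
  have hl1 : EqOn (fun ζ => (derivWithin f (Ici 0) |ζ| + g |ζ|) * ζ * κ ζ)
      (fun ζ => π * lateIntegrand₁ f g t z ζ) (Ioo 0 (t - z)) := fun ζ hζ => by
    simp only
    rw [hκ1 ζ hζ, abs_of_pos hζ.1, lateIntegrand₁]
    ring
  have hl4 : ∀ ζ ∈ Ioo (t - z) (t + z), lateIntegrand₄ f g t z ζ = 2 * √z / π *
      (((derivWithin f (Ici 0) |ζ| + g |ζ|) * ζ + F ζ / 2) * κ ζ) := fun ζ hζ => by
    have hζ0 : 0 < ζ := h0.trans_lt hζ.1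
    have hq : 0 < √ζ := sqrt_pos.2 hζ0
    have hq2 := sq_sqrt hζ0.le
    rw [hκ2 ζ hζ, abs_of_pos hζ0, hFf ζ hζ0.le, lateIntegrand₄]
    generalize hypHalf ((t ^ 2 - (ζ - z) ^ 2) / (4 * ζ * z)) = A
    generalize derivWithin f (Ici 0) ζ = B
    generalize f ζ = B'
    generalize g ζ = B''
    generalize √ζ = q at *
    subst hq2
    field_simp
  have hsub1 : Ioo 0 (t - z) ⊆ Ioo 0 (t + z) := Ioo_subset_Ioo_right h1
  have hsub2 : Ioo (t - z) (t + z) ⊆ Ioo 0 (t + z) := Ioo_subset_Ioo_left h0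
  have hint1 : IntegrableOn (lateIntegrand₁ f g t z) (Ioo 0 (t - z)) := by
    have := ((integrableOn_congr_fun hl1 measurableSet_Ioo).1 (hi1'.mono_set hsub1)).const_mul π⁻¹
    simpa [← mul_assoc, hπ.ne'] using! this
  have hint2 : IntegrableOn (lateIntegrand₂ f t z) (Ioo 0 (t - z)) := by
    rcases h0.eq_or_lt with h | h
    · simp [← h]
    have hc : Continuous fun ζ => F ζ / (t - z + |ζ|) :=
      hFc.div (by fun_prop) fun ζ => by positivity
    have := ((hκi _ hc).mono_set hsub1).const_mul π⁻¹
    refine IntegrableOn.congr_fun this (fun ζ hζ => ?_) measurableSet_Ioo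
    rw [hκ1 ζ hζ, abs_of_pos hζ.1, hFf ζ hζ.1.le, lateIntegrand₂]
    have := hπ.ne'
    field_simp
  have hint23 := ((integrableOn_congr_fun (fun ζ hζ => hμ1 ζ hζ) measurableSet_Ioo).1
    (hi2'.mono_set hsub1)).const_mul π⁻¹
  -- Fubini only gives integrability of a combination of the second and third integrands. The second
  -- is handled alone, as a bounded weight times the kernel `κ`, and the third is then a difference.
  have hint3 : IntegrableOn (lateIntegrand₃ f t z) (Ioo 0 (t - z)) := by
    refine IntegrableOn.congr_fun ((hint23.sub (hint2.const_mul (t - z))).const_mul z⁻¹)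
      (fun ζ _ => ?_) measurableSet_Ioo
    simp only [Pi.sub_apply]
    field_simp
    ring
  have hint4 : IntegrableOn (lateIntegrand₄ f g t z) (Ioo (t - z) (t + z)) := by
    have := ((hκi _ ((hkg.mul continuous_id).add (hFc.div_const 2))).mono_set hsub2).const_mul (2 * √z / π)
    exact IntegrableOn.congr_fun this (fun ζ hζ => (hl4 ζ hζ).symm) measurableSet_Ioo
  have hintF := ((hκi _ hFc).mono_set hsub2)
  have hint5 : IntegrableOn (lateIntegrand₅ f t z) (Ioo (t - z) (t + z)) := by
    refine IntegrableOn.congr_fun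
      (((hi2'.mono_set hsub2).sub (hintF.div_const 2)).const_mul (32 * z * √z / π))
      (fun ζ hζ => ?_) measurableSet_Ioo
    have h2 := hμ2 ζ hζ
    have h3 := hκ2 ζ hζ
    simp only [Pi.sub_apply]
    rw [h2, h3]
    field_simp
    ring
  refine ⟨(intervalIntegrable_iff_integrableOn_Ioo_of_le h0).2 hint1,
    (intervalIntegrable_iff_integrableOn_Ioo_of_le h0).2 hint2,
    (intervalIntegrable_iff_integrableOn_Ioo_of_le h0).2 hint3,
    (intervalIntegrable_iff_integrableOn_Ioo_of_le h1).2 hint4,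
    (intervalIntegrable_iff_integrableOn_Ioo_of_le h1).2 hint5, ?_⟩
  simp only [intervalIntegral_eq_setIntegral_Ioo h0, intervalIntegral_eq_setIntegral_Ioo h1]
  have hA : ∫ ζ in Ioo 0 (t - z), F ζ * μ ζ
      = π * ((t - z) * (∫ ζ in Ioo 0 (t - z), lateIntegrand₂ f t z ζ)
        + z * ∫ ζ in Ioo 0 (t - z), lateIntegrand₃ f t z ζ) := by
    rw [setIntegral_congr_fun measurableSet_Ioo fun ζ hζ => hμ1 ζ hζ, integral_const_mul,
      integral_add (hint2.const_mul _) (hint3.const_mul _), integral_const_mul, integral_const_mul]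
  have hB : ∫ ζ in Ioo (t - z) (t + z), ((derivWithin f (Ici 0) |ζ| + g |ζ|) * ζ * κ ζ + F ζ * μ ζ)
      = π * (1 / (2 * √z) * (∫ ζ in Ioo (t - z) (t + z), lateIntegrand₄ f g t z ζ)
        + 1 / (32 * z * √z) * ∫ ζ in Ioo (t - z) (t + z), lateIntegrand₅ f t z ζ) := by
    rw [← integral_const_mul, ← integral_const_mul, ← integral_add (hint4.const_mul _)
      (hint5.const_mul _), ← integral_const_mul]
    refine setIntegral_congr_fun measurableSet_Ioo fun ζ hζ => ?_
    have h2 := hμ2 ζ hζ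
    have h3 := hκ2 ζ hζ
    rw [h2, hl4 ζ hζ, h3]
    field_simp
    ring
  rw [integral_add (hi1'.mono_set hsub2) (hi2'.mono_set hsub2)] at hB
  rw [hΨ, setIntegral_Ioo_split h0 h1 hi1', setIntegral_Ioo_split h0 h1 hi2', hA,
    setIntegral_congr_fun measurableSet_Ioo hl1, integral_const_mul]
  have hB' : ∫ ζ in Ioo (t - z) (t + z), F ζ * μ ζ = π * (1 / (2 * √z) *
      (∫ ζ in Ioo (t - z) (t + z), lateIntegrand₄ f g t z ζ)
        + 1 / (32 * z * √z) * ∫ ζ in Ioo (t - z) (t + z), lateIntegrand₅ f t z ζ)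
      - ∫ ζ in Ioo (t - z) (t + z), (derivWithin f (Ici 0) |ζ| + g |ζ|) * ζ * κ ζ := by
    linarith
  rw [hB']
  field_simp
  ring

/-! ### The explicit formulas for `t ≤ z` -/

theorem hypHalf_zero : hypHalf 0 = 1 := by
  simp [hypHalf, ordinaryHypergeometric_zero]

/-- Below `z - t` the kernel integral cancels by `integral_sign_mul_kernel_of_lt`. Above it the sign
is harmless: where `t + z cos θ` is negative, its absolute value is at most `z - t < ζ` and the
kernel is cut off. -/
theorem axialMean_zero_abelOdd_early {h : ℝ → ℝ} (hh : Continuous h) {t z : ℝ} (ht : 0 < t)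
    (htz : t < z) :
    axialMean 0 (abelOdd h) t z = 1 / (2 * √z) * ∫ ζ in (z - t)..(z + t),
      h ζ * √ζ * hypHalf ((t ^ 2 - (ζ - z) ^ 2) / (4 * ζ * z)) := by
  have hz : 0 < z := ht.trans htz
  have h0 : 0 ≤ z - t := by linarith
  have h1 : z - t ≤ t + z := by linarith
  have hs : 0 < √z := sqrt_pos.2 hz
  obtain ⟨hi, he⟩ := axialMean_zero_abelOdd_eq hh ht.le hz
  rw [he, setIntegral_Ioo_split h0 h1 hi, add_comm z t, intervalIntegral_eq_setIntegral_Ioo h1]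
  have hzero : ∫ ζ in Ioo 0 (z - t), h ζ * ζ * ∫ θ in Ioo 0 π, (t + z * cos θ) / |t + z * cos θ|
      * (√((t + z * cos θ) ^ 2 - ζ ^ 2))⁻¹ = 0 := by
    refine setIntegral_eq_zero_of_forall_eq_zero fun ζ hζ => ?_
    rw [integral_sign_mul_kernel_of_lt ht.le hζ.1 hζ.2, mul_zero]
  rw [hzero, zero_add, ← integral_const_mul, ← integral_const_mul]
  refine setIntegral_congr_fun measurableSet_Ioo fun ζ hζ => ?_
  have hζ0 : 0 < ζ := h0.trans_lt hζ.1
  have hk : ∫ θ in Ioo 0 π, (t + z * cos θ) / |t + z * cos θ|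
      * (√((t + z * cos θ) ^ 2 - ζ ^ 2))⁻¹
      = ∫ θ in Ioo 0 π, (√((t + z * cos θ) ^ 2 - ζ ^ 2))⁻¹ := by
    congr 1
    funext θ
    rcases le_or_gt 0 (t + z * cos θ) with hs | hs
    · exact sign_mul_inv_sqrt hs
    · rw [inv_sqrt_sq_sub_sq_eq_zero, mul_zero]
      rw [abs_of_neg hs]
      nlinarith [neg_one_le_cos θ, hζ.1]
  have hab : |t - z| < ζ := abs_lt.2 ⟨by linarith [hζ.1], by linarith⟩
  have hq : 0 < √ζ := sqrt_pos.2 hζ0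
  have hq2 := sq_sqrt hζ0.le
  rw [hk, (integral_kernel_of_abs_lt hz hab hζ.2).2]
  generalize hypHalf ((t ^ 2 - (ζ - z) ^ 2) / (4 * ζ * z)) = A
  generalize h ζ = B
  have := pi_ne_zero
  generalize √ζ = q at *
  subst hq2
  field_simp

theorem abs_early_modulus_lt {t z x : ℝ} (ht : 0 < t) (htz : t < z) (hx : x ∈ Icc (-1 : ℝ) 1) :
    0 < z + t * x ∧ |t ^ 2 * (1 - x ^ 2) / (4 * (z + t * x) * z)| < 1 := by
  have hz : 0 < z := ht.trans htz
  have h1 : 0 < z + t * x := by nlinarith [hx.1]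
  have h2 : x ^ 2 ≤ 1 := by nlinarith [hx.1, hx.2]
  refine ⟨h1, ?_⟩
  rw [abs_of_nonneg (div_nonneg (mul_nonneg (sq_nonneg t) (by linarith)) (by positivity)),
    div_lt_one (by positivity)]
  nlinarith [hx.1]

/-- The even transform is the derivative of the odd transform of `F`, so this mean is the time
derivative of the formula just obtained for velocity `F`. The substitution `ζ = z + t x` fixes the
interval of integration before differentiating. -/
theorem axialMean_zero_abelEven_early {F k : ℝ → ℝ} (hF : ∀ x, HasDerivAt F (k x) x)
    (hk : Continuous k) {t z : ℝ} (ht : 0 < t) (htz : t < z) :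
    axialMean 0 (abelEven (F 0) k) t z
      = 1 / (2 * √z) * (F (z + t) * √(z + t) + F (z - t) * √(z - t))
        + t ^ 2 / (16 * z * √z) * ∫ x in (-1)..1, F (z + t * x) / √(z + t * x)
          * hypThreeHalves (t ^ 2 * (1 - x ^ 2) / (4 * (z + t * x) * z)) := by
  have hz : 0 < z := ht.trans htz
  have hs : 0 < √z := sqrt_pos.2 hz
  have hFc : Continuous F := continuous_iff_continuousAt.2 fun x => (hF x).continuousAt
  set W : ℝ → ℝ → ℝ := fun t x => t ^ 2 * (1 - x ^ 2) / (4 * (z + t * x) * z) with hW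
  set Φ : ℝ → ℝ → ℝ := fun t x => F (z + t * x) * √(z + t * x) * hypHalf (W t x) with hΦ
  set Φ' : ℝ → ℝ → ℝ := fun t x => (k (z + t * x) * x * √(z + t * x)
      + F (z + t * x) * (x / (2 * √(z + t * x)))) * hypHalf (W t x)
    + F (z + t * x) * √(z + t * x) * (hypThreeHalves (W t x) / 4
      * ((2 * t * (1 - x ^ 2) * (4 * (z + t * x) * z) - t ^ 2 * (1 - x ^ 2) * (4 * x * z))
        / (4 * (z + t * x) * z) ^ 2)) with hΦ'
  have hu : uIcc (-1 : ℝ) 1 = Icc (-1) 1 := uIcc_of_le (by norm_num)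
  have hJ : ∀ t ∈ Ioo 0 z, axialMean 0 (abelOdd F) t z
      = 1 / (2 * √z) * (t * ∫ x in (-1)..1, Φ t x) := by
    intro t ht
    rw [axialMean_zero_abelOdd_early hFc ht.1 ht.2]
    have := intervalIntegral.mul_integral_comp_add_mul (a := -1) (b := 1) (f := fun ζ =>
      F ζ * √ζ * hypHalf ((t ^ 2 - (ζ - z) ^ 2) / (4 * ζ * z))) t z
    rw [mul_neg, mul_one, ← sub_eq_add_neg] at this
    rw [← this]
    congr 2
    refine intervalIntegral.integral_congr fun x _ => ?_
    simp only [hΦ, hW]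
    congr 3
    ring
  have hpos : ∀ p ∈ Ioo 0 z ×ˢ uIcc (-1 : ℝ) 1, 0 < z + p.1 * p.2 ∧ W p.1 p.2 ∈ Ioo (-1) 1 :=
    fun p hp => by
      rw [hu] at hp
      have := abs_early_modulus_lt hp.1.1 hp.1.2 hp.2
      exact ⟨this.1, abs_lt.1 this.2⟩
  have hne : ∀ p ∈ Ioo 0 z ×ˢ uIcc (-1 : ℝ) 1, 4 * (z + p.1 * p.2) * z ≠ 0 := fun p hp => by
    have := (hpos p hp).1
    positivity
  have hWc : ContinuousOn (fun p : ℝ × ℝ => W p.1 p.2) (Ioo 0 z ×ˢ uIcc (-1) 1) :=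
    ContinuousOn.div (by fun_prop) (by fun_prop) hne
  have hHc := continuousOn_hypHalf.comp hWc fun p hp => (hpos p hp).2
  have hGc := continuousOn_hypThreeHalves.comp hWc fun p hp => (hpos p hp).2
  have hΦc : ContinuousOn (fun p : ℝ × ℝ => Φ p.1 p.2) (Ioo 0 z ×ˢ uIcc (-1) 1) :=
    ContinuousOn.mul (by fun_prop) hHc
  have hΦc' : ContinuousOn (fun p : ℝ × ℝ => Φ' p.1 p.2) (Ioo 0 z ×ˢ uIcc (-1) 1) := by
    refine ContinuousOn.add (ContinuousOn.mul (ContinuousOn.add (by fun_prop)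
      (ContinuousOn.mul (by fun_prop) (ContinuousOn.div (by fun_prop) (by fun_prop) fun p hp => ?_)))
      hHc) (ContinuousOn.mul (by fun_prop) (ContinuousOn.mul (hGc.div_const 4)
      (ContinuousOn.div (by fun_prop) (by fun_prop) fun p hp => pow_ne_zero 2 (hne p hp))))
    have := sqrt_pos.2 (hpos p hp).1
    positivity
  have hslice : ∀ {E : ℝ → ℝ → ℝ} {t}, t ∈ Ioo 0 z →
      ContinuousOn (fun p : ℝ × ℝ => E p.1 p.2) (Ioo 0 z ×ˢ uIcc (-1) 1) →
      ContinuousOn (E t) (uIcc (-1) 1) := fun {E t} ht hE =>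
    hE.comp (f := fun x => (t, x)) (by fun_prop) fun x hx => ⟨ht, hx⟩
  have hdt : ∀ t ∈ Ioo 0 z, ∀ x ∈ uIcc (-1 : ℝ) 1, HasDerivAt (fun t => Φ t x) (Φ' t x) t := by
    intro t ht x hx
    obtain ⟨h1, h2⟩ := hpos (t, x) ⟨ht, hx⟩
    have h3 := hne (t, x) ⟨ht, hx⟩
    have e1 : HasDerivAt (fun t => z + t * x) x t := by
      simpa using ((hasDerivAt_id t).mul_const x).const_add z
    have e2 : HasDerivAt (fun t => t ^ 2 * (1 - x ^ 2)) (2 * t * (1 - x ^ 2)) t := by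
      simpa using ((hasDerivAt_id t).fun_pow 2).mul_const (1 - x ^ 2)
    have e3 := e2.fun_div ((e1.const_mul 4).mul_const z) h3
    have e4 := (hasDerivAt_hypHalf (abs_lt.2 h2)).comp t e3
    have e5 := (((hF _).comp t e1).mul (e1.sqrt h1.ne')).mul e4
    exact e5
  -- The operators `t ∂ₜ` and `x ∂ₓ` agree on functions of `z + t x`, so `Φ + t Φ'` differs from the
  -- exact derivative of `x Φ` only through the modulus. The derivative `k` of `F` thus disappears
  -- into boundary terms, and the defect is the integral with `G`.
  have hdx : ∀ x ∈ uIcc (-1 : ℝ) 1, HasDerivAt (fun x => x * Φ t x)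
      (Φ t x + t * Φ' t x - t ^ 2 / (8 * z) * (F (z + t * x) / √(z + t * x)
        * hypThreeHalves (W t x))) x := by
    intro x hx
    obtain ⟨h1, h2⟩ := hpos (t, x) ⟨⟨ht, htz⟩, hx⟩
    have h3 := hne (t, x) ⟨⟨ht, htz⟩, hx⟩
    have e1 : HasDerivAt (fun x => z + t * x) t x := by
      simpa using ((hasDerivAt_id x).const_mul t).const_add z
    have e2 : HasDerivAt (fun x => t ^ 2 * (1 - x ^ 2)) (t ^ 2 * -(2 * x)) x := by
      simpa using (((hasDerivAt_id x).fun_pow 2).const_sub 1).const_mul (t ^ 2)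
    have e3 := e2.fun_div ((e1.const_mul 4).mul_const z) h3
    have e4 := (hasDerivAt_hypHalf (abs_lt.2 h2)).comp x e3
    have e5 := (hasDerivAt_id x).mul ((((hF _).comp x e1).mul (e1.sqrt h1.ne')).mul e4)
    refine e5.congr_deriv ?_
    simp only [hΦ, hΦ', id, Function.comp_apply, Pi.mul_apply]
    have hr := sqrt_pos.2 h1
    have hr2 := sq_sqrt h1.le
    generalize hypHalf (t ^ 2 * (1 - x ^ 2) / (4 * (z + t * x) * z)) = A
    generalize hypThreeHalves (t ^ 2 * (1 - x ^ 2) / (4 * (z + t * x) * z)) = B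
    generalize F (z + t * x) = C
    generalize k (z + t * x) = D
    generalize √(z + t * x) = r at *
    have hζ : z + t * x = r ^ 2 := hr2.symm
    rw [hζ]
    field_simp
    ring
  have hder := hasDerivAt_intervalIntegral (a := -1) (b := 1) (F := Φ) (F' := Φ') isOpen_Ioo
    (⟨ht, htz⟩ : t ∈ Ioo 0 z) (fun t ht => hslice ht hΦc) hΦc' hdt
  have hder' := (((hasDerivAt_id t).mul hder).const_mul (1 / (2 * √z))).congr_of_eventuallyEq (by
    filter_upwards [Ioo_mem_nhds ht htz] with t ht using hJ t ht)
  have hpp : IsPiecewisePrimitive (abelOdd F) (abelEven (F 0) k) :=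
    .of_continuous (continuous_abelEven _ hk) (hasDerivAt_abelOdd hF hk)
  rw [(hpp.hasDerivAt_axialMean_time 0 t hz).unique hder']
  have hGcont : ContinuousOn (fun x => F (z + t * x) / √(z + t * x) * hypThreeHalves (W t x))
      (uIcc (-1) 1) :=
    ContinuousOn.mul (ContinuousOn.div (by fun_prop) (by fun_prop) fun x hx =>
      (sqrt_pos.2 (hpos (t, x) ⟨⟨ht, htz⟩, hx⟩).1).ne')
      (hslice (E := fun t x => hypThreeHalves (W t x)) ⟨ht, htz⟩ hGc)
  have hGi := hGcont.intervalIntegrable (μ := volume)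
  have hΦi := (hslice ⟨ht, htz⟩ hΦc).intervalIntegrable (μ := volume)
  have hΦi' := (hslice ⟨ht, htz⟩ hΦc').intervalIntegrable (μ := volume)
  have hparts := intervalIntegral.integral_eq_sub_of_hasDerivAt hdx
    ((hΦi.add (hΦi'.const_mul t)).sub (hGi.const_mul (t ^ 2 / (8 * z))))
  rw [intervalIntegral.integral_sub (hΦi.add (hΦi'.const_mul t)) (hGi.const_mul (t ^ 2 / (8 * z))),
    intervalIntegral.integral_add hΦi (hΦi'.const_mul t), intervalIntegral.integral_const_mul,
    intervalIntegral.integral_const_mul] at hparts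
  have hΦ1 : Φ t 1 = F (z + t) * √(z + t) := by simp [hΦ, hW, hypHalf_zero]
  have hΦ2 : Φ t (-1) = F (z - t) * √(z - t) := by
    simp [hΦ, hW, hypHalf_zero, ← sub_eq_add_neg]
  rw [hΦ1, hΦ2] at hparts
  simp only [id, one_mul]
  rw [show (∫ x in (-1)..1, Φ t x) + t * ∫ x in (-1)..1, Φ' t x = F (z + t) * √(z + t)
    + F (z - t) * √(z - t) + t ^ 2 / (8 * z) * ∫ x in (-1)..1,
      F (z + t * x) / √(z + t * x) * hypThreeHalves (W t x) by linarith]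
  change _ = 1 / (2 * √z) * (F (z + t) * √(z + t) + F (z - t) * √(z - t))
    + t ^ 2 / (16 * z * √z) * ∫ x in (-1)..1, F (z + t * x) / √(z + t * x) * hypThreeHalves (W t x)
  generalize (∫ x in (-1)..1, F (z + t * x) / √(z + t * x) * hypThreeHalves (W t x)) = I
  field_simp
  ring

theorem earlyIntegrand_of_lt {f g : ℝ → ℝ} (hf : ContinuousOn f (Ici 0))
    (hg : ContinuousOn g (Ici 0)) {t z : ℝ} (ht : 0 ≤ t) (htz : t < z) :
    IntervalIntegrable (earlyIntegrand₁ f t z) volume (z - t) (z + t) ∧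
      IntervalIntegrable (earlyIntegrand₂ g t z) volume (z - t) (z + t) := by
  have hz : 0 < z := ht.trans_lt htz
  have hu : uIcc (z - t) (z + t) = Icc (z - t) (z + t) := uIcc_of_le (by linarith)
  have hpos : ∀ ζ ∈ uIcc (z - t) (z + t), 0 < ζ := fun ζ hζ => by
    rw [hu] at hζ; linarith [hζ.1]
  have hW : ContinuousOn (fun ζ => (t ^ 2 - (ζ - z) ^ 2) / (4 * ζ * z)) (uIcc (z - t) (z + t)) :=
    ContinuousOn.div (by fun_prop) (by fun_prop) fun ζ hζ => by
      have := hpos ζ hζ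
      positivity
  have hmem : MapsTo (fun ζ => (t ^ 2 - (ζ - z) ^ 2) / (4 * ζ * z)) (uIcc (z - t) (z + t))
      (Ioo (-1) 1) := fun ζ hζ => by
    have h0 := hpos ζ hζ
    rw [hu] at hζ
    have h1 : 0 ≤ (t ^ 2 - (ζ - z) ^ 2) / (4 * ζ * z) :=
      div_nonneg (by nlinarith [hζ.1, hζ.2]) (by positivity)
    exact ⟨by linarith, (div_lt_one (by positivity)).2 (by nlinarith)⟩
  have hsub : uIcc (z - t) (z + t) ⊆ Ici 0 := fun ζ hζ => (hpos ζ hζ).le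
  exact ⟨((((hf.mono hsub).div (by fun_prop) fun ζ hζ => (sqrt_pos.2 (hpos ζ hζ)).ne').mul
      (continuousOn_hypThreeHalves.comp hW hmem))).intervalIntegrable,
    ((((hg.mono hsub).mul (by fun_prop)).mul
      (continuousOn_hypHalf.comp hW hmem))).intervalIntegrable⟩

theorem axialMean_waveProfile_early_of_lt {f g : ℝ → ℝ} (hf : ContDiffOn ℝ 1 f (Ici 0))
    (hg : ContinuousOn g (Ici 0)) {t z : ℝ} (ht : 0 < t) (htz : t < z) :
    axialMean 0 (waveProfile f g) t z =
      1 / 2 * √(1 - t / z) * f (z - t) + 1 / 2 * √(1 + t / z) * f (z + t)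
      + t / (16 * z * √z) * (∫ ζ in (z - t)..(z + t), earlyIntegrand₁ f t z ζ)
      + 1 / (2 * √z) * (∫ ζ in (z - t)..(z + t), earlyIntegrand₂ g t z ζ) := by
  have hz : 0 < z := ht.trans htz
  have hs : 0 < √z := sqrt_pos.2 hz
  obtain ⟨hk, F, hF, hFf⟩ := exists_primitive_of_contDiffOn hf
  have hg' : Continuous fun x => g |x| := hg.comp_continuous continuous_abs fun x => abs_nonneg x
  have hpos : ∀ ζ ∈ uIcc (z - t) (z + t), 0 < ζ := fun ζ hζ => by
    rw [uIcc_of_le (by linarith)] at hζ; linarith [hζ.1]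
  have hE : ∫ ζ in (z - t)..(z + t), g |ζ| * √ζ * hypHalf ((t ^ 2 - (ζ - z) ^ 2) / (4 * ζ * z))
      = ∫ ζ in (z - t)..(z + t), earlyIntegrand₂ g t z ζ :=
    intervalIntegral.integral_congr fun ζ hζ => by
      simp only [earlyIntegrand₂, abs_of_pos (hpos ζ hζ)]
  have hsub := intervalIntegral.mul_integral_comp_add_mul (a := -1) (b := 1)
    (f := earlyIntegrand₁ f t z) t z
  rw [mul_neg, mul_one, ← sub_eq_add_neg] at hsub
  have hI : ∫ x in (-1)..1, F (z + t * x) / √(z + t * x)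
      * hypThreeHalves (t ^ 2 * (1 - x ^ 2) / (4 * (z + t * x) * z))
      = ∫ x in (-1)..1, earlyIntegrand₁ f t z (z + t * x) :=
    intervalIntegral.integral_congr fun x hx => by
      rw [uIcc_of_le (by norm_num)] at hx
      have := (abs_early_modulus_lt ht htz hx).1
      simp only [earlyIntegrand₁]
      rw [hFf _ this.le]
      congr 3
      ring
  rw [axialMean_waveProfile_eq_add hf hg, axialMean_zero_abelOdd_early hg' ht htz, hE,
    ← hFf 0 le_rfl, axialMean_zero_abelEven_early hF hk ht htz, hI, ← hsub,
    hFf _ (by linarith), hFf _ (by linarith), show 1 - t / z = (z - t) / z by field_simp,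
    show 1 + t / z = (z + t) / z by field_simp, sqrt_div (by linarith), sqrt_div (by linarith)]
  field_simp
  ring

/-- At `t = z` the interval reaches `ζ = 0`, outside the scope of the argument for `t < z`. The
formula is recovered from the one for `z ≤ t`, whose first three integrals are empty, by integrating
`d/dζ (f √ζ F(w))`. -/
theorem axialMean_waveProfile_early_self {f g : ℝ → ℝ} (hf : ContDiffOn ℝ 1 f (Ici 0))
    (hg : ContinuousOn g (Ici 0)) {z : ℝ} (hz : 0 < z) :
    IntervalIntegrable (earlyIntegrand₁ f z z) volume 0 (2 * z) ∧
    IntervalIntegrable (earlyIntegrand₂ g z z) volume 0 (2 * z) ∧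
    axialMean 0 (waveProfile f g) z z = 1 / 2 * √2 * f (2 * z)
      + z / (16 * z * √z) * (∫ ζ in 0..(2 * z), earlyIntegrand₁ f z z ζ)
      + 1 / (2 * √z) * (∫ ζ in 0..(2 * z), earlyIntegrand₂ g z z ζ) := by
  have hs : 0 < √z := sqrt_pos.2 hz
  have hs2 := sq_sqrt hz.le
  have h2z : 0 ≤ 2 * z := by linarith
  obtain ⟨-, -, -, h4, h5, hΨ⟩ := axialMean_waveProfile_late hf hg hz le_rfl
  simp only [sub_self, intervalIntegral.integral_same, ← two_mul, mul_zero,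
    zero_add] at h4 h5 hΨ
  -- The modulus at `t = z` after cancelling `ζ`. It stays in `[0, 1/2]`, so `F` and `G` remain
  -- continuous up to `ζ = 0`.
  set w : ℝ → ℝ := fun ζ => (2 * z - ζ) / (4 * z) with hw
  have hwe : ∀ ζ > 0, (z ^ 2 - (ζ - z) ^ 2) / (4 * ζ * z) = w ζ := fun ζ hζ => by
    simp only [hw]
    field_simp
    ring
  have hwm : MapsTo w (Icc 0 (2 * z)) (Ioo (-1) 1) := fun ζ hζ => by
    simp only [hw]
    exact ⟨by rw [lt_div_iff₀ (by positivity)]; linarith [hζ.2],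
      by rw [div_lt_iff₀ (by positivity)]; linarith [hζ.1]⟩
  have hwc : ContinuousOn w (Icc 0 (2 * z)) := by fun_prop
  have hfc : ContinuousOn f (Icc 0 (2 * z)) := hf.continuousOn.mono Icc_subset_Ici_self
  have hgc : ContinuousOn g (Icc 0 (2 * z)) := hg.mono Icc_subset_Ici_self
  have hHc := continuousOn_hypHalf.comp hwc hwm
  have hGc := continuousOn_hypThreeHalves.comp hwc hwm
  have hu : uIcc 0 (2 * z) = Icc 0 (2 * z) := uIcc_of_le h2z
  have hAi : IntervalIntegrable (fun ζ => f ζ * √ζ * hypThreeHalves (w ζ)) volume 0 (2 * z) :=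
    ContinuousOn.intervalIntegrable (by rw [hu]; exact (hfc.mul (by fun_prop)).mul hGc)
  have hgi : IntervalIntegrable (fun ζ => g ζ * √ζ * hypHalf (w ζ)) volume 0 (2 * z) :=
    ContinuousOn.intervalIntegrable (by rw [hu]; exact (hgc.mul (by fun_prop)).mul hHc)
  have he2 : ∀ ζ ∈ uIoc 0 (2 * z), g ζ * √ζ * hypHalf (w ζ) = earlyIntegrand₂ g z z ζ :=
    fun ζ hζ => by
      rw [uIoc_of_le h2z] at hζ
      rw [earlyIntegrand₂, hwe ζ hζ.1]
  have he1 : ∀ ζ ∈ uIoc 0 (2 * z), 1 / (2 * z) * (lateIntegrand₅ f z z ζ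
      + f ζ * √ζ * hypThreeHalves (w ζ)) = earlyIntegrand₁ f z z ζ := fun ζ hζ => by
    rw [uIoc_of_le h2z] at hζ
    have hζ0 := hζ.1
    rw [earlyIntegrand₁, lateIntegrand₅, hwe ζ hζ.1]
    have hq : 0 < √ζ := sqrt_pos.2 hζ.1
    have hq2 := sq_sqrt hζ.1.le
    generalize hypThreeHalves (w ζ) = A
    generalize f ζ = B
    generalize √ζ = q at *
    subst hq2
    field_simp
    ring
  have hi2 := hgi.congr he2
  have hi1 := ((h5.add hAi).const_mul (1 / (2 * z))).congr he1
  refine ⟨hi1, hi2, ?_⟩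
  have hE1 : ∫ ζ in 0..(2 * z), earlyIntegrand₁ f z z ζ = 1 / (2 * z) *
      ((∫ ζ in 0..(2 * z), lateIntegrand₅ f z z ζ)
        + ∫ ζ in 0..(2 * z), f ζ * √ζ * hypThreeHalves (w ζ)) := by
    rw [← intervalIntegral.integral_add h5 hAi, ← intervalIntegral.integral_const_mul]
    exact intervalIntegral.integral_congr_ae (.of_forall fun ζ hζ => (he1 ζ hζ).symm)
  have hparts := intervalIntegral.integral_eq_sub_of_hasDerivAt_of_le
    (f := fun ζ => f ζ * √ζ * hypHalf (w ζ)) (f' := fun ζ => lateIntegrand₄ f g z z ζ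
      - earlyIntegrand₂ g z z ζ - 1 / (16 * z) * (f ζ * √ζ * hypThreeHalves (w ζ))) h2z
    ((hfc.mul (by fun_prop)).mul hHc) (fun ζ hζ => ?_)
    ((h4.sub hi2).sub (hAi.const_mul _))
  · rw [intervalIntegral.integral_sub (h4.sub hi2) (hAi.const_mul _),
      intervalIntegral.integral_sub h4 hi2, intervalIntegral.integral_const_mul] at hparts
    have h2 : √(2 * z) = √2 * √z := sqrt_mul (by norm_num) z
    simp only [hw, sub_self, zero_div, hypHalf_zero, sqrt_zero, mul_zero, zero_mul, sub_zero,
      mul_one, h2] at hparts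
    rw [hΨ, hE1]
    simp only [hw]
    rw [show ∫ ζ in 0..(2 * z), lateIntegrand₄ f g z z ζ = f (2 * z) * (√2 * √z)
      + (∫ ζ in 0..(2 * z), earlyIntegrand₂ g z z ζ) + 1 / (16 * z) * ∫ ζ in 0..(2 * z), f ζ * √ζ
        * hypThreeHalves ((2 * z - ζ) / (4 * z)) by linarith]
    field_simp
    ring
  · have hζ0 := hζ.1
    have hfd : HasDerivAt f (derivWithin f (Ici 0) ζ) ζ :=
      (hf.differentiableOn (by simp) ζ hζ.1.le).hasDerivWithinAt.hasDerivAt (Ici_mem_nhds hζ.1)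
    have hwd : HasDerivAt w (-1 / (4 * z)) ζ :=
      ((hasDerivAt_id ζ).const_sub (2 * z)).div_const (4 * z)
    have hm := hwm ⟨hζ.1.le, hζ.2.le⟩
    have hd := (hfd.mul ((hasDerivAt_id ζ).sqrt hζ.1.ne')).mul
      ((hasDerivAt_hypHalf (abs_lt.2 hm)).comp ζ hwd)
    refine hd.congr_deriv ?_
    simp only [Pi.mul_apply, id, Function.comp_apply]
    rw [lateIntegrand₄, earlyIntegrand₂, hwe ζ hζ.1]
    have hq : 0 < √ζ := sqrt_pos.2 hζ.1
    have hq2 := sq_sqrt hζ.1.le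
    generalize hypHalf (w ζ) = A
    generalize hypThreeHalves (w ζ) = B
    generalize f ζ = C
    generalize derivWithin f (Ici 0) ζ = C'
    generalize g ζ = C''
    clear hd hm hwd hfd
    generalize √ζ = q at *
    subst hq2
    field_simp
    ring

theorem axialMean_waveProfile_early {f g : ℝ → ℝ} (hf : ContDiffOn ℝ 1 f (Ici 0))
    (hg : ContinuousOn g (Ici 0)) {t z : ℝ} (ht : 0 ≤ t) (hz : 0 < z) (htz : t ≤ z) :
    IntervalIntegrable (earlyIntegrand₁ f t z) volume (z - t) (z + t) ∧
    IntervalIntegrable (earlyIntegrand₂ g t z) volume (z - t) (z + t) ∧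
    axialMean 0 (waveProfile f g) t z =
      1 / 2 * √(1 - t / z) * f (z - t) + 1 / 2 * √(1 + t / z) * f (z + t)
      + t / (16 * z * √z) * (∫ ζ in (z - t)..(z + t), earlyIntegrand₁ f t z ζ)
      + 1 / (2 * √z) * (∫ ζ in (z - t)..(z + t), earlyIntegrand₂ g t z ζ) := by
  rcases htz.eq_or_lt with rfl | htz
  · obtain ⟨h1, h2, h3⟩ := axialMean_waveProfile_early_self hf hg hz
    rw [sub_self, ← two_mul]
    refine ⟨h1, h2, ?_⟩
    rw [h3, div_self hz.ne', sub_self, sqrt_zero, one_add_one_eq_two]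
    ring
  · obtain ⟨h1, h2⟩ := earlyIntegrand_of_lt hf.continuousOn hg ht htz
    refine ⟨h1, h2, ?_⟩
    rcases ht.eq_or_lt with rfl | ht
    · rw [axialMean_zero_waveProfile hf hg hz]
      simp
      ring
    · exact axialMean_waveProfile_early_of_lt hf hg ht htz

/-! ### Regularity of the axis values -/

/-- By induction the one-sided derivative is extended and then integrated; the base case is even
reflection. -/
theorem exists_contDiff_eqOn_Ici (n : ℕ) {f : ℝ → ℝ} (hf : ContDiffOn ℝ n f (Ici 0)) :
    ∃ F : ℝ → ℝ, ContDiff ℝ n F ∧ EqOn F f (Ici 0) := by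
  induction n generalizing f with
  | zero =>
    refine ⟨fun x => f |x|, ?_, fun x hx => by simp only [abs_of_nonneg (mem_Ici.1 hx)]⟩
    simp only [CharP.cast_eq_zero, contDiff_zero]
    exact hf.continuousOn.comp_continuous continuous_abs fun x => abs_nonneg x
  | succ n ih =>
    have h1 : ContDiffOn ℝ 1 f (Ici 0) := hf.of_le (by norm_cast; omega)
    rw [Nat.cast_succ, contDiffOn_succ_iff_derivWithin (uniqueDiffOn_Ici 0)] at hf
    obtain ⟨H, hH, hHe⟩ := ih hf.2.2
    obtain ⟨K, hK⟩ := exists_primitive hH.continuous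
    obtain ⟨hk, F, hF, hFf⟩ := exists_primitive_of_contDiffOn h1
    refine ⟨fun x => K x - K 0 + f 0, ?_, fun x hx => ?_⟩
    · have hd : ∀ x, HasDerivAt (fun x => K x - K 0 + f 0) (H x) x := fun x =>
        ((hK x).sub_const _).add_const _
      rw [Nat.cast_succ, contDiff_succ_iff_deriv]
      refine ⟨fun x => (hd x).differentiableAt, by simp, ?_⟩
      rwa [funext fun x => (hd x).deriv]
    · have e1 := intervalIntegral.integral_eq_sub_of_hasDerivAt (a := 0) (b := x)
        (fun y _ => hK y) (hH.continuous.intervalIntegrable _ _)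
      have e2 := intervalIntegral.integral_eq_sub_of_hasDerivAt (a := 0) (b := x)
        (fun y _ => hF y) (hk.intervalIntegrable _ _)
      have e3 : ∫ y in 0..x, H y = ∫ y in 0..x, derivWithin f (Ici 0) |y| :=
        intervalIntegral.integral_congr fun y hy => by
          rw [uIcc_of_le hx] at hy
          simp only [abs_of_nonneg hy.1, hHe hy.1]
      rw [e3, e2, hFf x hx, hFf 0 le_rfl] at e1
      simp only
      linarith

theorem contDiff_integral_comp_mul_sin (n : ℕ) {w h : ℝ → ℝ} (hw : Continuous w)
    (hh : ContDiff ℝ n h) : ContDiff ℝ n fun s : ℝ => ∫ α in 0..π / 2, w α * h (s * sin α) := by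
  induction n generalizing w h with
  | zero => simpa using continuous_integral_comp_mul_sin hw hh.continuous
  | succ n ih =>
    rw [Nat.cast_succ, contDiff_succ_iff_deriv] at hh ⊢
    have hd := hasDerivAt_integral_comp_mul_sin (a := 0) (b := π / 2) hw
      (fun x => (hh.1 x).hasDerivAt) hh.2.2.continuous
    refine ⟨fun x => (hd x).differentiableAt, by simp, ?_⟩
    rw [funext fun x => (hd x).deriv]
    simpa only [mul_assoc] using ih (w := fun α => w α * sin α) (hw.mul continuous_sin) hh.2.2

theorem hasDerivAt_glue {U V U' V' : ℝ → ℝ} (hU : ∀ s, HasDerivAt U (U' s) s)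
    (hV : ∀ s, HasDerivAt V (V' s) s) (h0 : U 0 = V 0) (h1 : U' 0 = V' 0) (s : ℝ) :
    HasDerivAt (fun s => if 0 ≤ s then U s else V s) (if 0 ≤ s then U' s else V' s) s := by
  rcases lt_trichotomy s 0 with hs | rfl | hs
  · rw [if_neg hs.not_ge]
    refine (hV s).congr_of_eventuallyEq ?_
    filter_upwards [gt_mem_nhds hs] with x hx using if_neg hx.not_ge
  · rw [if_pos le_rfl, ← hasDerivWithinAt_univ, ← Ici_union_Iic (a := (0 : ℝ))]
    refine (hU 0).hasDerivWithinAt.congr (fun x hx => if_pos (mem_Ici.1 hx)) (if_pos le_rfl) |>.union ?_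
    rw [h1]
    refine (hV 0).hasDerivWithinAt.congr (fun x hx => ?_) ?_
    · rcases (mem_Iic.1 hx).lt_or_eq with h | rfl
      · exact if_neg h.not_ge
      · rw [if_pos le_rfl, h0]
    · rw [if_pos le_rfl, h0]
  · rw [if_pos hs.le]
    refine (hU s).congr_of_eventuallyEq ?_
    filter_upwards [lt_mem_nhds hs] with x hx using if_pos hx.le

theorem isPiecewisePrimitive_glue {U V U' V' : ℝ → ℝ} (hU : ∀ s, HasDerivAt U (U' s) s)
    (hV : ∀ s, HasDerivAt V (V' s) s) (h0 : U 0 = V 0) (hU' : Continuous U')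
    (hV' : Continuous V') :
    IsPiecewisePrimitive (fun s => if 0 ≤ s then U s else V s)
      (fun s => if 0 ≤ s then U' s else V' s) where
  continuous := Continuous.if_le (continuous_iff_continuousAt.2 fun s => (hU s).continuousAt)
    (continuous_iff_continuousAt.2 fun s => (hV s).continuousAt) continuous_const continuous_id
    fun s hs => by rw [← hs, h0]
  measurable := Measurable.ite measurableSet_Ici hU'.measurable hV'.measurable
  continuousAt := fun s hs => by
    rcases hs.lt_or_gt with hs | hs
    · refine hV'.continuousAt.congr ?_
      filter_upwards [gt_mem_nhds hs] with x hx using (if_neg hx.not_ge).symm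
    · refine hU'.continuousAt.congr ?_
      filter_upwards [lt_mem_nhds hs] with x hx using (if_pos hx.le).symm
  hasDerivAt := fun s hs => by
    rcases hs.lt_or_gt with hs | hs
    · rw [if_neg hs.not_ge]
      refine (hV s).congr_of_eventuallyEq ?_
      filter_upwards [gt_mem_nhds hs] with x hx using if_neg hx.not_ge
    · rw [if_pos hs.le]
      refine (hU s).congr_of_eventuallyEq ?_
      filter_upwards [lt_mem_nhds hs] with x hx using if_pos hx.le
  bounded := fun M => by
    obtain ⟨C, hC⟩ := (isCompact_Icc (a := -M) (b := M)).exists_bound_of_continuousOn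
      hU'.continuousOn
    obtain ⟨D, hD⟩ := (isCompact_Icc (a := -M) (b := M)).exists_bound_of_continuousOn
      hV'.continuousOn
    refine ⟨max C D, fun s hs => ?_⟩
    split_ifs
    · exact (hC s (abs_le.1 hs)).trans (le_max_left _ _)
    · exact (hD s (abs_le.1 hs)).trans (le_max_right _ _)

/-- With `A`, `B` the smooth versions of the even and odd parts, the profile is `A s + B s` for `s ≥
0` and `A (-s) - B (-s)` for `s < 0`. Its first derivatives match at the origin exactly when `A' 0 =
0`, which is `f' 0 = 0`. The second derivative may jump there, which a piecewise primitive allows.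
-/
theorem exists_isPiecewisePrimitive_waveProfile {f g : ℝ → ℝ} (hf : ContDiffOn ℝ 3 f (Ici 0))
    (hf0 : derivWithin f (Ici 0) 0 = 0) (hg : ContDiffOn ℝ 2 g (Ici 0)) :
    ∃ R S : ℝ → ℝ, IsPiecewisePrimitive (waveProfile f g) R ∧ IsPiecewisePrimitive R S := by
  have hf2 : ContDiffOn ℝ (2 : ℕ) (derivWithin f (Ici 0)) (Ici 0) :=
    hf.derivWithin (uniqueDiffOn_Ici 0) (by norm_num)
  obtain ⟨K, hK, hKe⟩ := exists_contDiff_eqOn_Ici 2 hf2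
  obtain ⟨G, hG, hGe⟩ := exists_contDiff_eqOn_Ici 2 (f := g) hg
  have hA : ContDiff ℝ (1 + 1) fun s : ℝ => f 0 + s * ∫ α in 0..π / 2, 1 * K (s * sin α) :=
    contDiff_const.add (contDiff_id.mul
      (contDiff_integral_comp_mul_sin 2 (continuous_const (y := (1 : ℝ))) hK))
  have hB : ContDiff ℝ (1 + 1) fun s : ℝ => s * ∫ α in 0..π / 2, sin α * G (s * sin α) :=
    contDiff_id.mul (contDiff_integral_comp_mul_sin 2 continuous_sin hG)
  have hA0 : deriv (fun s : ℝ => f 0 + s * ∫ α in 0..π / 2, 1 * K (s * sin α)) 0 = 0 := by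
    have h1 := (contDiff_integral_comp_mul_sin 2 (continuous_const (y := (1 : ℝ))) hK
      ).differentiable (by simp) 0
    have := (((hasDerivAt_id (0 : ℝ)).mul h1.hasDerivAt).const_add (f 0)).deriv
    refine this.trans ?_
    simp [hKe (mem_Ici.2 le_rfl), hf0]
  set A : ℝ → ℝ := fun s : ℝ => f 0 + s * ∫ α in 0..π / 2, 1 * K (s * sin α) with hAdef
  set B : ℝ → ℝ := fun s : ℝ => s * ∫ α in 0..π / 2, sin α * G (s * sin α) with hBdef
  have hP : waveProfile f g = fun s => if 0 ≤ s then A s + B s else A (-s) - B (-s) := by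
    have hint : ∀ s ≥ 0, (∫ α in 0..π / 2, derivWithin f (Ici 0) |s * sin α|)
        = ∫ α in 0..π / 2, 1 * K (s * sin α) ∧ (∫ α in 0..π / 2, sin α * g |s * sin α|)
        = ∫ α in 0..π / 2, sin α * G (s * sin α) := fun s hs => by
      have hp : ∀ α ∈ uIcc 0 (π / 2), 0 ≤ s * sin α := fun α hα => by
        rw [uIcc_of_le (by positivity)] at hα
        exact mul_nonneg hs (sin_nonneg_of_nonneg_of_le_pi hα.1 (by linarith [hα.2, pi_pos]))
      constructor <;> refine intervalIntegral.integral_congr fun α hα => ?_ <;>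
        simp only [abs_of_nonneg (hp α hα), hKe (mem_Ici.2 (hp α hα)),
          hGe (mem_Ici.2 (hp α hα)), one_mul]
    funext s
    split_ifs with hs
    · simp only [waveProfile, axisProfile, abelEven, abelOdd, abs_of_nonneg hs, (hint s hs).1,
        (hint s hs).2, hAdef, hBdef]
    · have hs' := neg_nonneg.2 (not_le.1 hs).le
      simp only [waveProfile, axisProfile, abelEven, abelOdd, abs_of_neg (not_le.1 hs),
        (hint (-s) hs').1, (hint (-s) hs').2, hAdef, hBdef]
      ring
  rw [contDiff_succ_iff_deriv] at hA hB
  have h1 : ∀ {u : ℝ → ℝ}, ContDiff ℝ 1 u →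
      (∀ s, HasDerivAt u (deriv u s) s) ∧ Continuous (deriv u) := fun {u} hu =>
    ⟨fun s => (hu.differentiable (by simp) s).hasDerivAt, hu.continuous_deriv le_rfl⟩
  have hneg : ∀ {u u' : ℝ → ℝ}, (∀ s, HasDerivAt u (u' s) s) →
      ∀ s, HasDerivAt (fun s => u (-s)) (-u' (-s)) s := fun {u u'} hu s => by
    simpa using! (hu (-s)).comp s (hasDerivAt_neg s)
  have hAd := fun s => (hA.1 s).hasDerivAt
  have hBd := fun s => (hB.1 s).hasDerivAt
  have hA2 := h1 hA.2.2
  have hB2 := h1 hB.2.2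
  have hA2c := hA2.2
  have hB2c := hB2.2
  have hAc := hA.2.2.continuous
  have hBc := hB.2.2.continuous
  have hd := hasDerivAt_glue (fun s => (hAd s).add (hBd s))
    (fun s => (hneg hAd s).sub (hneg hBd s)) (by simp [hAdef, hBdef]) (by simp [hA0])
  have hR := isPiecewisePrimitive_glue (fun s => (hA2.1 s).add (hB2.1 s))
    (fun s => (hneg hA2.1 s).neg.sub (hneg hB2.1 s).neg) (by simp [hA0]) (by fun_prop)
    (by fun_prop)
  exact ⟨_, _, hP ▸ IsPiecewisePrimitive.of_continuous hR.continuous hd, hR⟩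

/-! ### Smoothness and energy of axial means -/

theorem ContDiffOn.of_partials (n : ℕ) {H Ht Hz : ℝ → ℝ → ℝ} {U : Set (ℝ × ℝ)} (hU : IsOpen U)
    (ht : ∀ p ∈ U, HasDerivAt (fun s => H s p.2) (Ht p.1 p.2) p.1)
    (hz : ∀ p ∈ U, HasDerivAt (H p.1) (Hz p.1 p.2) p.2)
    (hHt : ContDiffOn ℝ n (fun p : ℝ × ℝ => Ht p.1 p.2) U)
    (hHz : ContDiffOn ℝ n (fun p : ℝ × ℝ => Hz p.1 p.2) U) :
    ContDiffOn ℝ (n + 1) (fun p : ℝ × ℝ => H p.1 p.2) U := by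
  rw [contDiffOn_succ_iff_hasFDerivWithinAt_of_uniqueDiffOn hU.uniqueDiffOn]
  refine ⟨by simp, fun p => Ht p.1 p.2 • ContinuousLinearMap.fst ℝ ℝ ℝ
    + Hz p.1 p.2 • ContinuousLinearMap.snd ℝ ℝ ℝ,
    (hHt.smul contDiffOn_const).add (hHz.smul contDiffOn_const), fun p hp => ?_⟩
  have hc : ∀ {G : ℝ → ℝ → ℝ}, ContDiffOn ℝ n (fun p : ℝ × ℝ => G p.1 p.2) U →
      ContinuousAt (fun p : ℝ × ℝ => ContinuousLinearMap.toSpanSingleton ℝ (G p.1 p.2)) p :=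
    fun {G} hG => (ContinuousLinearMap.toSpanSingletonCLE (𝕜 := ℝ) (E := ℝ)).continuous.continuousAt.comp
      (hG.continuousOn.continuousAt (hU.mem_nhds hp))
  have := hasStrictFDerivAt_uncurry_coprod (𝕜 := ℝ) (u := p) (f := H)
    (f₁ := fun s y => ContinuousLinearMap.toSpanSingleton ℝ (Ht s y))
    (f₂ := fun s y => ContinuousLinearMap.toSpanSingleton ℝ (Hz s y))
    (by filter_upwards [hU.mem_nhds hp] with q hq using (ht q hq).hasFDerivAt)
    (by filter_upwards [hU.mem_nhds hp] with q hq using (hz q hq).hasFDerivAt) (hc hHt) (hc hHz)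
  refine (this.hasFDerivAt.congr_fderiv ?_).hasFDerivWithinAt
  ext <;> simp [Function.HasUncurry.uncurry]

namespace IsPiecewisePrimitive

variable {P R S : ℝ → ℝ}

/-- The second partial derivatives are means of `S`; they are continuous for `z > 0` although `S`
may jump, since a single angle is null. -/
theorem contDiffOn_axialMean (hP : IsPiecewisePrimitive P R) (hR : IsPiecewisePrimitive R S) :
    ContDiffOn ℝ 2 (fun p : ℝ × ℝ => axialMean 0 P p.1 p.2) (univ ×ˢ Ioi 0) := by
  have hU : IsOpen ((univ : Set ℝ) ×ˢ Ioi (0 : ℝ)) := isOpen_univ.prod isOpen_Ioi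
  have hS : ∀ j, ContDiffOn ℝ (0 : ℕ) (fun p : ℝ × ℝ => axialMean j S p.1 p.2)
      (univ ×ˢ Ioi 0) := fun j => by
    simp only [CharP.cast_eq_zero, contDiffOn_zero]
    exact fun p hp => (hR.continuousAt_axialMean j p.1 hp.2).continuousWithinAt
  have h1 : ∀ j, ContDiffOn ℝ (1 : ℕ) (fun p : ℝ × ℝ => axialMean j R p.1 p.2)
      (univ ×ˢ Ioi 0) := fun j => by
    simpa using ContDiffOn.of_partials 0 hU
      (fun p hp => hR.hasDerivAt_axialMean_time j p.1 hp.2)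
      (fun p hp => hR.hasDerivAt_axialMean_space j p.1 hp.2) (hS j) (hS (j + 1))
  have := ContDiffOn.of_partials 1 hU
    (fun p hp => hP.hasDerivAt_axialMean_time 0 p.1 hp.2)
    (fun p hp => hP.hasDerivAt_axialMean_space 0 p.1 hp.2) (h1 0) (h1 1)
  simpa [one_add_one_eq_two] using this

theorem wave_eq_axialMean (hP : IsPiecewisePrimitive P R) (hR : IsPiecewisePrimitive R S)
    (t : ℝ) {z : ℝ} (hz : 0 < z) :
    deriv (fun s => deriv (fun r => axialMean 0 P r z) s) t
      - deriv (fun y => y * deriv (fun x => axialMean 0 P t x) y) z / z = 0 := by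
  have h1 : (fun s => deriv (fun r => axialMean 0 P r z) s) = fun s => axialMean 0 R s z :=
    funext fun s => (hP.hasDerivAt_axialMean_time 0 s hz).deriv
  have h2 : (fun y => y * deriv (fun x => axialMean 0 P t x) y)
      =ᶠ[𝓝 z] fun y => y * axialMean 1 R t y := by
    filter_upwards [lt_mem_nhds hz] with y hy
    rw [(hP.hasDerivAt_axialMean_space 0 t hy).deriv]
  rw [h1, h2.deriv_eq, (hR.hasDerivAt_axialMean_time 0 t hz).deriv,
    ((hasDerivAt_id' z).fun_mul (hR.hasDerivAt_axialMean_space 1 t hz)).deriv,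
    hR.axialMean_add_two t hz]
  field_simp
  ring

theorem exists_abs_axialMean_le (h : IsPiecewisePrimitive R S) (N : ℝ) :
    ∃ C, ∀ j t z, |t| + |z| ≤ N → |axialMean j S t z| ≤ C := by
  obtain ⟨C, hC⟩ := h.bounded N
  refine ⟨C, fun j t z htz => ?_⟩
  have h1 : ‖∫ θ in 0..π, cos θ ^ j * S (t + z * cos θ)‖ ≤ C * |π - 0| := by
    refine intervalIntegral.norm_integral_le_of_norm_le_const fun θ _ => ?_
    rw [norm_mul, norm_pow, norm_eq_abs, norm_eq_abs]
    have h2 := hC _ (abs_add_mul_cos_le htz θ)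
    have h3 := pow_le_one₀ (n := j) (abs_nonneg _) (abs_cos_le_one θ)
    nlinarith [abs_nonneg (S (t + z * cos θ))]
  rw [axialMean, abs_mul, abs_of_pos (by positivity : 0 < 1 / π), div_mul_eq_mul_div, one_mul,
    div_le_iff₀ pi_pos]
  simpa [abs_of_pos pi_pos] using h1

theorem intervalIntegrable_axialMean (h : IsPiecewisePrimitive R S) (j : ℕ) (t : ℝ) {M : ℝ}
    (hM : 0 ≤ M) : IntervalIntegrable (fun z => axialMean j S t z) volume 0 M := by
  obtain ⟨C, hC⟩ := h.exists_abs_axialMean_le (|t| + M)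
  rw [intervalIntegrable_iff_integrableOn_Ioc_of_le hM]
  refine Integrable.mono' (g := fun _ => C) (by simp) ?_ ?_
  · refine ContinuousOn.aestronglyMeasurable (fun z hz => ?_) measurableSet_Ioc
    exact ((h.continuousAt_axialMean j t hz.1).comp (f := fun z => (t, z))
      (by fun_prop)).continuousWithinAt
  · refine (ae_restrict_iff' measurableSet_Ioc).2 (.of_forall fun z hz => hC j t z ?_)
    rw [abs_of_pos hz.1]
    linarith [hz.2]

end IsPiecewisePrimitive

theorem hasDerivAt_max_zero_sq (x : ℝ) : HasDerivAt (fun x => max x 0 ^ 2) (2 * max x 0) x := by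
  have := hasDerivAt_glue (U := fun x => x ^ 2) (V := fun _ => 0) (U' := fun x => 2 * x)
    (V' := fun _ => 0) (fun s => by simpa using hasDerivAt_pow 2 s)
    (fun s => hasDerivAt_const s 0) (by simp) (by simp) x
  convert this using 1
  · funext y
    split_ifs with h
    · rw [max_eq_left h]
    · rw [max_eq_right (not_le.1 h).le]; simp
  · split_ifs with h
    · rw [max_eq_left h]
    · rw [max_eq_right (not_le.1 h).le]; simp

/-- The energy density of an axial mean with respect to `dz`, weighted by a cut-off of the cone
`t + z ≤ M`. -/
noncomputable def coneEnergyDensity (R : ℝ → ℝ) (M t z : ℝ) : ℝ :=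
  max (M - (z + t)) 0 ^ 2 * (z * (axialMean 0 R t z ^ 2 + axialMean 1 R t z ^ 2))

theorem continuous_coneEnergyDensity {R : ℝ → ℝ} (hR : Continuous R) (M : ℝ) :
    Continuous fun p : ℝ × ℝ => coneEnergyDensity R M p.1 p.2 := by
  have h0 := continuous_axialMean hR 0
  have h1 := continuous_axialMean hR 1
  unfold coneEnergyDensity
  fun_prop

/-- The time derivative of `coneEnergyDensity`, where `S` is the derivative of `R`. -/
noncomputable def coneEnergyDensityDeriv (R S : ℝ → ℝ) (M t z : ℝ) : ℝ :=
  -2 * max (M - (z + t)) 0 * (z * (axialMean 0 R t z ^ 2 + axialMean 1 R t z ^ 2))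
    + 2 * max (M - (z + t)) 0 ^ 2 * z * axialMean 0 R t z * axialMean 0 S t z
    + 2 * max (M - (z + t)) 0 ^ 2 * z * axialMean 1 R t z * axialMean 1 S t z

namespace IsPiecewisePrimitive

variable {R S : ℝ → ℝ}

theorem hasDerivAt_coneEnergyDensity (h : IsPiecewisePrimitive R S) (M t : ℝ) {z : ℝ}
    (hz : 0 < z) :
    HasDerivAt (fun t => coneEnergyDensity R M t z) (coneEnergyDensityDeriv R S M t z) t := by
  have h1 : HasDerivAt (fun t => M - (z + t)) (-1) t := by
    simpa using ((hasDerivAt_id t).const_add z).const_sub M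
  have h2 := (hasDerivAt_max_zero_sq (M - (z + t))).comp t h1
  have h3 := (((h.hasDerivAt_axialMean_time 0 t hz).fun_pow 2).fun_add
    ((h.hasDerivAt_axialMean_time 1 t hz).fun_pow 2)).const_mul z
  refine (h2.mul h3).congr_deriv ?_
  simp only [coneEnergyDensityDeriv, Function.comp_apply]
  push_cast
  ring

theorem exists_bound_coneEnergyDensityDeriv (h : IsPiecewisePrimitive R S) (M t : ℝ) :
    ∃ B, ∀ x ∈ Metric.ball t 1, ∀ z ∈ Ioc 0 M, ‖coneEnergyDensityDeriv R S M x z‖ ≤ B := by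
  have hc0 := continuous_axialMean h.continuous 0
  have hc1 := continuous_axialMean h.continuous 1
  obtain ⟨C, hC⟩ := h.exists_abs_axialMean_le (|t| + 1 + M)
  have hK : IsCompact (Metric.closedBall t 1 ×ˢ Icc 0 M) :=
    (isCompact_closedBall t 1).prod isCompact_Icc
  obtain ⟨B₁, hB₁⟩ := hK.exists_bound_of_continuousOn (f := fun p : ℝ × ℝ =>
    -2 * max (M - (p.2 + p.1)) 0 *
      (p.2 * (axialMean 0 R p.1 p.2 ^ 2 + axialMean 1 R p.1 p.2 ^ 2))) (by fun_prop)
  obtain ⟨B₂, hB₂⟩ := hK.exists_bound_of_continuousOn (f := fun p : ℝ × ℝ =>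
    2 * max (M - (p.2 + p.1)) 0 ^ 2 * p.2 * axialMean 0 R p.1 p.2) (by fun_prop)
  obtain ⟨B₃, hB₃⟩ := hK.exists_bound_of_continuousOn (f := fun p : ℝ × ℝ =>
    2 * max (M - (p.2 + p.1)) 0 ^ 2 * p.2 * axialMean 1 R p.1 p.2) (by fun_prop)
  refine ⟨B₁ + B₂ * C + B₃ * C, fun x hx z hz => ?_⟩
  have hmem : (x, z) ∈ Metric.closedBall t 1 ×ˢ Icc 0 M :=
    ⟨Metric.ball_subset_closedBall hx, hz.1.le, hz.2⟩
  have hxz : |x| + |z| ≤ |t| + 1 + M := by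
    have h1 := Metric.mem_ball.1 hx
    rw [dist_eq] at h1
    have h2 := abs_sub_abs_le_abs_sub x t
    rw [abs_of_pos hz.1]
    linarith [hz.2]
  have h1 := hB₁ _ hmem
  have h2 := hB₂ _ hmem
  have h3 := hB₃ _ hmem
  have h4 := hC 0 x z hxz
  have h5 := hC 1 x z hxz
  simp only [coneEnergyDensityDeriv] at h1 h2 h3 ⊢
  generalize -2 * max (M - (z + x)) 0 *
    (z * (axialMean 0 R x z ^ 2 + axialMean 1 R x z ^ 2)) = a at h1 ⊢
  generalize 2 * max (M - (z + x)) 0 ^ 2 * z * axialMean 0 R x z = b at h2 ⊢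
  generalize 2 * max (M - (z + x)) 0 ^ 2 * z * axialMean 1 R x z = c at h3 ⊢
  refine norm_add₃_le.trans (add_le_add (add_le_add h1 ?_) ?_)
  · rw [norm_mul]
    exact mul_le_mul h2 h4 (norm_nonneg _) ((norm_nonneg _).trans h2)
  · rw [norm_mul]
    exact mul_le_mul h3 h5 (norm_nonneg _) ((norm_nonneg _).trans h3)

theorem hasDerivAt_integral_coneEnergyDensity (h : IsPiecewisePrimitive R S) {M : ℝ} (hM : 0 ≤ M)
    (t : ℝ) : HasDerivAt (fun t => ∫ z in 0..M, coneEnergyDensity R M t z)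
      (∫ z in 0..M, coneEnergyDensityDeriv R S M t z) t := by
  have hce := continuous_coneEnergyDensity h.continuous M
  obtain ⟨B, hB⟩ := h.exists_bound_coneEnergyDensityDeriv M t
  refine (intervalIntegral.hasDerivAt_integral_of_dominated_loc_of_deriv_le
    (F' := coneEnergyDensityDeriv R S M) (bound := fun _ => B) (Metric.ball_mem_nhds t one_pos)
    (.of_forall fun x => (hce.comp (f := fun z => (x, z)) (by fun_prop)).aestronglyMeasurable)
    ((hce.comp (f := fun z => (t, z)) (by fun_prop)).intervalIntegrable _ _) ?_ ?_
    intervalIntegrable_const ?_).2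
  · rw [uIoc_of_le hM]
    refine ContinuousOn.aestronglyMeasurable (fun z hz => ?_) measurableSet_Ioc
    have hS : ∀ j, ContinuousAt (fun z => axialMean j S t z) z := fun j =>
      (h.continuousAt_axialMean j t hz.1).comp (f := fun z => (t, z)) (by fun_prop)
    have hS0 := hS 0
    have hS1 := hS 1
    have hr0 := continuous_axialMean_right h.continuous 0 t
    have hr1 := continuous_axialMean_right h.continuous 1 t
    unfold coneEnergyDensityDeriv
    exact ContinuousAt.continuousWithinAt (by fun_prop)
  · refine .of_forall fun z hz x hx => hB x hx z ?_
    rwa [uIoc_of_le hM] at hz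
  · refine .of_forall fun z hz x _ => ?_
    rw [uIoc_of_le hM] at hz
    exact h.hasDerivAt_coneEnergyDensity M x hz.1

/-- The energy identity with the weight `χ²`, `χ = max (M - (z + t)) 0`. With `a`, `b` the time and
space derivatives of the wave, the derivative of the density is the `z`-derivative of the flux `2 χ²
z a b` minus `2 χ z (a - b)²`. The squared cut-off is used because it is `C¹`. -/
theorem antitoneOn_coneEnergy (h : IsPiecewisePrimitive R S) {M : ℝ} (hM : 0 ≤ M) :
    AntitoneOn (fun t => ∫ z in 0..M, coneEnergyDensity R M t z) (Ici 0) := by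
  have hR := h.continuous
  have hE := h.hasDerivAt_integral_coneEnergyDensity hM
  refine antitoneOn_of_deriv_nonpos (convex_Ici 0)
    (fun t _ => (hE t).continuousAt.continuousWithinAt)
    (fun t _ => (hE t).differentiableAt.differentiableWithinAt) fun t ht => ?_
  rw [interior_Ici] at ht
  rw [(hE t).deriv]
  have hr : ∀ j, Continuous fun z => axialMean j R t z := fun j => continuous_axialMean_right hR j t
  have hr0 := hr 0
  have hr1 := hr 1
  have hS := fun j => h.intervalIntegrable_axialMean j t hM
  let K : ℝ → ℝ := fun z =>
    -2 * max (M - (z + t)) 0 * (2 * (z * (axialMean 0 R t z * axialMean 1 R t z)))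
    + max (M - (z + t)) 0 ^ 2 * (2 * (axialMean 0 R t z * axialMean 1 R t z))
    + 2 * max (M - (z + t)) 0 ^ 2 * z * axialMean 1 R t z * axialMean 1 S t z
    + 2 * max (M - (z + t)) 0 ^ 2 * z * axialMean 0 R t z * axialMean 2 S t z
  have hKi : IntervalIntegrable K volume 0 M :=
    ((Continuous.intervalIntegrable (by fun_prop) _ _).add
      ((hS 1).continuousOn_mul (Continuous.continuousOn (by fun_prop)))).add
      ((hS 2).continuousOn_mul (Continuous.continuousOn (by fun_prop)))
  have hDi : IntervalIntegrable (coneEnergyDensityDeriv R S M t) volume 0 M :=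
    ((Continuous.intervalIntegrable (by fun_prop) _ _).add
      ((hS 0).continuousOn_mul (Continuous.continuousOn (by fun_prop)))).add
      ((hS 1).continuousOn_mul (Continuous.continuousOn (by fun_prop)))
  -- The flux vanishes at `z = 0` because of the factor `z`, and at `z = M` because the cut-off is
  -- zero there for `t > 0`.
  have hK0 : ∫ z in 0..M, K z = 0 := by
    rw [intervalIntegral.integral_eq_sub_of_hasDerivAt_of_le hM (f := fun z =>
      max (M - (z + t)) 0 ^ 2 * (2 * (z * (axialMean 0 R t z * axialMean 1 R t z))))
      (by fun_prop) (fun z hz => ?_) hKi]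
    · simp [le_of_lt (mem_Ioi.1 ht)]
    · have h1 : HasDerivAt (fun z => M - (z + t)) (-1) z := by
        simpa using ((hasDerivAt_id z).add_const t).const_sub M
      have h2 := (hasDerivAt_max_zero_sq (M - (z + t))).comp z h1
      have h3 := ((hasDerivAt_id' z).fun_mul ((h.hasDerivAt_axialMean_space 0 t hz.1).fun_mul
        (h.hasDerivAt_axialMean_space 1 t hz.1))).const_mul 2
      refine (h2.mul h3).congr_deriv ?_
      simp only [K, Function.comp_apply, zero_add, one_add_one_eq_two]
      ring
  refine le_of_le_of_eq ?_ hK0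
  refine intervalIntegral.integral_mono_on_of_le_Ioo hM hDi hKi fun z hz => ?_
  have h1 : 0 ≤ max (M - (z + t)) 0 * (z * (axialMean 0 R t z - axialMean 1 R t z) ^ 2) :=
    mul_nonneg (le_max_right _ _) (mul_nonneg hz.1.le (sq_nonneg _))
  have h2 : K z - coneEnergyDensityDeriv R S M t z =
      2 * (max (M - (z + t)) 0 * (z * (axialMean 0 R t z - axialMean 1 R t z) ^ 2)) := by
    simp only [K, coneEnergyDensityDeriv, h.axialMean_add_two t hz.1]
    have := hz.1.ne'
    field_simp
    ring
  linarith

end IsPiecewisePrimitive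

/-! ### Existence of finite-energy waves -/

theorem memLp_halfLineMeasure_of_continuous {u : ℝ → ℝ} (hu : Continuous u) {C : ℝ}
    (hC : ∀ r ≥ 0, ∫ z in 0..r, z * u z ^ 2 ≤ C) : MemLp u 2 halfLineMeasure := by
  rw [memLp_two_iff_integrable_sq hu.aestronglyMeasurable, halfLineMeasure,
    integrable_withDensity_iff (by fun_prop) (by simp)]
  have hi : ∀ r, IntervalIntegrable (fun z => z * u z ^ 2) volume 0 r := fun r =>
    Continuous.intervalIntegrable (by fun_prop) _ _
  have h1 : IntegrableOn (fun z => z * u z ^ 2) (Ioi 0) := by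
    refine integrableOn_Ioi_of_intervalIntegral_norm_bounded C 0
      (fun r => (hi r).1) tendsto_id ?_
    filter_upwards [Ici_mem_atTop 0] with r hr
    refine le_of_eq_of_le (intervalIntegral.integral_congr fun z hz => ?_) (hC r hr)
    rw [uIcc_of_le hr] at hz
    simp only [norm_eq_abs]
    exact abs_of_nonneg (mul_nonneg hz.1 (sq_nonneg _))
  refine IntegrableOn.congr_fun h1 (fun z hz => ?_) measurableSet_Ioi
  rw [ENNReal.toReal_ofReal (le_of_lt hz), mul_comm]

theorem MemLp.exists_integral_mul_sq_le {u : ℝ → ℝ} (hu : MemLp u 2 halfLineMeasure) :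
    ∃ C, ∀ r ≥ 0, ∫ z in 0..r, z * u z ^ 2 ≤ C := by
  have h1 := hu.integrable_sq
  rw [halfLineMeasure, integrable_withDensity_iff (by fun_prop) (by simp)] at h1
  have h2 : IntegrableOn (fun z => z * u z ^ 2) (Ioi 0) :=
    IntegrableOn.congr_fun h1 (fun z hz => by
      rw [ENNReal.toReal_ofReal (le_of_lt hz), mul_comm]) measurableSet_Ioi
  refine ⟨∫ z in Ioi 0, z * u z ^ 2, fun r hr => ?_⟩
  rw [intervalIntegral.integral_of_le hr]
  refine setIntegral_mono_set h2 ?_ (.of_forall fun z hz => hz.1)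
  exact (ae_restrict_iff' measurableSet_Ioi).2
    (.of_forall fun z hz => mul_nonneg (le_of_lt hz) (sq_nonneg _))

namespace IsPiecewisePrimitive

variable {R S : ℝ → ℝ}

/-- Monotonicity of the cone energy with `M = 2 (t + r)`: at time `t` the weight is at least `(t +
r)²` on `z ≤ r`, and at time `0` it is at most `4 (t + r)²`. The constant does not depend on `r`, so
letting `r` grow gives global integrability. -/
theorem integral_energy_le (h : IsPiecewisePrimitive R S) {t r : ℝ} (ht : 0 ≤ t) (hr : 0 < r) :
    ∫ z in 0..r, z * (axialMean 0 R t z ^ 2 + axialMean 1 R t z ^ 2)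
      ≤ 4 * ∫ z in 0..2 * (t + r), z * (axialMean 0 R 0 z ^ 2 + axialMean 1 R 0 z ^ 2) := by
  have hM : 0 ≤ 2 * (t + r) := by positivity
  have hmono := h.antitoneOn_coneEnergy hM self_mem_Ici (mem_Ici.2 ht) ht
  have hce := continuous_coneEnergyDensity h.continuous (2 * (t + r))
  have hct : ∀ t, Continuous (coneEnergyDensity R (2 * (t + r)) t) := fun t =>
    (continuous_coneEnergyDensity h.continuous _).comp (f := fun z => (t, z)) (by fun_prop)
  have hr0 := fun t => continuous_axialMean_right h.continuous 0 t
  have hr1 := fun t => continuous_axialMean_right h.continuous 1 t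
  have hr0t := hr0 t
  have hr1t := hr1 t
  have hr00 := hr0 0
  have hr10 := hr1 0
  have hnonneg : ∀ M t, ∀ z ≥ 0, 0 ≤ coneEnergyDensity R M t z := fun M t z hz => by
    unfold coneEnergyDensity; positivity
  have h1 : (t + r) ^ 2 * ∫ z in 0..r, z * (axialMean 0 R t z ^ 2 + axialMean 1 R t z ^ 2)
      ≤ ∫ z in 0..2 * (t + r), coneEnergyDensity R (2 * (t + r)) t z := by
    rw [← intervalIntegral.integral_const_mul]
    refine (intervalIntegral.integral_mono_on hr.le (Continuous.intervalIntegrable (by fun_prop) _ _)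
      ((hct t).intervalIntegrable 0 r) fun z hz => ?_).trans
      (intervalIntegral.integral_mono_interval le_rfl hr.le (by linarith)
        ((ae_restrict_iff' measurableSet_Ioc).2 (.of_forall fun z hz => hnonneg _ t z hz.1.le))
        ((hct t).intervalIntegrable _ _))
    refine mul_le_mul_of_nonneg_right ?_ (by have := hz.1; positivity)
    exact pow_le_pow_left₀ (by positivity) ((by linarith [hz.2] : t + r ≤ _).trans
      (le_max_left _ _)) 2
  have h2 : ∫ z in 0..2 * (t + r), coneEnergyDensity R (2 * (t + r)) 0 z
      ≤ (2 * (t + r)) ^ 2 *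
        ∫ z in 0..2 * (t + r), z * (axialMean 0 R 0 z ^ 2 + axialMean 1 R 0 z ^ 2) := by
    rw [← intervalIntegral.integral_const_mul]
    refine intervalIntegral.integral_mono_on hM
      ((hce.comp (f := fun z => (0, z)) (by fun_prop)).intervalIntegrable _ _)
      (Continuous.intervalIntegrable (by fun_prop) _ _) fun z hz => ?_
    refine mul_le_mul_of_nonneg_right ?_ (by have := hz.1; positivity)
    exact pow_le_pow_left₀ (le_max_right _ _) (max_le (by linarith [hz.1]) hM) 2
  have h3 : 0 < (t + r) ^ 2 := by positivity
  refine le_of_mul_le_mul_left (h1.trans (hmono.trans (h2.trans (le_of_eq ?_)))) h3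
  ring

theorem memLp_axialMean (h : IsPiecewisePrimitive R S)
    (h0 : MemLp (axialMean 0 R 0) 2 halfLineMeasure)
    (h1 : MemLp (axialMean 1 R 0) 2 halfLineMeasure) {t : ℝ} (ht : 0 ≤ t) :
    MemLp (axialMean 0 R t) 2 halfLineMeasure ∧ MemLp (axialMean 1 R t) 2 halfLineMeasure := by
  obtain ⟨C₀, hC₀⟩ := MemLp.exists_integral_mul_sq_le h0
  obtain ⟨C₁, hC₁⟩ := MemLp.exists_integral_mul_sq_le h1
  have hr : ∀ j t, Continuous (axialMean j R t) := fun j t =>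
    continuous_axialMean_right h.continuous j t
  have hi : ∀ j t r, IntervalIntegrable (fun z => z * axialMean j R t z ^ 2) volume 0 r :=
    fun j t r => (continuous_id.mul ((hr j t).pow 2)).intervalIntegrable _ _
  have hn : ∀ j, ∀ r ≥ 0, 0 ≤ ∫ z in 0..r, z * axialMean j R t z ^ 2 := fun j r hr =>
    intervalIntegral.integral_nonneg hr fun z hz => mul_nonneg hz.1 (sq_nonneg _)
  have key : ∀ r ≥ 0, (∫ z in 0..r, z * axialMean 0 R t z ^ 2)
      + ∫ z in 0..r, z * axialMean 1 R t z ^ 2 ≤ 4 * (C₀ + C₁) := by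
    intro r hr
    rcases hr.eq_or_lt with rfl | hr
    · have := hC₀ 0 le_rfl
      have := hC₁ 0 le_rfl
      simp only [intervalIntegral.integral_same] at *
      linarith
    · have h2 := h.integral_energy_le ht hr
      simp only [mul_add _ (_ ^ 2)] at h2
      rw [intervalIntegral.integral_add (hi _ _ _) (hi _ _ _),
        intervalIntegral.integral_add (hi _ _ _) (hi _ _ _)] at h2
      have hp : 0 ≤ 2 * (t + r) := by positivity
      linarith [hC₀ _ hp, hC₁ _ hp]
  exact ⟨memLp_halfLineMeasure_of_continuous (hr 0 t) (C := 4 * (C₀ + C₁)) fun r hr => by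
      linarith [key r hr, hn 1 r hr],
    memLp_halfLineMeasure_of_continuous (hr 1 t) (C := 4 * (C₀ + C₁)) fun r hr => by
      linarith [key r hr, hn 0 r hr]⟩

end IsPiecewisePrimitive

/-- Differentiating `axialMean 1 P 0 z = (∫ ζ g) / z` in `z` and using `axialMean_add_two` isolates
the mean of `P'`, so the derivative of the profile never has to be computed. -/
theorem axialMean_zero_deriv_waveProfile {f g R : ℝ → ℝ} (hf : ContDiffOn ℝ 1 f (Ici 0))
    (hg : ContinuousOn g (Ici 0)) (hR : IsPiecewisePrimitive (waveProfile f g) R) {z : ℝ}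
    (hz : 0 < z) : axialMean 0 R 0 z = g z := by
  have hg' : Continuous fun x => g |x| :=
    hg.comp_continuous continuous_abs fun x => abs_nonneg x
  have hone : ∀ z > 0, axialMean 1 (waveProfile f g) 0 z = (∫ ζ in 0..z, ζ * g |ζ|) / z :=
    fun z hz => axialMean_one_axisProfile (f 0) (exists_primitive_of_contDiffOn hf).1 hg' hz
  have h1 : HasDerivAt (fun z => ∫ ζ in 0..z, ζ * g |ζ|) (z * g |z|) z :=
    ((continuous_id.mul hg').integral_hasStrictDerivAt 0 z).hasDerivAt
  have h2 := h1.fun_div (hasDerivAt_id z) hz.ne'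
  have h3 := (hR.hasDerivAt_axialMean_space 1 0 hz).congr_of_eventuallyEq
    (show (fun z => (∫ ζ in 0..z, ζ * g |ζ|) / z) =ᶠ[𝓝 z] _ by
      filter_upwards [lt_mem_nhds hz] with y hy using (hone y hy).symm)
  have h4 := h2.unique h3
  simp only [one_add_one_eq_two, hR.axialMean_add_two 0 hz, hone z hz, abs_of_pos hz, id] at h4
  have h5 := hz.ne'
  generalize axialMean 0 R 0 z = a at h4 ⊢
  field_simp at h4
  exact mul_left_cancel₀ (pow_ne_zero 2 h5) (by linarith)

theorem ae_pos_halfLineMeasure : ∀ᵐ z ∂halfLineMeasure, 0 < z :=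
  (withDensity_absolutelyContinuous _ _).ae_le (ae_restrict_mem measurableSet_Ioi)

theorem isVerticalWave_axialMean {f g : ℝ → ℝ} (hf : ContDiffOn ℝ 3 f (Ici 0))
    (hf0 : derivWithin f (Ici 0) 0 = 0) (hg : ContDiffOn ℝ 2 g (Ici 0))
    (hfL : MemLp (derivWithin f (Ici 0)) 2 halfLineMeasure) (hgL : MemLp g 2 halfLineMeasure) :
    IsVerticalWave f g (axialMean 0 (waveProfile f g)) := by
  obtain ⟨R, S, hP, hR⟩ := exists_isPiecewisePrimitive_waveProfile hf hf0 hg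
  have hf1 : ContDiffOn ℝ 1 f (Ici 0) := hf.of_le (by norm_num)
  have ht : ∀ t ≥ 0, ∀ z > 0,
      derivWithin (fun s => axialMean 0 (waveProfile f g) s z) (Ici 0) t = axialMean 0 R t z :=
    fun t ht z hz =>
      (hP.hasDerivAt_axialMean_time 0 t hz).hasDerivWithinAt.derivWithin (uniqueDiffOn_Ici 0 t ht)
  have hz : ∀ t, ∀ z > 0, deriv (fun y => axialMean 0 (waveProfile f g) t y) z
      = axialMean 1 R t z := fun t z hz => (hP.hasDerivAt_axialMean_space 0 t hz).deriv
  have h0 : ∀ z > 0, axialMean 0 R 0 z = g z := fun z hz =>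
    axialMean_zero_deriv_waveProfile hf1 hg.continuousOn hP hz
  have h1 : ∀ z > 0, axialMean 1 R 0 z = derivWithin f (Ici 0) z := fun z hz => by
    rw [derivWithin_of_mem_nhds (Ici_mem_nhds hz)]
    refine ((hP.hasDerivAt_axialMean_space 0 0 hz).congr_of_eventuallyEq ?_).deriv.symm
    filter_upwards [lt_mem_nhds hz] with y hy
    rw [axialMean_zero_waveProfile hf1 hg.continuousOn hy]
  have hL := fun t (ht : 0 ≤ t) => hR.memLp_axialMean
    (hgL.ae_eq (ae_pos_halfLineMeasure.mono fun z hz => (h0 z hz).symm))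
    (hfL.ae_eq (ae_pos_halfLineMeasure.mono fun z hz => (h1 z hz).symm)) ht
  exact
    { contDiffOn := (hP.contDiffOn_axialMean hR).mono (prod_mono_left (subset_univ _))
      wave_eq := fun t _ z hz => hP.wave_eq_axialMean hR t hz
      initial_value := fun z hz => axialMean_zero_waveProfile hf1 hg.continuousOn hz
      initial_velocity := fun z hz => (ht 0 le_rfl z hz).trans (h0 z hz)
      memLp_time_deriv := fun t htt =>
        (hL t htt).1.ae_eq (ae_pos_halfLineMeasure.mono fun z hz => (ht t htt z hz).symm)
      memLp_space_deriv := fun t htt =>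
        (hL t htt).2.ae_eq (ae_pos_halfLineMeasure.mono fun z h => (hz t z h).symm) }

/-! ### The representation formulas, the trace and existence -/

theorem mainTheorem11 (f g : ℝ → ℝ)
    (hf : ContDiffOn ℝ 1 f (Ici 0)) (hg : ContinuousOn g (Ici 0)) :
    -- every finite-energy solution is given by the explicit formulas, and has the stated trace
    (∀ φ : ℝ → ℝ → ℝ, IsVerticalWave f g φ →
      (∀ t z : ℝ, 0 ≤ t → 0 < z → t ≤ z →
        IntervalIntegrable (earlyIntegrand₁ f t z) volume (z - t) (z + t) ∧
        IntervalIntegrable (earlyIntegrand₂ g t z) volume (z - t) (z + t) ∧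
        φ t z =
          1 / 2 * √(1 - t / z) * f (z - t) + 1 / 2 * √(1 + t / z) * f (z + t)
          + t / (16 * z * √z) * (∫ ζ in (z - t)..(z + t), earlyIntegrand₁ f t z ζ)
          + 1 / (2 * √z) * (∫ ζ in (z - t)..(z + t), earlyIntegrand₂ g t z ζ)) ∧
      (∀ t z : ℝ, 0 < z → z ≤ t →
        IntervalIntegrable (lateIntegrand₁ f g t z) volume 0 (t - z) ∧
        IntervalIntegrable (lateIntegrand₂ f t z) volume 0 (t - z) ∧
        IntervalIntegrable (lateIntegrand₃ f t z) volume 0 (t - z) ∧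
        IntervalIntegrable (lateIntegrand₄ f g t z) volume (t - z) (t + z) ∧
        IntervalIntegrable (lateIntegrand₅ f t z) volume (t - z) (t + z) ∧
        φ t z =
          (∫ ζ in 0..(t - z), lateIntegrand₁ f g t z ζ)
          + (t - z) * (∫ ζ in 0..(t - z), lateIntegrand₂ f t z ζ)
          + z * (∫ ζ in 0..(t - z), lateIntegrand₃ f t z ζ)
          + 1 / (2 * √z) * (∫ ζ in (t - z)..(t + z), lateIntegrand₄ f g t z ζ)
          + 1 / (32 * z * √z) * (∫ ζ in (t - z)..(t + z), lateIntegrand₅ f t z ζ)) ∧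
      (∀ t : ℝ, 0 ≤ t →
        IntervalIntegrable (traceIntegrand f g t) volume 0 t ∧
        Tendsto (fun z => φ t z) (𝓝[>] 0)
          (𝓝 (f 0 + ∫ ζ in 0..t, traceIntegrand f g t ζ)))) ∧
    -- for smooth enough data of finite energy such a solution exists
    (ContDiffOn ℝ 3 f (Ici 0) → derivWithin f (Ici 0) 0 = 0 → ContDiffOn ℝ 2 g (Ici 0) →
      MemLp (derivWithin f (Ici 0)) 2 halfLineMeasure → MemLp g 2 halfLineMeasure →
      ∃ φ : ℝ → ℝ → ℝ, IsVerticalWave f g φ) := by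
  refine ⟨fun φ h => ⟨fun t z ht hz htz => ?_, fun t z hz htz => ?_, fun t ht => ?_⟩,
    fun hf3 hf0 hg2 hfL hgL => ⟨_, isVerticalWave_axialMean hf3 hf0 hg2 hfL hgL⟩⟩
  · rw [h.eq_axialMean hf hg ht hz]
    exact axialMean_waveProfile_early hf hg ht hz htz
  · rw [h.eq_axialMean hf hg (hz.le.trans htz) hz]
    exact axialMean_waveProfile_late hf hg hz htz
  · obtain ⟨hi, he⟩ := intervalIntegrable_traceIntegrand hf hg ht
    exact ⟨hi, he ▸ h.tendsto_trace hf hg ht⟩
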